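/- **Setting.** Let $\Sigma=\{\rho\ge 0\}\subset\mathbb R^n$ be a region with smooth boundary $\partial\Sigma=\{\rho=0\}$ ($\rho$ smooth, $d\rho\neq0$ on $\partial\Sigma$). Consider a Hamiltonian gauge field theory with canonical fields $z^A$, Poisson matrix $\sigma^{AB}$ (constant, antisymmetric, invertible, with inverse $\sigma_{AB}$), Lagrange multipliers $\lambda^a$, action $$S=\int dt\Big\{\int_\Sigma \tfrac12 z^A\sigma_{AB}\dot z^B-H\Big\},\qquad H=\int_\Sigma\big(h(z)+\lambda^a\phi_a(z)\big)+\oint_{\partial\Sigma}b_H(z,\lambda),$$ first-class constraints $\phi_a$, first-class $h$, and internal boundary conditions $\chi_I^\alpha(z,\lambda)|_{\partial\Sigma}=\zeta^\alpha$, all local and time independent. At fixed time the independent fields are $z^A$ and $\lambda^{(l)a}=\partial_t^l\lambda^a$, $l\ge0$. The external boundary conditions are $\partial_{(i)}\phi_a|_{\partial\Sigma}=0$ and $\partial_{(i)}(\dot z^A-\sigma^{AB}\delta H/\delta z^B)|_{\partial\Sigma}=0$. Local functions are smooth functions of $t$, $x$ and finitely many spatial derivatives of these fields, and functionals are integrals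 of local functions over $\Sigma$. "Weakly zero" ($\approx0$) means zero modulo the ideal generated by the $\partial_{(i)}\phi_a$; on $\partial\Sigma$ local functions are identified modulo this ideal, and functionals are identified modulo total divergences whose flux through $\partial\Sigma$ vanishes in this sense. Put $\delta_t=\partial_t+\delta_H$ with $\delta_Hz^A=\sigma^{AB}\delta H/\delta z^B$, $\delta_H\lambda^{(l)}=\lambda^{(l+1)}$. A variation $\delta$ preserves the internal boundary conditions if it preserves the external ones and $\delta(\delta_t^k\chi_I^\alpha)|_{\partial\Sigma}=0$ for all $k\ge0$; $H$ is assumed to have no boundary term in its variation under such $\delta$. A couple $(G,\delta^\lambda_G)$ is a functional $G[t,z,\lambda,\dot\lambda,\dots]$ with local functions $\delta^\lambda_G\lambda^a=\Lambda_G^a$. It generates the transformation $\delta_Gz^A=Z_G^A=\sigma^{AB}\delta G/\delta z^B$, $\delta_G\lambda^a=\Lambda_G^a$; let $\tilde\delta_G$ be given by $\tilde\delta_Gz^A=Z_G^A$, $\tilde\delta_G\lambda^{(l)a}=\delta_t^l\Lambda_G^a$. The couple generates an *external symmetry* if 1. $[\delta_G,\delta]\chi_I^\alpha|_{\partial\Sigma}=0$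 and $\delta G=\int_\Sigma\big(\frac{\delta G}{\delta z^A}\delta z^A+\sum_l\frac{\delta G}{\delta\lambda^{(l)a}}\delta\lambda^{(l)a}\big)$ for every $\delta$ preserving the internal boundary conditions; 2. the action is invariant in the sense $\delta_GS=\int dt\,\{\frac{d}{dt}(\int_\Sigma\frac12z^A\sigma_{AB}Z_G^B-G)+\oint_{\partial\Sigma}V_G\}$, where $\delta\oint_{\partial\Sigma} V_G=0$ for every such $\delta$ (here $\dot z$ is arbitrary apart from the external boundary conditions). It generates a *proper gauge transformation* if moreover $\delta_G\chi_I^\alpha|_{\partial\Sigma}=0$ and $G\approx0$. External symmetries (proper gauge transformations) are the transformations generated by such couples. The modified bracket of couples is $$[(G_1,\delta_1^\lambda),(G_2,\delta_2^\lambda)]=\big(\tilde\delta_1G_2-\tilde\delta_2G_1-\{G_2,G_1\},\ \delta^\lambda_{[1,2]}\big),\qquad \delta^\lambda_{[1,2]}\lambda^a=\tilde\delta_1\Lambda_2^a-\tilde\delta_2\Lambda_1^a,$$ with $\{F,G\}=\int_\Sigma\frac{\delta F}{\delta z^A}\sigma^{AB}\frac{\delta G}{\delta z^B}$. The bracket $\delta_{[1,2]}$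 of transformations is the representative of the commutator $[\delta_1,\delta_2]$ modulo trivial symmetries which is free of time derivatives of $z$: its action on $\lambda^a$ is as above, and $$\delta_{[1,2]}z^A=\tilde\delta_1Z_2^A+\sum_{l\ge1}\sum_{k=0}^{l-1}\sigma^{AD}(-\partial)_{(j)}\Big(\frac{\partial(\delta_t^k\Lambda_1^b)}{\partial z^D_{(j)}}\,(-\delta_t)^{l-1-k}\frac{\delta(\phi_a\Lambda_2^a)}{\delta\lambda^{(l)b}}\Big)-(1\leftrightarrow2).$$ **Theorem.** (a) For any three couples generating external symmetries, $[[(G_1,\delta_1^\lambda),(G_2,\delta_2^\lambda)],(G_3,\delta_3^\lambda)]+\text{cyclic}=(G_J,\delta_J^\lambda)$ satisfies $G_J\approx0$ and generates a proper gauge transformation. (b) The couples generating external symmetries form a vector space $\mathcal C$ closed under the modified bracket, in which those generating proper gauge transformations form an ideal $\mathcal P$; likewise the external symmetries $\mathcal S$ with the bracket $\delta_{[1,2]}$ and the proper gauge transformations $\mathcal Q\subset\mathcal S$. The induced brackets make $\mathcal C/\mathcal P$ and $\mathcal S/\mathcal Q$ Lie algebras. (c) The map $(G,\delta^\lambda_G)\mapsto\delta_G$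 induces a surjective homomorphism of Lie algebras $\mathcal C/\mathcal P\to\mathcal S/\mathcal Q$, whose kernel consists of the classes of couples that generate the zero transformation. In this sense $\mathcal C/\mathcal P$ is a (possibly extended) representation of $\mathcal S/\mathcal Q$. (d) The modified bracket itself does not satisfy the Jacobi identity in general: there are such a theory with $\partial\Sigma\ne\emptyset$ and three couples generating external symmetries for which the functional $G_J$ is not zero. -/

import Mathlib

open scoped ContDiff

noncomputable section

namespace GaugeBracket

/-! ### Jet coordinates at a fixed time

At a fixed time the independent fields are the canonical fields `z^A` and the Lagrange multipliers
together with their time derivatives, `λ^a, ∂_t λ^a, ∂_t² λ^a, …`. -/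

/-- The fields at a fixed time: `z A` is `z^A`, and `lam a l` is the `l`-th time derivative of
the Lagrange multiplier `λ^a`. -/
inductive Fld (N m : ℕ) : Type
  | z (A : Fin N)
  | lam (a : Fin m) (l : ℕ)

/-- Spatial multi-indices. -/
abbrev MIdx (n : ℕ) := Fin n →₀ ℕ

/-- Coordinates of the jet space: time, position, and the spatial derivatives of the fields. -/
inductive Coord (n N m : ℕ) : Type
  | t
  | x (i : Fin n)
  | jet (u : Fld N m) (I : MIdx n)

/-- The (infinite) jet space. -/
abbrev Jet (n N m : ℕ) := Coord n N m → ℝ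

/-- Real functions on the jet space. -/
abbrev JFun (n N m : ℕ) := Jet n N m → ℝ

variable {n N m : ℕ}

/-- The point of space under a jet. -/
def base (p : Jet n N m) : Fin n → ℝ := fun i => p (.x i)

/-- Local functions: smooth functions of finitely many jet coordinates. -/
def IsLocal (f : JFun n N m) : Prop :=
  ∃ (S : Finset (Coord n N m)) (F : (S → ℝ) → ℝ), ContDiff ℝ ∞ F ∧ ∀ p, f p = F (fun s => p s)

open Classical in
/-- Partial derivative with respect to a jet coordinate. -/
def pd (c : Coord n N m) (f : JFun n N m) : JFun n N m :=
  fun p => deriv (fun s : ℝ => f (Function.update p c s)) (p c)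

/-- The total spatial derivative `∂_i`. -/
def totalD (i : Fin n) (f : JFun n N m) : JFun n N m := fun p =>
  pd (.x i) f p +
    ∑ᶠ c : Fld N m × MIdx n, p (.jet c.1 (c.2 + Finsupp.single i 1)) * pd (.jet c.1 c.2) f p

/-- The iterated total derivative `∂_{(I)}`. -/
def totalDI (I : MIdx n) (f : JFun n N m) : JFun n N m :=
  (List.finRange n).foldr (fun i g => (totalD i)^[I i] g) f

/-- The total divergence `∂_i k^i`. -/
def divg (k : Fin n → JFun n N m) : JFun n N m := ∑ i, totalD i (k i)

/-- The variation of a function of the fields under `δ u = Q u`, prolonged to all spatial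
derivatives (the evolutionary vector field with characteristic `Q`). -/
def evol (Q : Fld N m → JFun n N m) (f : JFun n N m) : JFun n N m := fun p =>
  ∑ᶠ c : Fld N m × MIdx n, totalDI c.2 (Q c.1) p * pd (.jet c.1 c.2) f p

/-- The formal adjoint, with respect to the field `u`, of the linearization of `f`, applied to `w`:
`∑_I (-∂)_{(I)} ((∂ f / ∂ u_{(I)}) w)`. -/
def adjLin (u : Fld N m) (f w : JFun n N m) : JFun n N m := fun p =>
  ∑ᶠ I : MIdx n, (-1 : ℝ) ^ I.degree * totalDI I (pd (.jet u I) f * w) p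

/-- The Euler-Lagrange derivative `δ f / δ u`. -/
def euler (u : Fld N m) (f : JFun n N m) : JFun n N m := adjLin u f 1

/-- The time derivative `∂_t + δ_w` where `δ_w` is `z^A ↦ w^A`, and where the time derivatives of
the multipliers are shifted, `λ^{(l)} ↦ λ^{(l+1)}`. -/
def timeD (w : Fin N → JFun n N m) (f : JFun n N m) : JFun n N m :=
  pd .t f + evol (fun u => match u with
    | .z A => w A
    | .lam a l => fun p => p (.jet (.lam a (l + 1)) 0)) f

/-- Jet coordinates on which functions of `z` alone may depend. -/
def zCoords : Set (Coord n N m) :=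
  {c | (∃ i, c = .x i) ∨ ∃ A I, c = .jet (.z A) I}

/-- Jet coordinates on which functions of `z` and `λ` may depend. -/
def zlamCoords : Set (Coord n N m) :=
  {c | (∃ i, c = .x i) ∨ (∃ A I, c = .jet (.z A) I) ∨ ∃ a I, c = .jet (.lam a 0) I}

/-! ### The theory -/

/-- The data of a gauge field theory with canonical fields `z^A`, `A < N`, and multipliers `λ^a`,
`a < m`, on the region `Σ = {ρ ≥ 0}` with boundary `{ρ = 0}`. The Hamiltonian is
`∫_Σ (h + λ^a φ_a) + ∮_{∂Σ} b^i` and the internal boundary conditions are `χ^α|_{∂Σ} = ζ^α`. -/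
structure GaugeData (n N m : ℕ) (ι : Type*) where
  /-- Defining function of the region. -/
  ρ : (Fin n → ℝ) → ℝ
  /-- The Poisson matrix `σ^{AB}`. -/
  σ : Matrix (Fin N) (Fin N) ℝ
  /-- The constraints. -/
  φ : Fin m → JFun n N m
  /-- The bulk Hamiltonian density without its constraint part. -/
  h : JFun n N m
  /-- The boundary term of the Hamiltonian. -/
  b : Fin n → JFun n N m
  /-- The internal boundary conditions. -/
  χ : ι → JFun n N m

namespace GaugeData

variable {ι : Type*} (T : GaugeData n N m ι)

/-- The spatial region `Σ`. -/
def region : Set (Fin n → ℝ) := {x | 0 ≤ T.ρ x}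

/-- Its boundary `∂Σ`. -/
def bdry : Set (Fin n → ℝ) := {x | T.ρ x = 0}

/-- Equality of functions on the jets over `Σ`. -/
def EqOnRegion (f g : JFun n N m) : Prop := ∀ p, base p ∈ T.region → f p = g p

/-- Over `K`, the function `f` lies in the ideal generated by the constraints and all their
spatial derivatives. -/
def InIdeal (K : Set (Fin n → ℝ)) (f : JFun n N m) : Prop :=
  ∃ (S : Finset (Fin m × MIdx n)) (c : Fin m × MIdx n → JFun n N m),
    (∀ s ∈ S, IsLocal (c s)) ∧
    ∀ p, base p ∈ K → f p = ∑ s ∈ S, c s p * totalDI s.2 (T.φ s.1) p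

/-- Weak equality to zero of a local function on `Σ`. -/
def Weak (f : JFun n N m) : Prop := T.InIdeal T.region f

/-- `f|_{∂Σ} = 0` for all fields that satisfy the external boundary conditions. At a fixed time
these are `∂_{(I)} φ_a|_{∂Σ} = 0`; the remaining ones, the equations of motion of `z` on the
boundary, say that there the time derivative of `z` is its Hamiltonian variation. -/
def BZero (f : JFun n N m) : Prop := T.InIdeal T.bdry f

/-- The local functional `∫_Σ f` is zero for all fields that satisfy the external boundary
conditions: `f` is a divergence `∂_i k^i` whose flux density through `∂Σ` vanishes under these
conditions. Local functionals `∫_Σ f` are represented by their densities `f`; a boundary term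
`∮_{∂Σ} k^i` is `∫_Σ ∂_i k^i`. -/
def IsNull (f : JFun n N m) : Prop :=
  ∃ k : Fin n → JFun n N m, (∀ i, IsLocal (k i)) ∧ T.EqOnRegion f (divg k) ∧
    T.BZero (fun p => ∑ i, fderiv ℝ T.ρ (base p) (Pi.single i 1) * k i p)

/-- The functional `∫_Σ f` is weakly zero. -/
def WeaklyZero (f : JFun n N m) : Prop :=
  ∃ e : JFun n N m, IsLocal e ∧ T.Weak e ∧ T.IsNull (f - e)

/-- The Hamiltonian variation `Z^A = σ^{AB} δ g / δ z^B`. -/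
def ham (g : JFun n N m) (A : Fin N) : JFun n N m := ∑ B, T.σ A B • euler (.z B) g

/-- The variation with characteristic `Z` on the canonical fields that leaves the multipliers
untouched. -/
def zVar (Z : Fin N → JFun n N m) : Fld N m → JFun n N m
  | .z A => Z A
  | .lam _ _ => 0

/-- The Poisson bracket `{f, g} = ∫_Σ (δf/δz^A) σ^{AB} (δg/δz^B)`. -/
def poisson (f g : JFun n N m) : JFun n N m := ∑ A, euler (.z A) f * T.ham g A

/-- The density `λ^a φ_a`. -/
def lamPhi : JFun n N m := fun p => ∑ a, p (.jet (.lam a 0) 0) * T.φ a p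

/-- The total Hamiltonian `H`. -/
def H : JFun n N m := T.h + T.lamPhi + divg T.b

/-- `δ_t = ∂_t + δ_H`, with `δ_H λ = ∂_t λ`. -/
def deltaT (f : JFun n N m) : JFun n N m := timeD (T.ham T.H) f

/-- Variations at a fixed time that preserve the internal boundary conditions: they preserve the
external boundary conditions, and they do not vary `χ^α` on the boundary, at any time; by the
equations of motion on the boundary the `k`-th time derivative of `χ^α` there is `δ_t^k χ^α`. -/
structure PreservesInternal (v : Fld N m → JFun n N m) : Prop where
  isLocal : ∀ u, IsLocal (v u)
  external : ∀ a I, T.BZero (evol v (totalDI I (T.φ a)))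
  internal : ∀ k α, T.BZero (evol v (T.deltaT^[k] (T.χ α)))

/-- The functional `∫_Σ g` has no boundary term in its variations that preserve the internal
boundary conditions. -/
def HasVariation (g : JFun n N m) : Prop :=
  ∀ v, T.PreservesInternal v →
    T.IsNull (evol v g - fun p => ∑ᶠ u : Fld N m, euler u g p * v u p)

/-- The functional `∫_Σ g` is invariant under the variations that preserve the internal boundary
conditions: it depends on the boundary sources only. -/
def SourceOnly (g : JFun n N m) : Prop :=
  ∀ v, T.PreservesInternal v → T.IsNull (evol v g)

/-- The standing assumptions on the theory. -/
structure IsGaugeTheory : Prop where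
  ρ_smooth : ContDiff ℝ ∞ T.ρ
  ρ_regular : ∀ x, T.ρ x = 0 → fderiv ℝ T.ρ x ≠ 0
  σ_skew : T.σ.transpose = -T.σ
  σ_unit : IsUnit T.σ.det
  φ_local : ∀ a, IsLocal (T.φ a)
  φ_dep : ∀ a, DependsOn (T.φ a) zCoords
  h_local : IsLocal T.h
  h_dep : DependsOn T.h zCoords
  b_local : ∀ i, IsLocal (T.b i)
  b_dep : ∀ i, DependsOn (T.b i) zlamCoords
  χ_local : ∀ α, IsLocal (T.χ α)
  χ_dep : ∀ α, DependsOn (T.χ α) zlamCoords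
  /-- The constraints are first class: `{φ_a, ∫ λ^b φ_b} ≈ 0` with arbitrary smearing fields. -/
  φ_firstClass : ∀ a, T.Weak (evol (zVar (T.ham T.lamPhi)) (T.φ a))
  /-- `h` is first class. -/
  h_firstClass : ∀ a, T.Weak (evol (zVar (T.ham T.h)) (T.φ a))
  /-- The Hamiltonian has a well-defined variation. -/
  H_variation : T.HasVariation T.H

/-! ### Couples, external symmetries and their brackets -/

end GaugeData

/-- Couples `(G, δ^λ_G)`: a (density of a) functional and the variation `Λ^a` of `λ^a`. -/
abbrev Couple (n N m : ℕ) := JFun n N m × (Fin m → JFun n N m)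

/-- Transformations `δ z^A = Z^A`, `δ λ^a = Λ^a`. -/
abbrev Transf (n N m : ℕ) := (Fin N → JFun n N m) × (Fin m → JFun n N m)

namespace GaugeData

variable {ι : Type*} (T : GaugeData n N m ι)

/-- The transformation `(σ^{AB} δG/δz^B, Λ^a)` generated by a couple. -/
def transf (c : Couple n N m) : Transf n N m := (T.ham c.1, c.2)

/-- The characteristic of `δ̃`: `z^A ↦ Z^A` and `λ^{(l)a} ↦ δ_t^l Λ^a`. -/
def tchar (τ : Transf n N m) : Fld N m → JFun n N m
  | .z A => τ.1 A
  | .lam a l => T.deltaT^[l] (τ.2 a)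

/-- The variation `δ̃` of a transformation. -/
def tilde (τ : Transf n N m) (f : JFun n N m) : JFun n N m := evol (T.tchar τ) f

/-- The variation under `τ` of the Lagrangian density `(1/2) z^A σ_{AB} ∂_t z^B - H`, where `w` is
the value of `∂_t z`. -/
def lagrangianVar (w : Fin N → JFun n N m) (τ : Transf n N m) : JFun n N m :=
  (fun p => ∑ A, ∑ B, (1 / 2 : ℝ) * T.σ⁻¹ A B *
    (τ.1 A p * w B p + p (.jet (.z A) 0) * timeD w (τ.1 B) p)) - T.tilde τ T.H

/-- `w` is an admissible value of `∂_t z`: it is arbitrary up to the equations of motion and their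
derivatives on the boundary. -/
def Velocity (w : Fin N → JFun n N m) : Prop :=
  (∀ A, IsLocal (w A)) ∧ ∀ A I, T.BZero (totalDI I (w A - T.ham T.H A))

/-- The couple `(G, δ^λ_G)` generates an external symmetry. -/
structure IsExternal (c : Couple n N m) : Prop where
  local_gen : IsLocal c.1
  local_lam : ∀ a, IsLocal (c.2 a)
  /-- `[δ_G, δ] χ^α = 0` on the boundary for all `δ` preserving the internal conditions. -/
  source : ∀ v, T.PreservesInternal v → ∀ α,
    T.BZero (T.tilde (T.transf c) (evol v (T.χ α)) - evol v (T.tilde (T.transf c) (T.χ α)))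
  /-- `G` has a well-defined variation. -/
  variation : T.HasVariation c.1
  /-- Invariance of the action up to sources, with canonical generator `G`:
  `δ_G L = d/dt ∫_Σ ((1/2) z^A σ_{AB} Z^B - G) + ∮_{∂Σ} V`, where the boundary term depends on
  the sources only. -/
  action : ∃ V : Fin n → JFun n N m, (∀ i, IsLocal (V i)) ∧ T.SourceOnly (divg V) ∧
    ∀ w, T.Velocity w → T.IsNull (T.lagrangianVar w (T.transf c) -
      timeD w ((fun p => ∑ A, ∑ B,
        (1 / 2 : ℝ) * T.σ⁻¹ A B * (p (.jet (.z A) 0) * T.ham c.1 B p)) - c.1) - divg V)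

/-- The couple generates a proper gauge transformation: an external symmetry that preserves the
internal boundary conditions and has a weakly vanishing generator. -/
structure IsProper (c : Couple n N m) : Prop where
  external : T.IsExternal c
  internal : ∀ α, T.BZero (T.tilde (T.transf c) (T.χ α))
  weak : T.WeaklyZero c.1

/-- The transformation `τ` is, over `Σ`, the one generated by the couple `c`. -/
def Generates (c : Couple n N m) (τ : Transf n N m) : Prop :=
  (∀ A, T.EqOnRegion (τ.1 A) ((T.transf c).1 A)) ∧ ∀ a, T.EqOnRegion (τ.2 a) ((T.transf c).2 a)

/-- Local transformations. -/
def LocalTransf (τ : Transf n N m) : Prop := (∀ A, IsLocal (τ.1 A)) ∧ ∀ a, IsLocal (τ.2 a)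

/-- `τ` is an external symmetry. -/
def IsExternalSymmetry (τ : Transf n N m) : Prop :=
  LocalTransf τ ∧ ∃ c, T.IsExternal c ∧ T.Generates c τ

/-- `τ` is a proper gauge transformation. -/
def IsProperGauge (τ : Transf n N m) : Prop :=
  LocalTransf τ ∧ ∃ c, T.IsProper c ∧ T.Generates c τ

/-- The modified bracket of couples,
`[(G₁, δ₁), (G₂, δ₂)] = (δ̃₁ G₂ - δ̃₂ G₁ - {G₂, G₁}, δ̃₁ Λ₂ - δ̃₂ Λ₁)`. -/
def cbr (c₁ c₂ : Couple n N m) : Couple n N m :=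
  (T.tilde (T.transf c₁) c₂.1 - T.tilde (T.transf c₂) c₁.1 - T.poisson c₂.1 c₁.1,
    fun a => T.tilde (T.transf c₁) (c₂.2 a) - T.tilde (T.transf c₂) (c₁.2 a))

/-- The cyclic sum `[[c₁, c₂], c₃] + cyclic`. -/
def jacobiator (c₁ c₂ c₃ : Couple n N m) : Couple n N m :=
  T.cbr (T.cbr c₁ c₂) c₃ + T.cbr (T.cbr c₂ c₃) c₁ + T.cbr (T.cbr c₃ c₁) c₂

/-- The density `φ_a Λ^a`. -/
def phiLam (Λ : Fin m → JFun n N m) : JFun n N m := ∑ a, T.φ a * Λ a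

/-- The first half of the `z^A`-component of the bracket of two transformations:
`δ̃₁ Z₂^A + ∑_{l ≥ 1} ∑_{k < l} σ^{AD} (-∂)_{(j)} ( ∂(δ_t^k Λ₁^b)/∂z^D_{(j)} ·
(-δ_t)^{l-1-k} (δ/δλ^{(l)b}) (φ_a Λ₂^a) )`. -/
def halfBr (τ₁ τ₂ : Transf n N m) (A : Fin N) : JFun n N m :=
  T.tilde τ₁ (τ₂.1 A) + fun p =>
    ∑ᶠ l : ℕ, ∑ k ∈ Finset.range l, ∑ D, ∑ a, T.σ A D *
      adjLin (.z D) (T.deltaT^[k] (τ₁.2 a))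
        ((-1 : ℝ) ^ (l - 1 - k) • T.deltaT^[l - 1 - k] (euler (.lam a l) (T.phiLam τ₂.2))) p

/-- The bracket of transformations: the commutator `[δ₁, δ₂]`, from which the time derivatives of
`z` have been removed by trivial symmetries. -/
def tbr (τ₁ τ₂ : Transf n N m) : Transf n N m :=
  (fun A => T.halfBr τ₁ τ₂ A - T.halfBr τ₂ τ₁ A,
    fun a => T.tilde τ₁ (τ₂.2 a) - T.tilde τ₂ (τ₁.2 a))

end GaugeData

/-- A bilinear map is a Lie bracket. -/
def IsLieBracket {M : Type*} [AddCommGroup M] [Module ℝ M] (B : M →ₗ[ℝ] M →ₗ[ℝ] M) : Prop :=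
  (∀ x, B x x = 0) ∧ ∀ x y w, B (B x y) w + B (B y w) x + B (B w x) y = 0

end GaugeBracket

end

/-!
Local functions form a commutative real algebra `Loc`, and variations, total derivatives and the
time derivative are derivations of it of the form `vf a = ∑_c a_c ∂/∂c`. The commutator of two such
fields is the field of the commutator characteristic (`vf_vf`), and the Euler-Lagrange derivatives
of `δ_Q g` are known in general (`el_evo`): `δ(δ_Q g)/δu` is `δ_Q` of `δg/δu` plus the adjoint
linearizations of `Q` applied to the derivatives of `g`. Two facts about the region are needed. A
local function that vanishes over `Σ` has partial derivatives that vanish there as well, because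
every boundary point is a limit of points with `ρ > 0`, by regularity of `ρ` (`pdl_mem_vanish`);
hence null functionals have Euler-Lagrange derivatives that vanish over `Σ`
(`LocTheory.el_mem_vanish`). And integration by parts against a factor that vanishes weakly has no
flux through the boundary (`LocTheory.parts`).

Invariance of the action for arbitrary velocities is equivalent to invariance along the Hamiltonian
flow, `δ_t G - {G, H} - δ̃_G H - ∮ V = 0` (`GaugeData.IsGaugeTheory.action_sub_defect`). Its
Euler-Lagrange derivatives give, with respect to `λ^{(l+1)}`, that `δG/δλ^{(l)} ≈ 0`
(`LocTheory.Ext.el_lam_mem`); with respect to `λ`, that `δ̃_G` preserves the constraints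
(`LocTheory.Ext.var_φ_mem`); and with respect to `z`, that `δ̃_G` and `δ_t` commute weakly
(`LocTheory.Ext.dt_var_sub_mem`). It follows that `δ̃` of a bracket is the commutator of the two
variations up to a variation `Y` with weakly vanishing characteristic (`LocTheory.var_br`,
`LocTheory.Ext.ychar_mem`). Such variations may be integrated by parts freely, so that the bracket
of external symmetries is one (`LocTheory.Ext.br`), and proper gauge transformations form an ideal
(`LocTheory.Ext.br_prop`).

In the cyclic sum of double brackets all terms cancel except those that contain `Y_{12}`, `Y_{23}`
or `Y_{31}` (`LocTheory.jac_fst`). These are weakly zero; and since commutators of variations do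
satisfy the Jacobi identity, the variation of `χ` on the boundary cancels too, so that the cyclic
sum is proper (`LocTheory.Ext.jac`). The passage to Lie algebras of classes is then formal, once the
bracket of transformations is identified, over `Σ`, with the transformation generated by the bracket
of couples (`GaugeData.IsGaugeTheory.tbr_val`, `exists_lieBrackets`).

The variation `Y` need not be zero. On the half line, with one canonical pair `(q, p)` and the
constraint `p`, the generators `∫ q² p`, `∫ q p²` and `∫ ∂_t λ p` with `δλ` equal to `δ_t q²`, `δ_t(q p)` and
`∂_t² λ` have the cyclic sum `-4 ∫ λ² p²`, which has a nonzero Euler-Lagrange derivative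
with respect to `λ` (`halfLine.jac_fst`).
-/

noncomputable section

namespace GaugeBracket

variable {n N m : ℕ}

/-! ### The algebra of local functions -/

open Classical in
theorem hasDerivAt_comp_restrict {f : JFun n N m} {S : Finset (Coord n N m)} {F : (S → ℝ) → ℝ}
    (hF : ContDiff ℝ ∞ F) (hf : ∀ p, f p = F (fun s => p s)) (c : Coord n N m) (p : Jet n N m) :
    HasDerivAt (fun s : ℝ => f (Function.update p c s))
      (if h : c ∈ S then fderiv ℝ F (fun s => p s) (Pi.single ⟨c, h⟩ 1) else 0) (p c) := by
  split_ifs with h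
  · have e : (fun s : ℝ => f (Function.update p c s)) =
        F ∘ (Function.update (fun s : S => p s) ⟨c, h⟩) := by
      funext s
      rw [hf, Function.comp_apply]
      congr 1
      funext s'
      by_cases hs : s' = ⟨c, h⟩
      · subst hs; simp
      · have : (s' : Coord n N m) ≠ c := fun hc => hs (Subtype.ext hc)
        rw [Function.update_of_ne this, Function.update_of_ne hs]
    rw [e]
    have h1 := hasDerivAt_update (fun s : S => p s) ⟨c, h⟩ (p c)
    have h2 : Function.update (fun s : S => p s) ⟨c, h⟩ (p c) = fun s : S => p s :=
      Function.update_eq_self (⟨c, h⟩ : S) (fun s : S => p s)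
    have h3 : HasFDerivAt F (fderiv ℝ F (fun s : S => p s))
        (Function.update (fun s : S => p s) ⟨c, h⟩ (p c)) := by
      rw [h2]
      exact (hF.differentiable (by simp) _).hasFDerivAt
    exact h3.comp_hasDerivAt (p c) h1
  · have e : (fun s : ℝ => f (Function.update p c s)) = fun _ => f p := by
      funext s
      rw [hf, hf]
      congr 1
      funext s'
      have : (s' : Coord n N m) ≠ c := fun hc => h (hc ▸ s'.2)
      rw [Function.update_of_ne this]
    rw [e]
    exact hasDerivAt_const _ _

open Classical in
theorem pd_eq_of_restrict {f : JFun n N m} {S : Finset (Coord n N m)} {F : (S → ℝ) → ℝ}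
    (hF : ContDiff ℝ ∞ F) (hf : ∀ p, f p = F (fun s => p s)) (c : Coord n N m) (p : Jet n N m) :
    pd c f p = if h : c ∈ S then fderiv ℝ F (fun s => p s) (Pi.single ⟨c, h⟩ 1) else 0 :=
  (hasDerivAt_comp_restrict hF hf c p).deriv

theorem IsLocal.hasDerivAt {f : JFun n N m} (hf : IsLocal f) (c : Coord n N m) (p : Jet n N m) :
    HasDerivAt (fun s : ℝ => f (@Function.update _ _ (Classical.decEq _) p c s))
      (pd c f p) (p c) := by
  obtain ⟨S, F, hF, hf⟩ := hf
  rw [pd_eq_of_restrict hF hf]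
  exact hasDerivAt_comp_restrict hF hf c p

theorem IsLocal.pd {f : JFun n N m} (hf : IsLocal f) (c : Coord n N m) : IsLocal (pd c f) := by
  classical
  obtain ⟨S, F, hF, hf⟩ := hf
  by_cases h : c ∈ S
  · refine ⟨S, fun y => fderiv ℝ F y (Pi.single ⟨c, h⟩ 1), ?_, fun p => ?_⟩
    · exact (hF.fderiv_right (m := ∞) (by simp)).clm_apply contDiff_const
    · rw [pd_eq_of_restrict hF hf, dif_pos h]
  · refine ⟨S, fun _ => 0, contDiff_const, fun p => ?_⟩
    rw [pd_eq_of_restrict hF hf, dif_neg h]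

theorem IsLocal.finite_support {f : JFun n N m} (hf : IsLocal f) :
    {c | GaugeBracket.pd c f ≠ 0}.Finite := by
  obtain ⟨S, F, hF, hf⟩ := hf
  refine S.finite_toSet.subset fun c hc => ?_
  by_contra h
  exact hc (funext fun p => by rw [pd_eq_of_restrict hF hf, dif_neg (by simpa using h)]; rfl)

theorem IsLocal.pd_comm {f : JFun n N m} (hf : IsLocal f) (c c' : Coord n N m) :
    GaugeBracket.pd c (GaugeBracket.pd c' f) = GaugeBracket.pd c' (GaugeBracket.pd c f) := by
  classical
  obtain ⟨S, F, hF, hf⟩ := hf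
  have zero : ∀ c, c ∉ S → GaugeBracket.pd c f = 0 := fun c h => funext fun p => by
    rw [pd_eq_of_restrict hF hf, dif_neg h]; rfl
  have pd_zero : ∀ c, GaugeBracket.pd c (0 : JFun n N m) = 0 := fun c => funext fun p => by
    simp [GaugeBracket.pd]
  -- reduction to the symmetry of the second derivative in finitely many variables
  have second : ∀ c c' (h : c ∈ S) (h' : c' ∈ S) p, GaugeBracket.pd c (GaugeBracket.pd c' f) p =
      fderiv ℝ (fderiv ℝ F) (fun s => p s) (Pi.single ⟨c, h⟩ 1) (Pi.single ⟨c', h'⟩ 1) := by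
    intro c c' h h' p
    have h1 : ContDiff ℝ ∞ (fderiv ℝ F) := hF.fderiv_right (m := ∞) (by simp)
    rw [pd_eq_of_restrict (f := GaugeBracket.pd c' f)
      (F := fun y => fderiv ℝ F y (Pi.single ⟨c', h'⟩ 1)) (h1.clm_apply contDiff_const)
      (fun p => by rw [pd_eq_of_restrict hF hf, dif_pos h']), dif_pos h]
    rw [fderiv_clm_apply (h1.differentiable (by simp) _) (differentiableAt_const _)]
    simp
  by_cases h : c ∈ S
  · by_cases h' : c' ∈ S
    · funext p
      rw [second c c' h h', second c' c h' h]
      exact (hF.contDiffAt.isSymmSndFDerivAt (n := ∞) (by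
        rw [minSmoothness_of_isRCLikeNormedField]
        exact WithTop.coe_le_coe.2 (le_top : (2 : ℕ∞) ≤ ⊤))) _ _
    · have key : GaugeBracket.pd c' (GaugeBracket.pd c f) = 0 := by
        funext p
        have h1 : ContDiff ℝ ∞ (fderiv ℝ F) := hF.fderiv_right (m := ∞) (by simp)
        rw [pd_eq_of_restrict (f := GaugeBracket.pd c f)
          (F := fun y => fderiv ℝ F y (Pi.single ⟨c, h⟩ 1)) (h1.clm_apply contDiff_const)
          (fun p => by rw [pd_eq_of_restrict hF hf, dif_pos h]), dif_neg h']
        rfl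
      rw [zero c' h', pd_zero, key]
  · by_cases h' : c' ∈ S
    · have key : GaugeBracket.pd c (GaugeBracket.pd c' f) = 0 := by
        funext p
        have h1 : ContDiff ℝ ∞ (fderiv ℝ F) := hF.fderiv_right (m := ∞) (by simp)
        rw [pd_eq_of_restrict (f := GaugeBracket.pd c' f)
          (F := fun y => fderiv ℝ F y (Pi.single ⟨c', h'⟩ 1)) (h1.clm_apply contDiff_const)
          (fun p => by rw [pd_eq_of_restrict hF hf, dif_pos h']), dif_neg h]
        rfl
      rw [zero c h, pd_zero, key]
    · rw [zero c h, zero c' h', pd_zero, pd_zero]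

theorem IsLocal.comp₂ {f g : JFun n N m} (hf : IsLocal f) (hg : IsLocal g) {k : ℝ → ℝ → ℝ}
    (hk : ContDiff ℝ ∞ fun x : ℝ × ℝ => k x.1 x.2) : IsLocal fun p => k (f p) (g p) := by
  classical
  obtain ⟨S, F, hF, hf⟩ := hf
  obtain ⟨S', F', hF', hg⟩ := hg
  refine ⟨S ∪ S', fun y => k (F fun s => y ⟨s, Finset.mem_union_left _ s.2⟩)
    (F' fun s => y ⟨s, Finset.mem_union_right _ s.2⟩), ?_, fun p => by simp only [hf, hg]⟩
  refine hk.comp (ContDiff.prodMk (hF.comp ?_) (hF'.comp ?_)) <;>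
  exact contDiff_pi.2 fun s => contDiff_apply _ _ _

/-- The subalgebra of local functions. -/
def locAlg (n N m : ℕ) : Subalgebra ℝ (JFun n N m) where
  carrier := {f | IsLocal f}
  mul_mem' hf hg := hf.comp₂ hg (k := fun a b => a * b) (contDiff_fst.mul contDiff_snd)
  add_mem' hf hg := hf.comp₂ hg (k := fun a b => a + b) (contDiff_fst.add contDiff_snd)
  algebraMap_mem' r := ⟨∅, fun _ => r, contDiff_const, fun _ => rfl⟩

/-- The algebra of local functions, as a type of its own. -/
def Loc (n N m : ℕ) : Type := locAlg n N m

namespace Loc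

instance : CommRing (Loc n N m) := inferInstanceAs (CommRing (locAlg n N m))

instance : Algebra ℝ (Loc n N m) := inferInstanceAs (Algebra ℝ (locAlg n N m))

/-- The function underlying a local function. -/
def val : Loc n N m →ₐ[ℝ] JFun n N m := (locAlg n N m).val

/-- A function on the jet space that is local, as an element of the algebra. -/
def mk (f : JFun n N m) (hf : IsLocal f) : Loc n N m := ⟨f, hf⟩

theorem isLocal (f : Loc n N m) : IsLocal f.val := f.property

@[simp] theorem val_mk (f : JFun n N m) (hf : IsLocal f) : (mk f hf).val = f := rfl

theorem val_injective : Function.Injective (val : Loc n N m → JFun n N m) :=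
  Subtype.val_injective

@[ext] protected theorem ext {f g : Loc n N m} (h : ∀ p, f.val p = g.val p) : f = g :=
  val_injective (funext h)

end Loc

/-- A jet coordinate as a local function. -/
def crd (c : Coord n N m) : Loc n N m :=
  .mk (fun p => p c) ⟨{c}, fun y => y ⟨c, Finset.mem_singleton_self c⟩, contDiff_apply _ _ _,
    fun _ => rfl⟩

/-- The partial derivative of a local function. -/
def pdl (c : Coord n N m) (f : Loc n N m) : Loc n N m := .mk (pd c f.val) (f.isLocal.pd c)

@[simp] theorem val_pdl (c : Coord n N m) (f : Loc n N m) : (pdl c f).val = pd c f.val := rfl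

@[simp] theorem val_crd (c : Coord n N m) (p : Jet n N m) : (crd c).val p = p c := rfl

theorem pd_add (c : Coord n N m) (f g : Loc n N m) : pdl c (f + g) = pdl c f + pdl c g :=
  Loc.ext fun p => ((f.isLocal.hasDerivAt c p).add (g.isLocal.hasDerivAt c p)).deriv

theorem pd_smul (c : Coord n N m) (r : ℝ) (f : Loc n N m) : pdl c (r • f) = r • pdl c f :=
  Loc.ext fun p => ((f.isLocal.hasDerivAt c p).const_mul r).deriv

theorem pd_mul (c : Coord n N m) (f g : Loc n N m) :
    pdl c (f * g) = f * pdl c g + g * pdl c f :=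
  Loc.ext fun p => by
    refine ((f.isLocal.hasDerivAt c p).mul (g.isLocal.hasDerivAt c p)).deriv.trans ?_
    simp only [Function.update_eq_self]
    change _ = f.val p * pd c g.val p + g.val p * pd c f.val p
    ring

theorem pd_crd_self (c : Coord n N m) : pdl c (crd c) = 1 := by
  refine Loc.ext fun p => ?_
  have : (fun s : ℝ => (crd c : Loc n N m).val (@Function.update _ _ (Classical.decEq _) p c s))
      = fun s => s := by funext s; rw [val_crd]; classical exact Function.update_self ..
  exact (congrArg (fun k => deriv k (p c)) this).trans (deriv_id _)

theorem pd_crd_of_ne {c c' : Coord n N m} (h : c' ≠ c) : pdl c (crd c') = 0 := by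
  refine Loc.ext fun p => ?_
  have : (fun s : ℝ => (crd c' : Loc n N m).val (@Function.update _ _ (Classical.decEq _) p c s))
      = fun s => p c' := by funext s; rw [val_crd]; classical exact Function.update_of_ne h ..
  exact (congrArg (fun k => deriv k (p c)) this).trans (deriv_const _ _)

theorem pdl_comm (c c' : Coord n N m) (f : Loc n N m) :
    pdl c (pdl c' f) = pdl c' (pdl c f) := Loc.val_injective (f.isLocal.pd_comm c c')

theorem pdl_zero (c : Coord n N m) : pdl c 0 = 0 := by
  simpa using pd_smul c 0 (0 : Loc n N m)

/-! ### Differentials and vector fields -/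

/-- The module of differential forms `∑ g_c dc` of degree one on the jet space. -/
abbrev Form (n N m : ℕ) := Coord n N m →₀ Loc n N m

/-- The differential of a local function. -/
def grad : Derivation ℝ (Loc n N m) (Form n N m) :=
  Derivation.mk'
    { toFun := fun f => Finsupp.ofSupportFinite (fun c => pdl c f)
        (f.isLocal.finite_support.subset fun _ hc h => hc (Loc.val_injective h))
      map_add' := fun f g => Finsupp.ext fun c => by
        rw [Finsupp.add_apply]; exact pd_add c f g
      map_smul' := fun r f => Finsupp.ext fun c => by
        rw [Finsupp.smul_apply]; exact pd_smul c r f }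
    fun f g => Finsupp.ext fun c => by
      rw [Finsupp.add_apply]; exact pd_mul c f g

@[simp] theorem grad_apply (f : Loc n N m) (c : Coord n N m) : grad f c = pdl c f := rfl

theorem grad_crd (c : Coord n N m) : grad (crd c) = Finsupp.single c 1 := by
  classical
  ext1 c'
  rw [grad_apply, Finsupp.single_apply]
  split_ifs with h
  · rw [h, pd_crd_self]
  · exact pd_crd_of_ne h

/-- The vector field with components `a` as a derivation of the local functions. -/
def vf (a : Coord n N m → Loc n N m) : Derivation ℝ (Loc n N m) (Loc n N m) :=
  (Finsupp.linearCombination (Loc n N m) a).compDer grad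

theorem vf_apply (a : Coord n N m → Loc n N m) (f : Loc n N m) :
    vf a f = Finsupp.linearCombination (Loc n N m) a (grad f) := rfl

@[simp] theorem vf_crd (a : Coord n N m → Loc n N m) (c : Coord n N m) : vf a (crd c) = a c := by
  rw [vf_apply, grad_crd]; simp

/-- The Lie derivative along a vector field of forms of degree one. -/
def lieD (a : Coord n N m → Loc n N m) : Form n N m →ₗ[ℝ] Form n N m :=
  Finsupp.mapRange.linearMap (vf a : Loc n N m →ₗ[ℝ] Loc n N m) +
    Finsupp.lsum ℝ fun c => LinearMap.toSpanSingleton (Loc n N m) (Form n N m) (grad (a c))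
      |>.restrictScalars ℝ

theorem lieD_single (a : Coord n N m → Loc n N m) (c : Coord n N m) (g : Loc n N m) :
    lieD a (Finsupp.single c g) = Finsupp.single c (vf a g) + g • grad (a c) := by
  simp [lieD]

theorem lieD_apply (a : Coord n N m → Loc n N m) (θ : Form n N m) :
    lieD a θ = θ.mapRange (vf a) (map_zero _) + θ.sum fun c g => g • grad (a c) := by
  simp only [lieD, LinearMap.add_apply, Finsupp.lsum_apply]
  rfl

/-- The differential commutes with Lie derivatives. -/
theorem grad_vf (a : Coord n N m → Loc n N m) (f : Loc n N m) :
    grad (vf a f) = lieD a (grad f) := by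
  rw [lieD_apply, vf_apply, Finsupp.linearCombination_apply, Finsupp.sum, map_sum]
  simp only [smul_eq_mul, Derivation.leibniz, Finset.sum_add_distrib]
  rw [add_comm]
  congr 1
  ext1 c'
  rw [Finsupp.mapRange_apply, vf_apply, Finsupp.linearCombination_apply, Finsupp.finsetSum_apply]
  rw [Finsupp.sum_of_support_subset (s := (grad f).support)]
  · refine Finset.sum_congr rfl fun c _ => ?_
    simp only [Finsupp.smul_apply, grad_apply, smul_eq_mul]
    rw [pdl_comm, mul_comm]
  · intro c hc
    rw [Finsupp.mem_support_iff] at hc ⊢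
    contrapose! hc
    rw [grad_apply] at hc
    rw [grad_apply, grad_apply, pdl_comm, hc, pdl_zero]
  · intro c _
    simp

theorem vf_vf (a b : Coord n N m → Loc n N m) (f : Loc n N m) :
    vf a (vf b f) - vf b (vf a f) = vf (fun c => vf a (b c) - vf b (a c)) f := by
  have h1 : ∀ θ : Form n N m,
      vf a (Finsupp.linearCombination (Loc n N m) b θ) -
        Finsupp.linearCombination (Loc n N m) b (lieD a θ) =
      Finsupp.linearCombination (Loc n N m) (fun c => vf a (b c) - vf b (a c)) θ := by
    intro θ
    induction θ using Finsupp.induction_linear with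
    | zero => simp
    | add θ η h h' =>
      simp only [map_add] at h h' ⊢
      rw [← h, ← h']; ring
    | single c g =>
      rw [lieD_single]
      simp only [map_add, map_smul, Finsupp.linearCombination_single, smul_eq_mul,
        Derivation.leibniz, ← vf_apply]
      ring
  rw [vf_apply b (vf a f), grad_vf, vf_apply b f, h1, vf_apply]

/-! ### Total derivatives -/

theorem vf_comm {a b : Coord n N m → Loc n N m} (h : ∀ c, vf a (b c) = vf b (a c))
    (f : Loc n N m) : vf a (vf b f) = vf b (vf a f) := by
  rw [← sub_eq_zero, vf_vf]
  simp only [h, sub_self]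
  rw [vf_apply]
  induction grad f using Finsupp.induction_linear with
  | zero => simp
  | add => simp_all
  | single => simp

/-- The components of the total derivative `∂_i`. -/
def totCoef (i : Fin n) : Coord n N m → Loc n N m
  | .t => 0
  | .x j => if j = i then 1 else 0
  | .jet u I => crd (.jet u (I + Finsupp.single i 1))

/-- The total derivative `∂_i` as a derivation of the local functions. -/
def tot (i : Fin n) : Derivation ℝ (Loc n N m) (Loc n N m) := vf (totCoef i)

theorem tot_comm (i j : Fin n) (f : Loc n N m) : tot i (tot j f) = tot j (tot i f) := by
  refine vf_comm (fun c => ?_) f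
  cases c with
  | t => simp [totCoef]
  | x k => simp only [totCoef]; split_ifs <;> simp
  | jet u I => simp only [totCoef, vf_crd]; rw [add_right_comm]

/-- The iterated total derivative `∂_{(I)}` as a linear map. -/
def totI (I : MIdx n) : Module.End ℝ (Loc n N m) :=
  ((List.finRange n).map fun i =>
    ((tot (N := N) (m := m) i : Loc n N m →ₗ[ℝ] Loc n N m) ^ I i)).prod

@[simp] theorem totI_zero (f : Loc n N m) : totI 0 f = f := by
  have : (totI 0 : Module.End ℝ (Loc n N m)) = 1 := by
    simp [totI]
  rw [this]; rfl

theorem totI_add_single (I : MIdx n) (i : Fin n) (f : Loc n N m) :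
    totI (I + Finsupp.single i 1) f = tot i (totI I f) := by
  have hc : ∀ j : Fin n, Commute (tot (N := N) (m := m) i : Module.End ℝ (Loc n N m))
      (tot (N := N) (m := m) j : Module.End ℝ (Loc n N m)) :=
    fun j => LinearMap.ext fun f => tot_comm i j f
  have key : ∀ l : List (Fin n), l.Nodup →
      (l.map fun j => ((tot (N := N) (m := m) j : Module.End ℝ (Loc n N m)) ^
        ((I + Finsupp.single i 1 : MIdx n) j))).prod =
      (if i ∈ l then (tot (N := N) (m := m) i : Module.End ℝ (Loc n N m)) else 1) *
        (l.map fun j => ((tot (N := N) (m := m) j : Module.End ℝ (Loc n N m)) ^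
        (I j))).prod := by
    intro l hl
    induction l with
    | nil => simp
    | cons j l ih =>
      rw [List.nodup_cons] at hl
      rw [List.map_cons, List.prod_cons, List.map_cons, List.prod_cons, ih hl.2]
      by_cases hj : i = j
      · subst hj
        simp [hl.1, pow_succ', mul_assoc]
      · have : (I + Finsupp.single i 1 : MIdx n) j = I j := by simp [hj]
        rw [this]
        simp only [List.mem_cons, hj, false_or]
        split_ifs
        · rw [← mul_assoc, ← mul_assoc, ((hc j).pow_right _).eq]
        · simp
  have := key _ (List.nodup_finRange n)
  rw [if_pos (List.mem_finRange i)] at this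
  exact congrArg (fun L : Module.End ℝ (Loc n N m) => L f) this

theorem midx_induction {P : MIdx n → Prop} (h0 : P 0)
    (hs : ∀ I i, P I → P (I + Finsupp.single i 1)) (I : MIdx n) : P I := by
  obtain ⟨s, rfl⟩ := Multiset.toFinsupp.surjective I
  induction s using Multiset.induction with
  | empty => simpa using h0
  | cons i s ih =>
    rw [← Multiset.singleton_add, map_add, Multiset.toFinsupp_singleton, add_comm]
    exact hs _ _ ih

theorem totI_tot (I : MIdx n) (i : Fin n) (f : Loc n N m) :
    totI I (tot i f) = tot i (totI I f) := by
  induction I using midx_induction with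
  | h0 => simp
  | hs I j ih => rw [totI_add_single, totI_add_single, ih, tot_comm]

/-- The signed iterated total derivative `(-∂)_{(I)}`. -/
def ntot (I : MIdx n) : Module.End ℝ (Loc n N m) := (-1 : ℝ) ^ I.degree • totI I

@[simp] theorem ntot_zero (f : Loc n N m) : ntot 0 f = f := by simp [ntot]

theorem ntot_add_single (I : MIdx n) (i : Fin n) (f : Loc n N m) :
    ntot (I + Finsupp.single i 1) f = - ntot I (tot i f) := by
  simp [ntot, totI_add_single, totI_tot, pow_succ]

/-! ### Evolutionary vector fields -/

/-- Components of the evolutionary vector field with characteristic `Q` and time component `s`. -/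
def evoCoef (s : ℝ) (Q : Fld N m → Loc n N m) : Coord n N m → Loc n N m
  | .t => s • 1
  | .x _ => 0
  | .jet u I => totI I (Q u)

/-- The derivation `s ∂_t + δ_Q`, where `δ_Q` is the variation with characteristic `Q`. -/
def evo (s : ℝ) (Q : Fld N m → Loc n N m) : Derivation ℝ (Loc n N m) (Loc n N m) :=
  vf (evoCoef s Q)

@[simp] theorem evo_crd (s : ℝ) (Q : Fld N m → Loc n N m) (u : Fld N m) (I : MIdx n) :
    evo s Q (crd (.jet u I)) = totI I (Q u) := vf_crd _ _

theorem evo_tot (s : ℝ) (Q : Fld N m → Loc n N m) (i : Fin n) (f : Loc n N m) :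
    evo s Q (tot i f) = tot i (evo s Q f) := by
  refine vf_comm (fun c => ?_) f
  cases c with
  | t => simp [totCoef, evoCoef]
  | x k => simp only [totCoef, evoCoef]; split_ifs <;> simp
  | jet u I =>
    simp only [totCoef, evoCoef, vf_crd]; exact totI_add_single _ _ _

theorem evo_totI (s : ℝ) (Q : Fld N m → Loc n N m) (I : MIdx n) (f : Loc n N m) :
    evo s Q (totI I f) = totI I (evo s Q f) := by
  induction I using midx_induction with
  | h0 => simp
  | hs I j ih => rw [totI_add_single, totI_add_single, evo_tot, ih]

theorem evo_ntot (s : ℝ) (Q : Fld N m → Loc n N m) (I : MIdx n) (f : Loc n N m) :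
    evo s Q (ntot I f) = ntot I (evo s Q f) := by
  simp [ntot, evo_totI]

theorem evo_evo (s s' : ℝ) (Q Q' : Fld N m → Loc n N m) (f : Loc n N m) :
    evo s Q (evo s' Q' f) - evo s' Q' (evo s Q f) =
      evo 0 (fun u => evo s Q (Q' u) - evo s' Q' (Q u)) f := by
  refine (vf_vf _ _ f).trans ?_
  congr 2
  funext c
  cases c with
  | t => simp [evoCoef]
  | x k => simp [evoCoef]
  | jet u I =>
    simp only [evoCoef, map_sub]
    exact congrArg₂ _ (evo_totI _ _ _ _) (evo_totI _ _ _ _)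

theorem evo_add (s s' : ℝ) (Q Q' : Fld N m → Loc n N m) (f : Loc n N m) :
    evo (s + s') (fun u => Q u + Q' u) f = evo s Q f + evo s' Q' f := by
  simp only [evo, vf_apply]
  induction grad f using Finsupp.induction_linear with
  | zero => simp
  | add _ _ h h' => simp only [map_add, h, h']; ring
  | single c g =>
    cases c <;> simp [evoCoef, add_smul, mul_add]

theorem evo_smul (r s : ℝ) (Q : Fld N m → Loc n N m) (f : Loc n N m) :
    evo (r * s) (fun u => r • Q u) f = r • evo s Q f := by
  simp only [evo, vf_apply]
  induction grad f using Finsupp.induction_linear with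
  | zero => simp
  | add _ _ h h' => simp only [map_add, h, h', smul_add]
  | single c g =>
    cases c <;> simp [evoCoef, mul_smul]

/-! ### Euler operators -/

/-- Integration by parts of a form, `g d u_{(I)} ↦ (-∂)_{(I)} g d u`. -/
def eul : Form n N m →ₗ[ℝ] (Fld N m →₀ Loc n N m) :=
  Finsupp.lsum ℝ fun c => match c with
    | .t => 0
    | .x _ => 0
    | .jet u I => (Finsupp.lsingle u : Loc n N m →ₗ[ℝ] _) ∘ₗ ntot I

@[simp] theorem eul_single_t (g : Loc n N m) : eul (Finsupp.single .t g) = 0 := by simp [eul]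

@[simp] theorem eul_single_x (i : Fin n) (g : Loc n N m) :
    eul (Finsupp.single (.x i) g) = 0 := by simp [eul]

@[simp] theorem eul_single_jet (u : Fld N m) (I : MIdx n) (g : Loc n N m) :
    eul (Finsupp.single (.jet u I) g) = Finsupp.single u (ntot I g) := by simp [eul]

/-- The Euler-Lagrange derivatives of a local function with respect to all fields. -/
def el (f : Loc n N m) : Fld N m →₀ Loc n N m := eul (grad f)

/-- The formal adjoint of the linearization of `f` with respect to all fields, applied to `w`. -/
def adj (f w : Loc n N m) : Fld N m →₀ Loc n N m := eul (w • grad f)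

theorem el_add (f g : Loc n N m) : el (f + g) = el f + el g := by simp [el]
theorem el_sub (f g : Loc n N m) : el (f - g) = el f - el g := by simp [el]
theorem el_smul (r : ℝ) (f : Loc n N m) : el (r • f) = r • el f := by simp [el]
@[simp] theorem el_zero : el (0 : Loc n N m) = 0 := by simp [el]

theorem adj_add_right (f w w' : Loc n N m) : adj f (w + w') = adj f w + adj f w' := by
  simp [adj, add_smul]

theorem adj_sub_right (f w w' : Loc n N m) : adj f (w - w') = adj f w - adj f w' := by
  simp [adj, sub_smul]

theorem adj_neg_right (f w : Loc n N m) : adj f (-w) = - adj f w := by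
  simp [adj]

theorem adj_smul_right (r : ℝ) (f w : Loc n N m) : adj f (r • w) = r • adj f w := by
  simp [adj]

theorem adj_sum_right {κ : Type*} (s : Finset κ) (f : Loc n N m) (w : κ → Loc n N m) :
    adj f (∑ k ∈ s, w k) = ∑ k ∈ s, adj f (w k) := by
  simp [adj, Finset.sum_smul]

theorem adj_smul_left (r : ℝ) (f w : Loc n N m) : adj (r • f) w = r • adj f w := by
  simp [adj, smul_comm w r]

theorem adj_sum_left {κ : Type*} (s : Finset κ) (f : κ → Loc n N m) (w : Loc n N m) :
    adj (∑ k ∈ s, f k) w = ∑ k ∈ s, adj (f k) w := by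
  simp [adj, Finset.smul_sum]

@[simp] theorem adj_zero_right (f : Loc n N m) : adj f 0 = 0 := by simp [adj]

theorem adj_crd (u : Fld N m) (w : Loc n N m) :
    adj (crd (.jet u 0)) w = Finsupp.single u w := by
  simp [adj, grad_crd]

theorem el_mul (f g : Loc n N m) : el (f * g) = adj f g + adj g f := by
  rw [el, Derivation.leibniz, map_add, add_comm]; rfl

theorem eul_smul_lieD_tot (i : Fin n) (w : Loc n N m) (θ : Form n N m) :
    eul (w • lieD (totCoef i) θ) = - eul (tot i w • θ) := by
  induction θ using Finsupp.induction_linear with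
  | zero => simp
  | add _ _ h h' => simp only [map_add, smul_add, h, h', neg_add]
  | single c g =>
    rw [lieD_single, smul_add, map_add]
    cases c with
    | t => simp [totCoef, -Finsupp.single_mul]
    | x k => simp only [totCoef]; split_ifs <;> simp [-Finsupp.single_mul]
    | jet u I =>
      simp only [totCoef, grad_crd, Finsupp.smul_single, smul_eq_mul, eul_single_jet,
        ntot_add_single, mul_one]
      rw [← Finsupp.single_add, ← Finsupp.single_neg]
      congr 1
      rw [show vf (totCoef i) g = tot i g from rfl, Derivation.leibniz, map_add]
      simp only [smul_eq_mul]
      rw [mul_comm g]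
      abel

theorem adj_tot (i : Fin n) (f w : Loc n N m) : adj (tot i f) w = - adj f (tot i w) := by
  rw [adj, tot, grad_vf, eul_smul_lieD_tot]; rfl

theorem adj_totI (I : MIdx n) (f w : Loc n N m) : adj (totI I f) w = adj f (ntot I w) := by
  induction I using midx_induction generalizing w with
  | h0 => simp
  | hs I i ih => rw [totI_add_single, adj_tot, ih, ntot_add_single, adj_neg_right]

theorem el_tot (i : Fin n) (f : Loc n N m) : el (tot i f) = 0 := by
  have := adj_tot i f 1
  simpa [adj, el] using this

/-- The Euler-Lagrange derivatives of the variation of `f`. -/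
theorem el_evo (s : ℝ) (Q : Fld N m → Loc n N m) (f : Loc n N m) :
    el (evo s Q f) = (el f).mapRange (evo s Q) (map_zero _) +
      (el f).sum fun u w => adj (Q u) w := by
  have hs : ∀ e e' : Fld N m →₀ Loc n N m, ((e + e').sum fun u w => adj (Q u) w) =
      (e.sum fun u w => adj (Q u) w) + e'.sum fun u w => adj (Q u) w := fun e e' =>
    Finsupp.sum_add_index' (fun u => adj_zero_right _) (fun u => adj_add_right _)
  rw [el, evo, grad_vf, el]
  induction grad f using Finsupp.induction_linear with
  | zero => simp
  | add θ η h h' =>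
    simp only [map_add] at h h' ⊢
    rw [h, h', hs, Finsupp.mapRange_add (fun _ _ => map_add _ _ _)]
    abel
  | single c g =>
    rw [lieD_single, map_add]
    cases c with
    | t => simp [evoCoef]
    | x k => simp [evoCoef]
    | jet u I =>
      simp only [eul_single_jet, Finsupp.mapRange_single]
      rw [Finsupp.sum_single_index (h := fun u w => adj (Q u) w) (adj_zero_right _)]
      change _ + adj (totI I (Q u)) g = _
      rw [adj_totI, show vf (evoCoef s Q) g = evo s Q g from rfl, ← evo_ntot]
      rfl

open Classical in
/-- The part with respect to the multipliers of a family of Euler-Lagrange derivatives. -/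
def lamPart (e : Fld N m →₀ Loc n N m) : Fld N m →₀ Loc n N m :=
  e.filter fun u => ∃ a l, u = .lam a l

@[simp] theorem lamPart_lam (e : Fld N m →₀ Loc n N m) (a : Fin m) (l : ℕ) :
    lamPart e (.lam a l) = e (.lam a l) := by
  classical exact Finsupp.filter_apply_pos _ _ ⟨a, l, rfl⟩

@[simp] theorem lamPart_z (e : Fld N m →₀ Loc n N m) (A : Fin N) :
    lamPart e (.z A) = 0 := by
  classical exact Finsupp.filter_apply_neg _ _ (by simp)

theorem sum_eq_add_lamPart {M : Type*} [AddCommMonoid M] (e : Fld N m →₀ Loc n N m)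
    (F : Fld N m → Loc n N m → M) (h0 : ∀ u, F u 0 = 0) :
    e.sum F = ∑ A, F (.z A) (e (.z A)) + (lamPart e).sum F := by
  classical
  have hinj : Function.Injective (Fld.z : Fin N → Fld N m) := fun A B h => by cases h; rfl
  set S : Finset (Fld N m) := Finset.univ.image Fld.z
  set S' : Finset (Fld N m) := (lamPart e).support
  have hd : Disjoint S S' := by
    rw [Finset.disjoint_left]
    rintro u hu hu'
    obtain ⟨A, -, rfl⟩ := Finset.mem_image.1 hu
    simp [S'] at hu'
  rw [Finsupp.sum_of_support_subset e (s := S ∪ S') _ F (fun u _ => h0 u), Finset.sum_union hd,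
    Finset.sum_image fun A _ B _ h => hinj h]
  · refine congrArg₂ _ rfl (Finset.sum_congr rfl fun u hu => ?_)
    cases u with
    | z A => simp at hu
    | lam a l => simp
  · intro u hu
    cases u with
    | z A => simp [S]
    | lam a l =>
      refine Finset.mem_union_right _ ?_
      rw [Finsupp.mem_support_iff] at hu
      simpa [S'] using hu

/-! ### Comparison with the operations on functions -/

theorem finite_jet_support (θ : Form n N m) :
    {c : Fld N m × MIdx n | θ (.jet c.1 c.2) ≠ 0}.Finite := by
  have : Function.Injective fun c : Fld N m × MIdx n => (Coord.jet c.1 c.2 : Coord n N m) := by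
    rintro ⟨u, I⟩ ⟨u', I'⟩ h
    cases h; rfl
  exact (θ.hasFiniteSupport.preimage this.injOn)

theorem finsum_add_form {M : Type*} [AddCommMonoid M] (F : Fld N m × MIdx n → Loc n N m →+ M)
    (θ η : Form n N m) : ∑ᶠ c : Fld N m × MIdx n, F c ((θ + η) (.jet c.1 c.2)) =
      ∑ᶠ c : Fld N m × MIdx n, F c (θ (.jet c.1 c.2)) +
        ∑ᶠ c : Fld N m × MIdx n, F c (η (.jet c.1 c.2)) := by
  rw [← finsum_add_distrib]
  · simp
  · exact (finite_jet_support θ).subset fun c hc h => hc (by simp [h])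
  · exact (finite_jet_support η).subset fun c hc h => hc (by simp [h])

theorem linearCombination_val (a : Coord n N m → Loc n N m) (θ : Form n N m) (p : Jet n N m) :
    (Finsupp.linearCombination (Loc n N m) a θ).val p =
      (a .t).val p * (θ .t).val p + ∑ i, (a (.x i)).val p * (θ (.x i)).val p +
        ∑ᶠ c : Fld N m × MIdx n, (a (.jet c.1 c.2)).val p * (θ (.jet c.1 c.2)).val p := by
  classical
  have hadd := finsum_add_form (n := n) (N := N) (m := m) (M := ℝ) fun c =>
    { toFun := fun g => (a (.jet c.1 c.2)).val p * g.val p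
      map_zero' := by simp
      map_add' := fun x y => by simp [mul_add] }
  simp only [AddMonoidHom.coe_mk, ZeroHom.coe_mk] at hadd
  induction θ using Finsupp.induction_linear with
  | zero => simp
  | add θ η h h' =>
    rw [hadd, map_add, map_add, Pi.add_apply, h, h']
    simp only [Finsupp.add_apply, map_add, Pi.add_apply, mul_add, Finset.sum_add_distrib]
    ring
  | single c g =>
    rw [Finsupp.linearCombination_single, smul_eq_mul, map_mul, Pi.mul_apply]
    cases c with
    | t => simp [mul_comm]
    | x i =>
      simp only [Finsupp.single_apply, reduceCtorEq, if_false, map_zero, Pi.zero_apply, mul_zero,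
        finsum_zero, zero_add, add_zero]
      rw [Finset.sum_eq_single i (fun j _ hj => by rw [if_neg (by simp [hj.symm])]; simp) (by simp)]
      simp [mul_comm]
    | jet u I =>
      simp only [Finsupp.single_apply, reduceCtorEq, if_false, map_zero, Pi.zero_apply, mul_zero,
        Finset.sum_const_zero, zero_add]
      rw [finsum_eq_single _ (u, I) (fun c hc => by
        rw [if_neg (by rintro ⟨⟩; exact hc rfl)]; simp)]
      simp [mul_comm]

theorem vf_val (a : Coord n N m → Loc n N m) (f : Loc n N m) (p : Jet n N m) :
    (vf a f).val p = (a .t).val p * pd .t f.val p + ∑ i, (a (.x i)).val p * pd (.x i) f.val p +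
        ∑ᶠ c : Fld N m × MIdx n, (a (.jet c.1 c.2)).val p * pd (.jet c.1 c.2) f.val p :=
  linearCombination_val a (grad f) p

theorem totalD_val (i : Fin n) (f : Loc n N m) : totalD i f.val = (tot i f).val := by
  funext p
  rw [tot, vf_val, totalD]
  simp only [totCoef, map_zero, Pi.zero_apply, zero_mul, zero_add]
  rw [Finset.sum_eq_single i (fun j _ hj => by simp [hj]) (by simp)]
  simp

theorem totalDI_val (I : MIdx n) (f : Loc n N m) : totalDI I f.val = (totI I f).val := by
  have h1 : ∀ (i : Fin n) (k : ℕ) (f : Loc n N m), (totalD i)^[k] f.val =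
      (((tot (N := N) (m := m) i : Module.End ℝ (Loc n N m)) ^ k) f).val := by
    intro i k
    induction k with
    | zero => intro f; rfl
    | succ k ih =>
      intro f
      rw [Function.iterate_succ_apply, totalD_val, ih, pow_succ]; rfl
  have h2 : ∀ (l : List (Fin n)), l.foldr (fun i g => (totalD i)^[I i] g) f.val =
      ((l.map fun i =>
        ((tot (N := N) (m := m) i : Module.End ℝ (Loc n N m)) ^ I i)).prod f).val := by
    intro l
    induction l with
    | nil => rfl
    | cons i l ih => rw [List.foldr_cons, ih, h1]; simp
  exact h2 _

theorem evol_val (Q : Fld N m → Loc n N m) (f : Loc n N m) :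
    evol (fun u => (Q u).val) f.val = (evo 0 Q f).val := by
  funext p
  rw [evo, vf_val, evol]
  simp [evoCoef, totalDI_val]

/-- The characteristic of `δ_w`, together with the shift of the time derivatives of the
multipliers. -/
def shift (w : Fin N → Loc n N m) : Fld N m → Loc n N m
  | .z A => w A
  | .lam a l => crd (.jet (.lam a (l + 1)) 0)

theorem timeD_val (w : Fin N → Loc n N m) (f : Loc n N m) :
    timeD (fun A => (w A).val) f.val = (evo 1 (shift w) f).val := by
  have hev : ∀ Q : Fld N m → JFun n N m, (∀ u, Q u = (shift w u).val) →
      pd .t f.val + evol Q f.val = (evo 1 (shift w) f).val := by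
    intro Q hQ
    obtain rfl : Q = fun u => (shift w u).val := funext hQ
    funext p
    rw [evo, vf_val, Pi.add_apply, evol]
    simp [evoCoef, totalDI_val]
  exact hev _ fun u => by cases u <;> rfl

theorem divg_val (k : Fin n → Loc n N m) :
    divg (fun i => (k i).val) = (∑ i, tot i (k i)).val := by
  simp [divg, totalD_val]

theorem ntot_val (I : MIdx n) (f : Loc n N m) (p : Jet n N m) :
    (ntot I f).val p = (-1 : ℝ) ^ I.degree * (totI I f).val p := by
  simp [ntot]

theorem eul_val (θ : Form n N m) (u : Fld N m) (p : Jet n N m) :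
    (eul θ u).val p = ∑ᶠ I : MIdx n, (ntot I (θ (.jet u I))).val p := by
  classical
  have hfin : ∀ θ : Form n N m, (Function.support fun I : MIdx n =>
      (ntot I (θ (.jet u I))).val p).Finite := by
    intro θ
    have : Function.Injective fun I : MIdx n => (u, I) := fun I J h => by simpa using h
    exact ((finite_jet_support θ).preimage this.injOn).subset fun I hI h => hI (by
      simp only at h
      simp [h])
  induction θ using Finsupp.induction_linear with
  | zero => simp
  | add θ η h h' =>
    simp only [map_add, Finsupp.add_apply, Pi.add_apply]
    rw [finsum_add_distrib (hfin θ) (hfin η), h, h']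
  | single c g =>
    cases c with
    | t => simp
    | x i => simp
    | jet u' I =>
      rw [eul_single_jet]
      by_cases hu : u' = u
      · subst hu
        rw [finsum_eq_single _ I (fun J hJ => by simp [Ne.symm hJ])]
        simp
      · simp [hu]

theorem adjLin_val (u : Fld N m) (f w : Loc n N m) :
    adjLin u f.val w.val = (adj f w u).val := by
  funext p
  rw [adj, eul_val, adjLin]
  refine finsum_congr fun I => ?_
  rw [ntot_val, ← totalDI_val]
  simp [mul_comm]

theorem euler_val (u : Fld N m) (f : Loc n N m) : euler u f.val = (el f u).val := by
  have := adjLin_val u f 1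
  simpa [euler, adj, el] using this

/-! ### Functions over the region and its boundary -/

theorem pdl_eq_zero_of_dependsOn {f : Loc n N m} {s : Set (Coord n N m)}
    (hf : DependsOn f.val s) {c : Coord n N m} (hc : c ∉ s) : pdl c f = 0 := by
  refine Loc.ext fun p => ?_
  have : (fun y : ℝ => f.val (@Function.update _ _ (Classical.decEq _) p c y)) =
      fun _ => f.val p := by
    funext y
    refine hf fun i hi => ?_
    classical exact Function.update_of_ne (fun h : i = c => hc (h ▸ hi)) ..
  exact (congrArg (fun k => deriv k (p c)) this).trans (deriv_const _ _)

theorem isLocal_base {g : (Fin n → ℝ) → ℝ} (hg : ContDiff ℝ ∞ g) :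
    IsLocal fun p : Jet n N m => g (base p) := by
  classical
  refine ⟨Finset.univ.image Coord.x, fun y => g fun i => y ⟨.x i, by simp⟩, ?_, fun p => rfl⟩
  exact hg.comp (contDiff_pi.2 fun i => contDiff_apply _ _ _)

theorem dependsOn_base {g : (Fin n → ℝ) → ℝ} :
    DependsOn (fun p : Jet n N m => g (base p)) (Set.range Coord.x) := fun _ _ h =>
  congrArg g (funext fun i => h _ ⟨i, rfl⟩)

/-- The ideal of the local functions that vanish on the jets over `K`. -/
def vanish (K : Set (Fin n → ℝ)) : Ideal (Loc n N m) where
  carrier := {f | ∀ p, base p ∈ K → f.val p = 0}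
  zero_mem' := by simp
  add_mem' hf hg p hp := by simp [hf p hp, hg p hp]
  smul_mem' c f hf p hp := by simp [hf p hp]

theorem base_update_of_ne {c : Coord n N m} (hc : ∀ i, c ≠ .x i) (p : Jet n N m) (y : ℝ) :
    base (@Function.update _ _ (Classical.decEq _) p c y) = base p := by
  funext i
  classical exact Function.update_of_ne (hc i).symm ..

theorem vf_mem {I : Ideal (Loc n N m)} {a : Coord n N m → Loc n N m} {f : Loc n N m}
    (h : ∀ c, pdl c f * a c ∈ I) : vf a f ∈ I := by
  rw [vf_apply, Finsupp.linearCombination_apply]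
  exact Submodule.sum_mem _ fun c _ => h c

theorem evo_mem_vanish {K : Set (Fin n → ℝ)} (s : ℝ) (Q : Fld N m → Loc n N m) {f : Loc n N m}
    (hf : f ∈ vanish K) : evo s Q f ∈ vanish K := by
  have key : ∀ c : Coord n N m, (∀ i, c ≠ .x i) → pdl c f ∈ vanish K := by
    intro c hc p hp
    have : (fun y : ℝ => f.val (@Function.update _ _ (Classical.decEq _) p c y)) =
        fun _ => 0 := funext fun y => hf _ (by rwa [base_update_of_ne hc])
    exact (congrArg (fun k => deriv k (p c)) this).trans (deriv_const _ _)
  refine vf_mem fun c => ?_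
  cases c with
  | t => exact Ideal.mul_mem_right _ _ (key _ (by simp))
  | x i => simp [evoCoef]
  | jet u I => exact Ideal.mul_mem_right _ _ (key _ (by simp))

theorem IsLocal.continuous_comp {f : JFun n N m} (hf : IsLocal f) {γ : ℝ → Jet n N m}
    (hγ : ∀ c, Continuous fun s => γ s c) : Continuous fun s => f (γ s) := by
  obtain ⟨S, F, hF, hf⟩ := hf
  simp only [hf]
  exact hF.continuous.comp (continuous_pi fun s => hγ s)

/-- A region with smooth regular boundary is the closure of its interior, so that the local
functions that vanish over it are stable under all partial derivatives. -/
theorem pdl_mem_vanish {ρ : (Fin n → ℝ) → ℝ} (hρ : ContDiff ℝ ∞ ρ)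
    (hreg : ∀ x, ρ x = 0 → fderiv ℝ ρ x ≠ 0) {f : Loc n N m} (hf : f ∈ vanish {x | 0 ≤ ρ x})
    (c : Coord n N m) : pdl c f ∈ vanish {x | 0 ≤ ρ x} := by
  classical
  have inner : ∀ p, 0 < ρ (base p) → (pdl c f).val p = 0 := by
    intro p hp
    have hcont : Continuous fun y : ℝ =>
        ρ (base (@Function.update _ _ (Classical.decEq _) p c y)) := by
      refine hρ.continuous.comp (continuous_pi fun i => ?_)
      by_cases hi : Coord.x i = c
      · subst hi
        exact continuous_id.congr fun y => (Function.update_self (Coord.x i) y p).symm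
      · exact (continuous_const (y := p (.x i))).congr fun y => by
            rw [base, Function.update_of_ne hi]
    have hev : (fun y : ℝ => f.val (@Function.update _ _ (Classical.decEq _) p c y))
        =ᶠ[nhds (p c)] fun _ => 0 := by
      have : ∀ᶠ y in nhds (p c),
          0 < ρ (base (@Function.update _ _ (Classical.decEq _) p c y)) := by
        refine hcont.continuousAt.eventually (lt_mem_nhds ?_)
        simpa only [Function.update_eq_self] using hp
      filter_upwards [this] with y hy
      exact hf _ hy.le
    exact hev.deriv_eq.trans (deriv_const _ _)
  intro p hp
  rcases (show 0 ≤ ρ (base p) from hp).lt_or_eq with hp | hp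
  · exact inner p hp
  -- approach a boundary point along a curve that enters the region
  obtain ⟨v, hv⟩ : ∃ v, 0 < fderiv ℝ ρ (base p) v := by
    obtain ⟨v, hv⟩ : ∃ v, fderiv ℝ ρ (base p) v ≠ 0 := by
      by_contra! h
      exact hreg _ hp.symm (ContinuousLinearMap.ext h)
    rcases hv.lt_or_gt with h | h
    · exact ⟨-v, by simpa using h⟩
    · exact ⟨v, h⟩
  let γ : ℝ → Jet n N m := fun s c => match c with
    | .x i => p (.x i) + s * v i
    | c => p c
  have hγ0 : γ 0 = p := by funext c; cases c <;> simp [γ]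
  have hbase : ∀ s, base (γ s) = base p + s • v := fun s => by funext i; simp [base, γ]
  have hγ : ∀ c, Continuous fun s => γ s c := by
    intro c
    cases c with
    | t => exact continuous_const
    | x i => exact (continuous_const.add (continuous_id.mul continuous_const))
    | jet u I => exact continuous_const
  have hder : HasDerivAt (fun s : ℝ => ρ (base p + s • v)) (fderiv ℝ ρ (base p) v) 0 := by
    have h1 : HasFDerivAt ρ (fderiv ℝ ρ (base p)) (base p + (0 : ℝ) • v) := by
      rw [zero_smul, add_zero]
      exact (hρ.differentiable (by simp) _).hasFDerivAt
    have h2 : HasDerivAt (fun s : ℝ => base p + s • v) v 0 := by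
      simpa using ((hasDerivAt_id (0 : ℝ)).smul_const v).const_add (base p)
    exact h1.comp_hasDerivAt (0 : ℝ) h2
  have hpos : ∀ᶠ s in nhdsWithin (0 : ℝ) (Set.Ioi 0), (pdl c f).val (γ s) = 0 := by
    have h1 := (hasDerivAt_iff_tendsto_slope.1 hder).eventually (lt_mem_nhds hv)
    have h2 : nhdsWithin (0 : ℝ) (Set.Ioi 0) ≤ nhdsWithin 0 {0}ᶜ :=
      nhdsWithin_mono _ fun s hs => (ne_of_gt hs : s ≠ 0)
    filter_upwards [h2 h1, self_mem_nhdsWithin] with s hs hs0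
    refine inner _ ?_
    rw [hbase]
    simp only [slope, vsub_eq_sub, zero_smul, add_zero, ← hp, sub_zero, smul_eq_mul] at hs
    exact (pos_iff_pos_of_mul_pos hs).1 (inv_pos.2 hs0)
  have hlim : Filter.Tendsto (fun s => (pdl c f).val (γ s)) (nhdsWithin (0 : ℝ) (Set.Ioi 0))
      (nhds ((pdl c f).val p)) := by
    have := ((pdl c f).isLocal.continuous_comp hγ).tendsto 0
    rw [hγ0] at this
    exact this.mono_left nhdsWithin_le_nhds
  exact tendsto_nhds_unique hlim ((Filter.tendsto_congr' hpos).2 tendsto_const_nhds)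

theorem tot_mem_vanish {ρ : (Fin n → ℝ) → ℝ} (hρ : ContDiff ℝ ∞ ρ)
    (hreg : ∀ x, ρ x = 0 → fderiv ℝ ρ x ≠ 0) {f : Loc n N m} (hf : f ∈ vanish {x | 0 ≤ ρ x})
    (i : Fin n) : tot i f ∈ vanish {x | 0 ≤ ρ x} :=
  vf_mem fun c => Ideal.mul_mem_right _ _ (pdl_mem_vanish hρ hreg hf c)

/-- The ideal of the local functions that are, over `K`, combinations of the constraints and
their spatial derivatives. -/
def constrIdeal (φ : Fin m → Loc n N m) (K : Set (Fin n → ℝ)) : Ideal (Loc n N m) :=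
  vanish K ⊔ Ideal.span (Set.range fun s : Fin m × MIdx n => totI s.2 (φ s.1))

theorem totI_mem_constrIdeal (φ : Fin m → Loc n N m) (K : Set (Fin n → ℝ)) (a : Fin m)
    (I : MIdx n) : totI I (φ a) ∈ constrIdeal φ K :=
  Ideal.mem_sup_right (Ideal.subset_span ⟨(a, I), rfl⟩)

/-- Stability of the constraint ideals under derivations need only be checked on generators. -/
theorem derivation_mem_constrIdeal {φ : Fin m → Loc n N m} {K : Set (Fin n → ℝ)}
    {X : Derivation ℝ (Loc n N m) (Loc n N m)} (hX : ∀ f ∈ vanish K, X f ∈ vanish K)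
    (hφ : ∀ a I, X (totI I (φ a)) ∈ constrIdeal φ K) {f : Loc n N m} (hf : f ∈ constrIdeal φ K) :
    X f ∈ constrIdeal φ K := by
  obtain ⟨g, hg, h, hh, rfl⟩ := Submodule.mem_sup.1 hf
  rw [map_add]
  refine add_mem (Ideal.mem_sup_left (hX g hg)) ?_
  refine Submodule.span_induction ?_ (by simp) (fun x y _ _ hx hy => ?_) (fun a x hx' hx => ?_) hh
  · rintro _ ⟨s, rfl⟩; exact hφ _ _
  · rw [map_add]; exact add_mem hx hy
  · rw [smul_eq_mul, Derivation.leibniz]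
    exact add_mem (Ideal.mul_mem_left _ _ hx)
      (Ideal.mul_mem_right _ _ (Ideal.mem_sup_right hx'))

theorem inIdeal_iff {ι : Type*} (T : GaugeData n N m ι) (φ : Fin m → Loc n N m)
    (hφ : ∀ a, (φ a).val = T.φ a) (K : Set (Fin n → ℝ)) (f : Loc n N m) :
    T.InIdeal K f.val ↔ f ∈ constrIdeal φ K := by
  constructor
  · rintro ⟨S, c, hc, h⟩
    set g : Loc n N m := ∑ s ∈ S.attach, Loc.mk (c s) (hc s s.2) * totI s.1.2 (φ s.1.1)
    have hg : g ∈ constrIdeal φ K := Submodule.sum_mem _ fun s _ =>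
      Ideal.mul_mem_left _ _ (totI_mem_constrIdeal _ _ _ _)
    have hfg : f - g ∈ constrIdeal φ K := by
      refine Ideal.mem_sup_left fun p hp => ?_
      rw [map_sub, Pi.sub_apply, h p hp, sub_eq_zero, map_sum, Finset.sum_apply,
        ← Finset.sum_attach]
      refine Finset.sum_congr rfl fun s _ => ?_
      rw [map_mul, Pi.mul_apply, ← totalDI_val, hφ]; rfl
    simpa using add_mem hfg hg
  · intro hf
    obtain ⟨g, hg, h, hh, rfl⟩ := Submodule.mem_sup.1 hf
    obtain ⟨c, rfl⟩ := Finsupp.mem_span_range_iff_exists_finsupp.1 hh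
    refine ⟨c.support, fun s => (c s).val, fun s _ => (c s).isLocal, fun p hp => ?_⟩
    rw [map_add, Pi.add_apply, hg p hp, zero_add, Finsupp.sum, map_sum, Finset.sum_apply]
    refine Finset.sum_congr rfl fun s _ => ?_
    rw [smul_eq_mul, map_mul, Pi.mul_apply, ← totalDI_val, hφ]

/-! ### Gauge theories in terms of local functions -/

/-- A gauge theory whose data are elements of the algebra of local functions, with the properties
that the brackets depend on. -/
structure LocTheory (n N m : ℕ) (ι : Type*) where
  /-- Defining function of the region. -/
  ρ : (Fin n → ℝ) → ℝ
  /-- The Poisson matrix. -/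
  σ : Matrix (Fin N) (Fin N) ℝ
  /-- The constraints. -/
  φ : Fin m → Loc n N m
  /-- The density of the total Hamiltonian. -/
  H : Loc n N m
  /-- The internal boundary conditions. -/
  χ : ι → Loc n N m
  ρ_smooth : ContDiff ℝ ∞ ρ
  ρ_regular : ∀ x, ρ x = 0 → fderiv ℝ ρ x ≠ 0
  σ_skew : ∀ A B, σ A B = - σ B A
  el_H_lam : ∀ a l, el H (.lam a l) = if l = 0 then φ a else 0
  adj_φ_lam : ∀ a b l w, adj (φ a) w (.lam b l) = 0
  /-- The constraints are preserved in time. -/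
  φ_first : ∀ a, evo 1 (shift fun A => ∑ B, σ A B • el H (.z B)) (φ a) ∈
    constrIdeal φ {x | 0 ≤ ρ x}

/-- The scalar product of two families of local functions. -/
def dot (a b : Fin N → Loc n N m) : Loc n N m := ∑ A, a A * b A

/-- The Euler-Lagrange derivatives with respect to the canonical fields. -/
def zel (g : Loc n N m) (A : Fin N) : Loc n N m := el g (.z A)

theorem linearCombination_split (v : Fld N m → Loc n N m) (e : Fld N m →₀ Loc n N m) :
    Finsupp.linearCombination (Loc n N m) v e = dot (fun A => e (.z A)) (fun A => v (.z A)) +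
      Finsupp.linearCombination (Loc n N m) v (lamPart e) := by
  rw [Finsupp.linearCombination_apply, sum_eq_add_lamPart _ _ (by simp)]
  rfl

theorem derivation_linearCombination (X : Derivation ℝ (Loc n N m) (Loc n N m))
    (v : Fld N m → Loc n N m) (e : Fld N m →₀ Loc n N m) :
    X (Finsupp.linearCombination (Loc n N m) v e) =
      Finsupp.linearCombination (Loc n N m) v (e.mapRange X (map_zero _)) +
        Finsupp.linearCombination (Loc n N m) (fun u => X (v u)) e := by
  induction e using Finsupp.induction_linear with
  | zero => simp
  | add _ _ h h' =>
    rw [Finsupp.mapRange_add (fun _ _ => map_add _ _ _)]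
    simp only [map_add, h, h']; abel
  | single u g => simp [Derivation.leibniz]; ring

theorem linearCombination_sub_left (v w : Fld N m → Loc n N m) (e : Fld N m →₀ Loc n N m) :
    Finsupp.linearCombination (Loc n N m) (fun u => v u - w u) e =
      Finsupp.linearCombination (Loc n N m) v e - Finsupp.linearCombination (Loc n N m) w e := by
  simp only [Finsupp.linearCombination_apply, smul_sub]
  exact Finsupp.sum_sub

theorem derivation_dot (X : Derivation ℝ (Loc n N m) (Loc n N m)) (a b : Fin N → Loc n N m) :
    X (dot a b) = dot (fun A => X (a A)) b + dot a (fun A => X (b A)) := by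
  simp only [dot, map_sum, Derivation.leibniz, smul_eq_mul, ← Finset.sum_add_distrib]
  exact Finset.sum_congr rfl fun A _ => by ring

/-- The sum of the Euler-Lagrange derivatives of the multipliers, each shifted by one time
derivative. -/
theorem lamPart_sum_shift (w : Fin N → Loc n N m) (e : Fld N m →₀ Loc n N m) (u : Fld N m) :
    ((lamPart e).sum fun u g => adj (shift w u) g) u = match u with
      | .z _ => 0
      | .lam _ 0 => 0
      | .lam a (l + 1) => e (.lam a l) := by
  classical
  have hs : ∀ e e' : Fld N m →₀ Loc n N m, ((e + e').sum fun u g => adj (shift w u) g) =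
      (e.sum fun u g => adj (shift w u) g) + e'.sum fun u g => adj (shift w u) g := fun e e' =>
    Finsupp.sum_add_index' (fun u => adj_zero_right _) (fun u => adj_add_right _)
  induction e using Finsupp.induction_linear with
  | zero =>
    have : lamPart (0 : Fld N m →₀ Loc n N m) = 0 := Finsupp.filter_zero _
    rw [this]
    rcases u with _ | ⟨_, _ | _⟩ <;> simp
  | add e e' h h' =>
    have : lamPart (e + e') = lamPart e + lamPart e' := Finsupp.filter_add
    rw [this, hs, Finsupp.add_apply, h, h']
    rcases u with _ | ⟨_, _ | _⟩ <;> simp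
  | single u' g =>
    cases u' with
    | z A =>
      have : lamPart (Finsupp.single (.z A) g : Fld N m →₀ Loc n N m) = 0 :=
        Finsupp.filter_single_of_neg _ (by simp)
      rw [this]
      rcases u with _ | ⟨_, _ | _⟩ <;> simp
    | lam a l =>
      have : lamPart (Finsupp.single (.lam a l) g : Fld N m →₀ Loc n N m) =
          Finsupp.single (.lam a l) g := Finsupp.filter_single_of_pos _ ⟨a, l, rfl⟩
      rw [this, Finsupp.sum_single_index (h := fun u g => adj (shift w u) g) (adj_zero_right _)]
      change adj (crd (.jet (.lam a (l + 1)) 0)) g u = _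
      rw [adj_crd]
      rcases u with _ | ⟨_, _ | _⟩ <;> simp [Finsupp.single_apply]

theorem eul_mem {I : Ideal (Loc n N m)} (hI : ∀ i, ∀ f ∈ I, tot i f ∈ I) {θ : Form n N m}
    (hθ : ∀ c, θ c ∈ I) (u : Fld N m) : eul θ u ∈ I := by
  classical
  have hn : ∀ J : MIdx n, ∀ f ∈ I, ntot J f ∈ I := by
    intro J
    induction J using midx_induction with
    | h0 => simp
    | hs J i ih => intro f hf; rw [ntot_add_single]; exact neg_mem (ih _ (hI i f hf))
  rw [← Finsupp.sum_single θ, Finsupp.sum, map_sum, Finsupp.finsetSum_apply]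
  refine Submodule.sum_mem _ fun c _ => ?_
  cases c with
  | t => simp
  | x i => simp
  | jet u' J =>
    rw [eul_single_jet, Finsupp.single_apply]
    split_ifs
    · exact hn _ _ (hθ _)
    · exact zero_mem _

theorem adj_mem {I : Ideal (Loc n N m)} (hI : ∀ i, ∀ f ∈ I, tot i f ∈ I) (f : Loc n N m)
    {w : Loc n N m} (hw : w ∈ I) (u : Fld N m) : adj f w u ∈ I :=
  eul_mem hI (fun c => by
    rw [Finsupp.smul_apply, smul_eq_mul]; exact Ideal.mul_mem_right _ _ hw) u

namespace LocTheory

variable {ι : Type*} (T : LocTheory n N m ι)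

/-- Contraction with the Poisson matrix. -/
def sig (b : Fin N → Loc n N m) (A : Fin N) : Loc n N m := ∑ B, T.σ A B • b B

/-- The pairing of two covectors by the Poisson matrix. -/
def pois (a b : Fin N → Loc n N m) : Loc n N m := dot a (T.sig b)

theorem pois_eq (a b : Fin N → Loc n N m) :
    T.pois a b = ∑ A, ∑ B, T.σ A B • (a A * b B) := by
  simp [pois, dot, sig, Finset.mul_sum]

theorem pois_skew (a b : Fin N → Loc n N m) : T.pois a b = - T.pois b a := by
  rw [pois_eq, pois_eq, Finset.sum_comm, ← Finset.sum_neg_distrib]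
  refine Finset.sum_congr rfl fun A _ => ?_
  rw [← Finset.sum_neg_distrib]
  refine Finset.sum_congr rfl fun B _ => ?_
  rw [T.σ_skew, neg_smul, mul_comm]

theorem pois_add_left (a a' b : Fin N → Loc n N m) :
    T.pois (fun A => a A + a' A) b = T.pois a b + T.pois a' b := by
  simp [pois, dot, add_mul, Finset.sum_add_distrib]

theorem pois_sub_left (a a' b : Fin N → Loc n N m) :
    T.pois (fun A => a A - a' A) b = T.pois a b - T.pois a' b := by
  simp [pois, dot, sub_mul]

theorem derivation_sig (X : Derivation ℝ (Loc n N m) (Loc n N m)) (b : Fin N → Loc n N m)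
    (A : Fin N) : X (T.sig b A) = T.sig (fun B => X (b B)) A := by
  simp [sig]

theorem derivation_pois (X : Derivation ℝ (Loc n N m) (Loc n N m)) (a b : Fin N → Loc n N m) :
    X (T.pois a b) = T.pois (fun A => X (a A)) b + T.pois a (fun A => X (b A)) := by
  simp only [pois, derivation_dot, derivation_sig]

/-- The adjoint form of the antisymmetry of the Poisson matrix. -/
theorem sum_adj_sig (a b : Fin N → Loc n N m) :
    ∑ A, adj (T.sig b A) (a A) = - ∑ A, adj (b A) (T.sig a A) := by
  simp only [sig, adj_sum_left, adj_sum_right, adj_smul_left, adj_smul_right]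
  rw [Finset.sum_comm, ← Finset.sum_neg_distrib]
  refine Finset.sum_congr rfl fun A _ => ?_
  rw [← Finset.sum_neg_distrib]
  exact Finset.sum_congr rfl fun B _ => by rw [T.σ_skew, neg_smul]

/-- The Hamiltonian vector field of a functional. -/
def ham (g : Loc n N m) : Fin N → Loc n N m := T.sig (zel g)

/-- The time derivative `δ_t`. -/
def dt : Derivation ℝ (Loc n N m) (Loc n N m) := evo 1 (shift (T.ham T.H))

/-- The characteristic of the variation `δ̃` generated by `Z` and `Λ`. -/
def tch (τ : (Fin N → Loc n N m) × (Fin m → Loc n N m)) : Fld N m → Loc n N m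
  | .z A => τ.1 A
  | .lam a l => T.dt^[l] (τ.2 a)

/-- The transformation generated by a couple. -/
def gen (c : Loc n N m × (Fin m → Loc n N m)) : (Fin N → Loc n N m) × (Fin m → Loc n N m) :=
  (T.ham c.1, c.2)

/-- The variation `δ̃` generated by a couple. -/
def var (c : Loc n N m × (Fin m → Loc n N m)) : Derivation ℝ (Loc n N m) (Loc n N m) :=
  evo 0 (T.tch (T.gen c))

/-- The modified bracket of couples. -/
def br (c₁ c₂ : Loc n N m × (Fin m → Loc n N m)) : Loc n N m × (Fin m → Loc n N m) :=
  (T.var c₁ c₂.1 - T.var c₂ c₁.1 - T.pois (zel c₂.1) (zel c₁.1),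
    fun a => T.var c₁ (c₂.2 a) - T.var c₂ (c₁.2 a))

/-! ### The ideals of the constraints and integration by parts -/

/-- The region. -/
def reg : Set (Fin n → ℝ) := {x | 0 ≤ T.ρ x}

/-- The boundary of the region. -/
def bd : Set (Fin n → ℝ) := {x | T.ρ x = 0}

/-- The local functions that vanish weakly over the region. -/
def weak : Ideal (Loc n N m) := constrIdeal T.φ T.reg

/-- The local functions that vanish weakly on the boundary. -/
def bweak : Ideal (Loc n N m) := constrIdeal T.φ T.bd

theorem vanish_le_weak : vanish T.reg ≤ T.weak := le_sup_left

theorem weak_le_bweak : T.weak ≤ T.bweak :=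
  sup_le_sup_right (fun _ hf p hp => hf p (le_of_eq (Eq.symm hp))) _

theorem tot_mem_vanish_reg (i : Fin n) (f : Loc n N m) (hf : f ∈ vanish T.reg) :
    tot i f ∈ vanish T.reg :=
  tot_mem_vanish T.ρ_smooth T.ρ_regular hf i

theorem tot_mem_weak (i : Fin n) (f : Loc n N m) (hf : f ∈ T.weak) : tot i f ∈ T.weak :=
  derivation_mem_constrIdeal (T.tot_mem_vanish_reg i)
    (fun a I => by rw [← totI_add_single]; exact totI_mem_constrIdeal _ _ _ _) hf

theorem totI_mem_weak (I : MIdx n) {f : Loc n N m} (hf : f ∈ T.weak) : totI I f ∈ T.weak := by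
  induction I using midx_induction with
  | h0 => simpa
  | hs I i ih => rw [totI_add_single]; exact T.tot_mem_weak i _ ih

theorem totI_mem_vanish (I : MIdx n) {f : Loc n N m} (hf : f ∈ vanish T.reg) :
    totI I f ∈ vanish T.reg := by
  induction I using midx_induction with
  | h0 => simpa
  | hs I i ih => rw [totI_add_single]; exact T.tot_mem_vanish_reg i _ ih

theorem evo_mem_weak {s : ℝ} {Q : Fld N m → Loc n N m} (hQ : ∀ a, evo s Q (T.φ a) ∈ T.weak)
    {f : Loc n N m} (hf : f ∈ T.weak) : evo s Q f ∈ T.weak :=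
  derivation_mem_constrIdeal (fun _ => evo_mem_vanish s Q)
    (fun a I => by rw [evo_totI]; exact T.totI_mem_weak I (hQ a)) hf

theorem evo_mem_bweak {s : ℝ} {Q : Fld N m → Loc n N m}
    (hQ : ∀ a I, evo s Q (totI I (T.φ a)) ∈ T.bweak) {f : Loc n N m} (hf : f ∈ T.bweak) :
    evo s Q f ∈ T.bweak :=
  derivation_mem_constrIdeal (fun _ => evo_mem_vanish s Q) hQ hf

theorem evo_mem_bweak_of_weak {s : ℝ} {Q : Fld N m → Loc n N m}
    (hQ : ∀ a, evo s Q (T.φ a) ∈ T.weak) {f : Loc n N m} (hf : f ∈ T.bweak) :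
    evo s Q f ∈ T.bweak :=
  T.evo_mem_bweak (fun a I => T.weak_le_bweak
    (by rw [evo_totI]; exact T.totI_mem_weak I (hQ a))) hf

theorem evo_char_mem_weak {Q : Fld N m → Loc n N m} (hQ : ∀ u, Q u ∈ T.weak) (f : Loc n N m) :
    evo 0 Q f ∈ T.weak := by
  refine vf_mem fun c => Ideal.mul_mem_left _ _ ?_
  cases c with
  | t => simp [evoCoef]
  | x i => simp [evoCoef]
  | jet u I => exact T.totI_mem_weak I (hQ u)

theorem dt_mem_weak {f : Loc n N m} (hf : f ∈ T.weak) : T.dt f ∈ T.weak :=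
  T.evo_mem_weak T.φ_first hf

theorem dt_mem_bweak {f : Loc n N m} (hf : f ∈ T.bweak) : T.dt f ∈ T.bweak :=
  T.evo_mem_bweak_of_weak T.φ_first hf

/-- Functions that vanish weakly on the boundary together with all their derivatives. -/
def BFlat (f : Loc n N m) : Prop := ∀ I, totI I f ∈ T.bweak

variable {T} in
theorem BFlat.tot {f : Loc n N m} (hf : T.BFlat f) (i : Fin n) :
    T.BFlat (GaugeBracket.tot i f) := fun I => by
  rw [totI_tot, ← totI_add_single]; exact hf _

variable {T} in
theorem BFlat.mul {f : Loc n N m} (hf : T.BFlat f) (g : Loc n N m) : T.BFlat (f * g) := by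
  intro I
  induction I using midx_induction generalizing f g with
  | h0 => simpa using Ideal.mul_mem_right g _ (by simpa using hf 0)
  | hs I i ih =>
    rw [totI_add_single, ← totI_tot, Derivation.leibniz, map_add, smul_eq_mul, smul_eq_mul,
      mul_comm g]
    exact add_mem (ih hf _) (ih (hf.tot i) _)

variable {T} in
theorem BFlat.totI {f : Loc n N m} (hf : T.BFlat f) (I : MIdx n) :
    T.BFlat (GaugeBracket.totI I f) := by
  induction I using midx_induction with
  | h0 => simpa
  | hs I i ih => rw [totI_add_single]; exact ih.tot i

theorem bflat_of_weak {f : Loc n N m} (hf : f ∈ T.weak) : T.BFlat f := fun I =>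
  T.weak_le_bweak (T.totI_mem_weak I hf)

/-- The components of the conormal of the boundary. -/
def conormal (i : Fin n) : Loc n N m :=
  .mk (fun p => fderiv ℝ T.ρ (base p) (Pi.single i 1))
    (isLocal_base (g := fun x => fderiv ℝ T.ρ x (Pi.single i 1))
      ((T.ρ_smooth.fderiv_right (m := ∞) (by simp)).clm_apply contDiff_const))

theorem evo_conormal (s : ℝ) (Q : Fld N m → Loc n N m) (i : Fin n) :
    evo s Q (T.conormal i) = 0 := by
  have h : ∀ c : Coord n N m, (∀ i, c ≠ .x i) → pdl c (T.conormal i) = 0 := fun c hc =>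
    pdl_eq_zero_of_dependsOn (dependsOn_base (g := fun x => fderiv ℝ T.ρ x (Pi.single i 1)))
      (by rintro ⟨j, rfl⟩; exact hc j rfl)
  rw [evo, vf_apply, Finsupp.linearCombination_apply]
  refine Finset.sum_eq_zero fun c _ => ?_
  cases c with
  | t => simp [h]
  | x i => simp [evoCoef]
  | jet u I => simp [h]

/-- The densities of functionals that are zero: divergences without flux through the boundary. -/
def null : Submodule ℝ (Loc n N m) where
  carrier := {f | ∃ k : Fin n → Loc n N m, f - ∑ i, tot i (k i) ∈ vanish T.reg ∧
    ∑ i, T.conormal i * k i ∈ T.bweak}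
  zero_mem' := ⟨0, by simp, by simp⟩
  add_mem' := by
    rintro f g ⟨k, hk, hk'⟩ ⟨l, hl, hl'⟩
    refine ⟨k + l, ?_, ?_⟩
    · have := add_mem hk hl
      simp only [Pi.add_apply, map_add, Finset.sum_add_distrib]
      convert this using 1; ring
    · simpa only [Pi.add_apply, mul_add, Finset.sum_add_distrib] using add_mem hk' hl'
  smul_mem' := by
    rintro r f ⟨k, hk, hk'⟩
    refine ⟨r • k, ?_, ?_⟩
    · have := Submodule.smul_of_tower_mem _ r hk
      simpa only [Pi.smul_apply, Derivation.map_smul, ← Finset.smul_sum, ← smul_sub] using this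
    · have := Submodule.smul_of_tower_mem _ r hk'
      simpa only [Pi.smul_apply, mul_smul_comm, ← Finset.smul_sum] using this

theorem tot_mem_null {f : Loc n N m} (hf : f ∈ T.bweak) (i : Fin n) : tot i f ∈ T.null := by
  classical
  refine ⟨Pi.single i f, ?_, ?_⟩
  · rw [Finset.sum_eq_single i (fun j _ hj => by simp [hj]) (by simp)]; simp
  · refine Submodule.sum_mem _ fun j _ => Ideal.mul_mem_left _ _ ?_
    by_cases hj : j = i
    · subst hj; simpa
    · simp [hj]

theorem evo_mem_null {s : ℝ} {Q : Fld N m → Loc n N m}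
    (hQ : ∀ f ∈ T.bweak, evo s Q f ∈ T.bweak) {f : Loc n N m} (hf : f ∈ T.null) :
    evo s Q f ∈ T.null := by
  obtain ⟨k, hk, hk'⟩ := hf
  refine ⟨fun i => evo s Q (k i), ?_, ?_⟩
  · simpa only [map_sub, map_sum, evo_tot] using evo_mem_vanish s Q hk
  · simpa only [map_sum, Derivation.leibniz, evo_conormal, smul_eq_mul, mul_zero, add_zero]
      using hQ _ hk'

theorem el_mem_vanish_of_mem_vanish {f : Loc n N m} (hf : f ∈ vanish T.reg) (u : Fld N m) :
    el f u ∈ vanish T.reg :=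
  eul_mem (T.tot_mem_vanish_reg) (fun c => pdl_mem_vanish T.ρ_smooth T.ρ_regular hf c) u

theorem el_sum_tot (k : Fin n → Loc n N m) : el (∑ i, tot i (k i)) = 0 := by
  have : el (∑ i, tot i (k i)) = ∑ i, el (tot i (k i)) := by simp [el]
  rw [this]
  exact Finset.sum_eq_zero fun i _ => el_tot i _

theorem el_mem_vanish {f : Loc n N m} (hf : f ∈ T.null) (u : Fld N m) :
    el f u ∈ vanish T.reg := by
  obtain ⟨k, hk, -⟩ := hf
  have := T.el_mem_vanish_of_mem_vanish hk u
  rwa [el_sub, el_sum_tot, sub_zero] at this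

theorem mul_totI_sub_mem_null (g v : Loc n N m) (h : T.BFlat g ∨ T.BFlat v) (I : MIdx n) :
    g * totI I v - ntot I g * v ∈ T.null := by
  induction I using midx_induction generalizing g with
  | h0 => simp
  | hs I i ih =>
    have h1 : tot i (g * totI I v) ∈ T.null := by
      refine T.tot_mem_null ?_ i
      rcases h with h | h
      · simpa using h.mul (totI I v) 0
      · rw [mul_comm]; simpa using (h.totI I).mul g 0
    have h2 := ih (tot i g) (h.imp_left fun h => h.tot i)
    rw [Derivation.leibniz] at h1
    convert sub_mem h1 h2 using 1
    rw [totI_add_single, ntot_add_single]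
    simp only [smul_eq_mul]
    ring

/-- Integration by parts, without boundary terms when one of the factors is flat there. -/
theorem parts (v : Fld N m → Loc n N m) (θ : Form n N m)
    (h : (∀ c, T.BFlat (θ c)) ∨ ∀ u, T.BFlat (v u)) :
    Finsupp.linearCombination (Loc n N m) (evoCoef 0 v) θ -
      Finsupp.linearCombination (Loc n N m) v (eul θ) ∈ T.null := by
  have : Finsupp.linearCombination (Loc n N m) (evoCoef 0 v) θ -
      Finsupp.linearCombination (Loc n N m) v (eul θ) =
      θ.sum fun c g => Finsupp.linearCombination (Loc n N m) (evoCoef 0 v) (Finsupp.single c g) -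
      Finsupp.linearCombination (Loc n N m) v (eul (Finsupp.single c g)) := by
    conv_lhs => rw [← Finsupp.sum_single θ]
    simp only [Finsupp.sum, map_sum, Finset.sum_sub_distrib]
  rw [this]
  refine Submodule.sum_mem _ fun c _ => ?_
  cases c with
  | t => simp [evoCoef]
  | x i => simp [evoCoef]
  | jet u I =>
    simp only [Finsupp.linearCombination_single, eul_single_jet, smul_eq_mul]
    exact T.mul_totI_sub_mem_null _ _ (h.imp (fun h => h _) fun h => h _) I

theorem evo_sub_mem_null {v : Fld N m → Loc n N m} (hv : ∀ u, v u ∈ T.weak) (f : Loc n N m) :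
    evo 0 v f - Finsupp.linearCombination (Loc n N m) v (el f) ∈ T.null :=
  T.parts v (grad f) (.inr fun u => T.bflat_of_weak (hv u))

theorem mul_evo_sub_mem_null (v : Fld N m → Loc n N m) {w : Loc n N m} (hw : w ∈ T.weak)
    (f : Loc n N m) :
    w * evo 0 v f - Finsupp.linearCombination (Loc n N m) v (adj f w) ∈ T.null := by
  have := T.parts v (w • grad f) (.inl fun c => by
    rw [Finsupp.smul_apply, smul_eq_mul]; exact (T.bflat_of_weak hw).mul _)
  rwa [map_smul, smul_eq_mul] at this

end LocTheory

namespace LocTheory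

variable {ι : Type*} (T : LocTheory n N m ι)

/-! ### Consequences of the invariance of the action -/

/-- Variations that preserve the internal boundary conditions. -/
structure Pres (v : Fld N m → Loc n N m) : Prop where
  external : ∀ a I, evo 0 v (totI I (T.φ a)) ∈ T.bweak
  internal : ∀ k α, evo 0 v (T.dt^[k] (T.χ α)) ∈ T.bweak

/-- Functionals without boundary term in their variation. -/
def HasVar (g : Loc n N m) : Prop :=
  ∀ v, T.Pres v → evo 0 v g - Finsupp.linearCombination (Loc n N m) v (el g) ∈ T.null

/-- The change of the action under a couple, when the canonical fields follow the flow of the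
Hamiltonian. -/
def defect (c : Loc n N m × (Fin m → Loc n N m)) : Loc n N m :=
  T.dt c.1 - T.pois (zel c.1) (zel T.H) - T.var c T.H

/-- Couples that generate external symmetries. -/
structure Ext (c : Loc n N m × (Fin m → Loc n N m)) : Prop where
  source : ∀ v, T.Pres v → ∀ α,
    T.var c (evo 0 v (T.χ α)) - evo 0 v (T.var c (T.χ α)) ∈ T.bweak
  variation : T.HasVar c.1
  action : ∃ V : Fin n → Loc n N m,
    (∀ v, T.Pres v → evo 0 v (∑ i, tot i (V i)) ∈ T.null) ∧
    T.defect c - ∑ i, tot i (V i) ∈ T.null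

theorem el_pois (g f : Loc n N m) : el (T.pois (zel g) (zel f)) =
    ∑ A, adj (zel g A) (T.ham f A) + ∑ A, adj (T.ham f A) (zel g A) := by
  rw [← Finset.sum_add_distrib]
  have : ∀ s : Finset (Fin N), ∀ k : Fin N → Loc n N m, el (∑ A ∈ s, k A) = ∑ A ∈ s, el (k A) := by
    intro s k; simp [el]
  rw [pois, dot, this]
  exact Finset.sum_congr rfl fun A _ => el_mul _ _

/-- The part of the Euler-Lagrange derivatives of `δ_Q g` that comes from the dependence of `Q` on
the fields splits into canonical fields and multipliers. -/
theorem el_evo_split (s : ℝ) (Q : Fld N m → Loc n N m) (g : Loc n N m) :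
    el (evo s Q g) = (el g).mapRange (evo s Q) (map_zero _) + (∑ A, adj (Q (.z A)) (zel g A) +
      (lamPart (el g)).sum fun u w => adj (Q u) w) := by
  rw [el_evo, sum_eq_add_lamPart _ _ (by simp)]
  rfl

theorem lamPart_el_H_sum (Q : Fld N m → Loc n N m) :
    ((lamPart (el T.H)).sum fun u w => adj (Q u) w) = ∑ a, adj (Q (.lam a 0)) (T.φ a) := by
  classical
  have hinj : Function.Injective fun a : Fin m => (Fld.lam a 0 : Fld N m) :=
    fun a b h => by cases h; rfl
  rw [Finsupp.sum_of_support_subset _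
    (s := Finset.univ.image fun a : Fin m => (Fld.lam a 0 : Fld N m))
    _ _ (by simp), Finset.sum_image fun a _ b _ h => hinj h]
  · simp [T.el_H_lam]
  · intro u hu
    rw [Finsupp.mem_support_iff] at hu
    cases u with
    | z A => simp at hu
    | lam a l =>
      rw [lamPart_lam, T.el_H_lam] at hu
      have : l = 0 := by by_contra h; simp [h] at hu
      subst this
      exact Finset.mem_image_of_mem _ (Finset.mem_univ a)

/-- The Euler-Lagrange derivatives of the change of the action. -/
theorem el_defect (c : Loc n N m × (Fin m → Loc n N m)) (u : Fld N m) :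
    el (T.defect c) u = T.dt (el c.1 u) +
      ((lamPart (el c.1)).sum fun u g => adj (shift (T.ham T.H) u) g) u -
      T.var c (el T.H u) - ∑ a, adj (c.2 a) (T.φ a) u := by
  have h1 : ∑ A, adj (T.ham c.1 A) (zel T.H A) = - ∑ A, adj (zel c.1 A) (T.ham T.H A) :=
    T.sum_adj_sig (zel T.H) (zel c.1)
  rw [defect, el_sub, el_sub, el_pois, dt, var, el_evo_split, el_evo_split, lamPart_el_H_sum]
  simp only [tch, gen, shift, Function.iterate_zero, id_eq]
  rw [h1]
  simp only [Finsupp.sub_apply, Finsupp.add_apply, Finsupp.mapRange_apply, Finsupp.neg_apply,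
    Finsupp.finsetSum_apply]
  ring

variable {T}

namespace Ext

variable {c c₁ c₂ c₃ : Loc n N m × (Fin m → Loc n N m)}

theorem el_defect_mem (hc : T.Ext c) (u : Fld N m) : T.dt (el c.1 u) +
      ((lamPart (el c.1)).sum fun u g => adj (shift (T.ham T.H) u) g) u -
      T.var c (el T.H u) - ∑ a, adj (c.2 a) (T.φ a) u ∈ vanish T.reg := by
  obtain ⟨V, -, hV⟩ := hc.action
  have := T.el_mem_vanish hV u
  rwa [el_sub, el_sum_tot, sub_zero, el_defect] at this

theorem adj_φ_mem (T : LocTheory n N m ι) (Λ : Fin m → Loc n N m) (u : Fld N m) :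
    ∑ a, adj (Λ a) (T.φ a) u ∈ T.weak :=
  Submodule.sum_mem _ fun a _ => adj_mem T.tot_mem_weak _
    (by simpa [weak] using totI_mem_constrIdeal T.φ T.reg a 0) _

theorem el_lam_succ (hc : T.Ext c) (a : Fin m) (l : ℕ) :
    el c.1 (.lam a l) - (∑ b, adj (c.2 b) (T.φ b) (.lam a (l + 1)) - T.dt (el c.1 (.lam a (l + 1))))
      ∈ vanish T.reg := by
  have := hc.el_defect_mem (.lam a (l + 1))
  rw [lamPart_sum_shift, T.el_H_lam] at this
  simp only [Nat.succ_ne_zero, if_false, map_zero, sub_zero] at this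
  convert this using 1
  ring

/-- On the region, the derivatives of the generator with respect to the multipliers vanish
weakly: the one of order `l` is determined, up to weakly vanishing terms, by the time derivative of
the one of order `l + 1`, and those of high order are zero. -/
theorem el_lam_mem (hc : T.Ext c) (a : Fin m) (l : ℕ) : el c.1 (.lam a l) ∈ T.weak := by
  classical
  obtain ⟨L, hL⟩ : ∃ L, ∀ l, L ≤ l → el c.1 (.lam a l) = 0 := by
    have hinj : Function.Injective fun l => (Fld.lam a l : Fld N m) := fun l l' h => by
      cases h; rfl
    obtain ⟨L, hL⟩ := ((el c.1).hasFiniteSupport.preimage hinj.injOn).bddAbove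
    refine ⟨L + 1, fun l hl => ?_⟩
    by_contra h
    have := hL (show l ∈ _ from h)
    omega
  have key : ∀ k l, L ≤ l + k → el c.1 (.lam a l) ∈ T.weak := by
    intro k
    induction k with
    | zero => intro l hl; rw [hL l hl]; exact zero_mem _
    | succ k ih =>
      intro l hl
      have h1 := T.vanish_le_weak (hc.el_lam_succ a l)
      have h2 := sub_mem (adj_φ_mem T c.2 (.lam a (l + 1)))
        (T.dt_mem_weak (ih (l + 1) (by omega)))
      simpa using add_mem h1 h2
  exact key L l (by omega)

/-- External symmetries preserve the constraints, by the invariance of the action under variations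
of the multipliers. -/
theorem var_φ_mem (hc : T.Ext c) (a : Fin m) : T.var c (T.φ a) ∈ T.weak := by
  have := T.vanish_le_weak (hc.el_defect_mem (.lam a 0))
  rw [lamPart_sum_shift, T.el_H_lam] at this
  simp only [if_true, add_zero] at this
  have h2 := sub_mem (sub_mem (T.dt_mem_weak (hc.el_lam_mem a 0)) this)
    (adj_φ_mem T c.2 (.lam a 0))
  convert h2 using 1
  ring

theorem var_mem_weak (hc : T.Ext c) {f : Loc n N m} (hf : f ∈ T.weak) : T.var c f ∈ T.weak :=
  T.evo_mem_weak hc.var_φ_mem hf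

theorem var_mem_bweak (hc : T.Ext c) {f : Loc n N m} (hf : f ∈ T.bweak) : T.var c f ∈ T.bweak :=
  T.evo_mem_bweak_of_weak hc.var_φ_mem hf

theorem var_mem_null (hc : T.Ext c) {f : Loc n N m} (hf : f ∈ T.null) : T.var c f ∈ T.null :=
  T.evo_mem_null (fun _ => hc.var_mem_bweak) hf

/-- The invariance of the action under variations of the canonical fields. -/
theorem el_z_mem (hc : T.Ext c) (A : Fin N) :
    T.dt (zel c.1 A) - T.var c (zel T.H A) ∈ T.weak := by
  have := T.vanish_le_weak (hc.el_defect_mem (.z A))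
  rw [lamPart_sum_shift] at this
  simpa [zel] using add_mem this (adj_φ_mem T c.2 (.z A))

end Ext

/-- The characteristic of the commutator of `δ_t` and `δ̃`. -/
def rchar (T : LocTheory n N m ι) (c : Loc n N m × (Fin m → Loc n N m)) :
    Fld N m → Loc n N m
  | .z A => T.sig (fun B => T.dt (zel c.1 B) - T.var c (zel T.H B)) A
  | .lam _ _ => 0

theorem dt_var_sub (T : LocTheory n N m ι) (c : Loc n N m × (Fin m → Loc n N m))
    (f : Loc n N m) : T.dt (T.var c f) - T.var c (T.dt f) = evo 0 (T.rchar c) f := by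
  refine (evo_evo _ _ _ _ f).trans ?_
  congr 2
  funext u
  cases u with
  | z A =>
    have h1 : T.dt (T.ham c.1 A) = T.sig (fun B => T.dt (zel c.1 B)) A := T.derivation_sig _ _ _
    have h2 : T.var c (T.ham T.H A) = T.sig (fun B => T.var c (zel T.H B)) A :=
      T.derivation_sig _ _ _
    refine (congrArg₂ (· - ·) h1 h2).trans ?_
    simp [rchar, sig, smul_sub]
  | lam a l =>
    refine sub_eq_zero.2 ?_
    change T.dt (T.dt^[l] (c.2 a)) = evo 0 _ (crd _)
    rw [evo_crd, totI_zero]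
    exact (Function.iterate_succ_apply' _ _ _).symm

namespace Ext

variable {c c₁ c₂ c₃ : Loc n N m × (Fin m → Loc n N m)}

theorem rchar_mem (hc : T.Ext c) (u : Fld N m) : T.rchar c u ∈ T.weak := by
  cases u with
  | z A =>
    simp only [rchar, sig]
    exact Submodule.sum_mem _ fun B _ => Submodule.smul_of_tower_mem _ (T.σ A B) (hc.el_z_mem B)
  | lam a l => exact zero_mem _

/-- Time derivative and symmetry transformation commute weakly. -/
theorem dt_var_sub_mem (hc : T.Ext c) (f : Loc n N m) :
    T.dt (T.var c f) - T.var c (T.dt f) ∈ T.weak := by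
  rw [dt_var_sub]; exact T.evo_char_mem_weak hc.rchar_mem f

theorem dt_iterate_var_sub_mem (hc : T.Ext c) (k : ℕ) (f : Loc n N m) :
    T.dt^[k] (T.var c f) - T.var c (T.dt^[k] f) ∈ T.weak := by
  induction k with
  | zero => simp
  | succ k ih =>
    rw [Function.iterate_succ_apply', Function.iterate_succ_apply']
    have h1 := T.dt_mem_weak ih
    rw [map_sub] at h1
    simpa using add_mem h1 (hc.dt_var_sub_mem (T.dt^[k] f))

end Ext

/-! ### The commutator of two external symmetries -/

theorem dt_iterate_smul (T : LocTheory n N m ι) (k : ℕ) (r : ℝ) (f : Loc n N m) :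
    T.dt^[k] (r • f) = r • T.dt^[k] f := by
  induction k with
  | zero => rfl
  | succ k ih => simp only [Function.iterate_succ_apply', ih, Derivation.map_smul]

theorem dt_iterate_sub (T : LocTheory n N m ι) (k : ℕ) (f g : Loc n N m) :
    T.dt^[k] (f - g) = T.dt^[k] f - T.dt^[k] g := by
  induction k with
  | zero => rfl
  | succ k ih => simp only [Function.iterate_succ_apply', ih, map_sub]

/-- The contribution of the dependence on the multipliers to the Euler-Lagrange derivatives of
`δ̃₁ G₂`. -/
def lamAdj (T : LocTheory n N m ι) (c₁ c₂ : Loc n N m × (Fin m → Loc n N m)) :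
    Fld N m →₀ Loc n N m :=
  (lamPart (el c₂.1)).sum fun u w => adj (T.tch (T.gen c₁) u) w

/-- The Euler-Lagrange derivatives of the generator of a modified bracket. -/
theorem el_br (T : LocTheory n N m ι) (c₁ c₂ : Loc n N m × (Fin m → Loc n N m)) :
    el (T.br c₁ c₂).1 = (el c₂.1).mapRange (T.var c₁) (map_zero _) -
      (el c₁.1).mapRange (T.var c₂) (map_zero _) + (T.lamAdj c₁ c₂ - T.lamAdj c₂ c₁) := by
  have h1 : ∑ A, adj (T.ham c₂.1 A) (zel c₁.1 A) = - ∑ A, adj (zel c₂.1 A) (T.ham c₁.1 A) :=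
    T.sum_adj_sig (zel c₁.1) (zel c₂.1)
  rw [br, el_sub, el_sub, el_pois, var, var, el_evo_split, el_evo_split]
  simp only [tch, gen]
  rw [h1]
  simp only [lamAdj, tch, gen]
  abel

theorem zel_br (T : LocTheory n N m ι) (c₁ c₂ : Loc n N m × (Fin m → Loc n N m)) (A : Fin N) :
    zel (T.br c₁ c₂).1 A = T.var c₁ (zel c₂.1 A) - T.var c₂ (zel c₁.1 A) +
      (T.lamAdj c₁ c₂ (.z A) - T.lamAdj c₂ c₁ (.z A)) := by
  rw [zel, el_br]; rfl

/-- The characteristic of the difference between `δ̃_{[1,2]}` and the commutator of `δ̃₁` and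
`δ̃₂`. -/
def ychar (T : LocTheory n N m ι) (c₁ c₂ : Loc n N m × (Fin m → Loc n N m)) (u : Fld N m) :
    Loc n N m :=
  T.tch (T.gen (T.br c₁ c₂)) u -
    (T.var c₁ (T.tch (T.gen c₂) u) - T.var c₂ (T.tch (T.gen c₁) u))

theorem var_br (T : LocTheory n N m ι) (c₁ c₂ : Loc n N m × (Fin m → Loc n N m))
    (f : Loc n N m) : T.var (T.br c₁ c₂) f =
      T.var c₁ (T.var c₂ f) - T.var c₂ (T.var c₁ f) + evo 0 (T.ychar c₁ c₂) f := by
  have h1 := evo_evo 0 0 (T.tch (T.gen c₁)) (T.tch (T.gen c₂)) f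
  simp only [var] at h1 ⊢
  rw [h1, ← evo_add]
  congr 2
  · simp
  · funext u; simp [ychar, var]

theorem ychar_z (T : LocTheory n N m ι) (c₁ c₂ : Loc n N m × (Fin m → Loc n N m)) (A : Fin N) :
    T.ychar c₁ c₂ (.z A) =
      T.sig (fun B => T.lamAdj c₁ c₂ (.z B) - T.lamAdj c₂ c₁ (.z B)) A := by
  change T.sig (zel (T.br c₁ c₂).1) A -
    (T.var c₁ (T.sig (zel c₂.1) A) - T.var c₂ (T.sig (zel c₁.1) A)) = _
  rw [derivation_sig, derivation_sig]
  simp only [sig, zel_br, ← Finset.sum_sub_distrib, ← smul_sub]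
  exact Finset.sum_congr rfl fun B _ => by congr 1; ring

namespace Ext

variable {c c₁ c₂ c₃ : Loc n N m × (Fin m → Loc n N m)}

theorem lamAdj_mem (h₂ : T.Ext c₂) (c₁ : Loc n N m × (Fin m → Loc n N m)) (u : Fld N m) :
    T.lamAdj c₁ c₂ u ∈ T.weak := by
  rw [lamAdj, Finsupp.sum, Finsupp.finsetSum_apply]
  refine Submodule.sum_mem _ fun u' _ => adj_mem T.tot_mem_weak _ ?_ u
  cases u' with
  | z A => simp
  | lam a l => rw [lamPart_lam]; exact h₂.el_lam_mem a l

/-- The modified bracket generates the commutator of the transformations up to weakly vanishing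
variations. -/
theorem ychar_mem (h₁ : T.Ext c₁) (h₂ : T.Ext c₂) (u : Fld N m) : T.ychar c₁ c₂ u ∈ T.weak := by
  cases u with
  | z A =>
    rw [ychar_z]
    exact Submodule.sum_mem _ fun B _ => Submodule.smul_of_tower_mem _ (T.σ A B)
      (sub_mem (h₂.lamAdj_mem _ _) (h₁.lamAdj_mem _ _))
  | lam a l =>
    have := sub_mem (h₁.dt_iterate_var_sub_mem l (c₂.2 a)) (h₂.dt_iterate_var_sub_mem l (c₁.2 a))
    convert this using 1
    simp only [ychar, tch, gen, br, dt_iterate_sub]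
    ring

end Ext

/-! ### Variations that preserve the internal boundary conditions -/

namespace Pres

variable {v : Fld N m → Loc n N m} {c : Loc n N m × (Fin m → Loc n N m)}

theorem mem_bweak (hv : T.Pres v) {f : Loc n N m} (hf : f ∈ T.bweak) : evo 0 v f ∈ T.bweak :=
  T.evo_mem_bweak hv.external hf

/-- The commutator of `δ_t` and a variation preserves the internal boundary conditions. -/
theorem comm_dt (hv : T.Pres v) :
    T.Pres fun u => T.dt (v u) - evo 0 v (shift (T.ham T.H) u) := by
  have h : ∀ f, evo 0 (fun u => T.dt (v u) - evo 0 v (shift (T.ham T.H) u)) f =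
      T.dt (evo 0 v f) - evo 0 v (T.dt f) := fun f => (evo_evo _ _ _ _ f).symm
  refine ⟨fun a I => ?_, fun k α => ?_⟩
  · rw [h]
    exact sub_mem (T.dt_mem_bweak (hv.external a I)) (hv.mem_bweak
      (T.dt_mem_bweak (totI_mem_constrIdeal _ _ _ _)))
  · rw [h, ← Function.iterate_succ_apply' T.dt]
    exact sub_mem (T.dt_mem_bweak (hv.internal k α)) (hv.internal (k + 1) α)

/-- Functions on the boundary that depend on the sources only keep this property in time. -/
theorem dt_iterate_mem {f : Loc n N m} (hf : ∀ v, T.Pres v → evo 0 v f ∈ T.bweak) (k : ℕ) :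
    ∀ v, T.Pres v → evo 0 v (T.dt^[k] f) ∈ T.bweak := by
  induction k with
  | zero => exact hf
  | succ k ih =>
    intro v hv
    rw [Function.iterate_succ_apply']
    have h1 := ih _ hv.comm_dt
    have h : evo 0 (fun u => T.dt (v u) - evo 0 v (shift (T.ham T.H) u)) (T.dt^[k] f) =
      T.dt (evo 0 v (T.dt^[k] f)) - evo 0 v (T.dt (T.dt^[k] f)) := (evo_evo _ _ _ _ _).symm
    rw [h] at h1
    simpa using sub_mem (T.dt_mem_bweak (ih v hv)) h1

/-- The characteristic of the commutator of `δ̃` and a variation. -/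
def commChar (T : LocTheory n N m ι) (c : Loc n N m × (Fin m → Loc n N m))
    (v : Fld N m → Loc n N m) (u : Fld N m) : Loc n N m :=
  T.var c (v u) - evo 0 v (T.tch (T.gen c) u)

theorem evo_commChar (T : LocTheory n N m ι) (c : Loc n N m × (Fin m → Loc n N m))
    (v : Fld N m → Loc n N m) (f : Loc n N m) :
    evo 0 (commChar T c v) f = T.var c (evo 0 v f) - evo 0 v (T.var c f) :=
  (evo_evo _ _ _ _ f).symm

theorem evo_dt_iterate_var_mem (hv : T.Pres v) (hc : T.Ext c) (k : ℕ) (α : ι) :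
    evo 0 v (T.var c (T.dt^[k] (T.χ α))) ∈ T.bweak := by
  have h1 : ∀ v, T.Pres v → evo 0 v (T.var c (T.χ α)) ∈ T.bweak := fun v hv => by
    have := sub_mem (hc.var_mem_bweak (hv.internal 0 α)) (hc.source v hv α)
    simpa using this
  have h2 := dt_iterate_mem h1 k v hv
  have h3 := hv.mem_bweak (T.weak_le_bweak (hc.dt_iterate_var_sub_mem k (T.χ α)))
  rw [map_sub] at h3
  simpa using sub_mem h2 h3

/-- The commutator of `δ̃` and a variation preserves the internal boundary conditions at all times,
as `δ̃` commutes weakly with `δ_t` and fixes the boundary values of `χ` up to sources. -/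
theorem comm_var (hv : T.Pres v) (hc : T.Ext c) : T.Pres (commChar T c v) := by
  refine ⟨fun a I => ?_, fun k α => ?_⟩
  · rw [evo_commChar]
    exact sub_mem (hc.var_mem_bweak (hv.external a I)) (hv.mem_bweak
      (hc.var_mem_bweak (totI_mem_constrIdeal _ _ _ _)))
  · rw [evo_commChar]
    exact sub_mem (hc.var_mem_bweak (hv.internal k α)) (hv.evo_dt_iterate_var_mem hc k α)

end Pres

end LocTheory

namespace LocTheory

variable {ι : Type*} {T : LocTheory n N m ι} {c c₁ c₂ c₃ : Loc n N m × (Fin m → Loc n N m)}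

/-! ### Closure under the modified bracket -/

theorem Ext.source_br (h₁ : T.Ext c₁) (h₂ : T.Ext c₂) {v : Fld N m → Loc n N m} (hv : T.Pres v)
    (α : ι) : T.var (T.br c₁ c₂) (evo 0 v (T.χ α)) - evo 0 v (T.var (T.br c₁ c₂) (T.χ α)) ∈
      T.bweak := by
  have y : ∀ f, evo 0 (T.ychar c₁ c₂) f ∈ T.bweak := fun f =>
    T.weak_le_bweak (T.evo_char_mem_weak (h₁.ychar_mem h₂) f)
  have e₁ := h₁.source _ (hv.comm_var h₂) α
  have e₂ := h₂.source _ (hv.comm_var h₁) α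
  simp only [Pres.evo_commChar] at e₁ e₂
  have := add_mem (sub_mem e₁ e₂) (sub_mem (y (evo 0 v (T.χ α))) (hv.mem_bweak (y (T.χ α))))
  convert this using 1
  simp only [var_br, map_sub, map_add]
  ring

/-- The commutator of a variation with `δ̃₁` is again a variation that preserves the internal
boundary conditions, so that the variation of `G₂` determines the one of `δ̃₁ G₂`. -/
theorem Ext.variation_var (h₁ : T.Ext c₁) (h₂ : T.Ext c₂) {v : Fld N m → Loc n N m}
    (hv : T.Pres v) :
    evo 0 v (T.var c₁ c₂.1) -
      (Finsupp.linearCombination (Loc n N m) v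
          ((el c₂.1).mapRange (T.var c₁) (map_zero _) + T.lamAdj c₁ c₂) +
        dot (zel c₂.1) (fun A => evo 0 v (T.ham c₁.1 A))) ∈ T.null := by
  have t₁ := h₂.variation _ (hv.comm_var h₁)
  have t₂ := h₁.var_mem_null (h₂.variation v hv)
  rw [Pres.evo_commChar] at t₁
  have t₃ : Finsupp.linearCombination (Loc n N m) (fun u => evo 0 v (T.tch (T.gen c₁) u))
      (lamPart (el c₂.1)) - Finsupp.linearCombination (Loc n N m) v (T.lamAdj c₁ c₂) ∈ T.null := by
    rw [lamAdj, Finsupp.linearCombination_apply, Finsupp.sum, Finsupp.sum, map_sum,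
      ← Finset.sum_sub_distrib]
    refine Submodule.sum_mem _ fun u _ => T.mul_evo_sub_mem_null v ?_ _
    cases u with
    | z A => simp
    | lam a l => rw [lamPart_lam]; exact h₂.el_lam_mem a l
  have s : Finsupp.linearCombination (Loc n N m) (Pres.commChar T c₁ v) (el c₂.1) =
      Finsupp.linearCombination (Loc n N m) (fun u => T.var c₁ (v u)) (el c₂.1) -
      (dot (zel c₂.1) (fun A => evo 0 v (T.ham c₁.1 A)) + Finsupp.linearCombination (Loc n N m)
        (fun u => evo 0 v (T.tch (T.gen c₁) u)) (lamPart (el c₂.1))) := by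
    rw [show Pres.commChar T c₁ v = fun u => T.var c₁ (v u) - evo 0 v (T.tch (T.gen c₁) u) from rfl,
      linearCombination_sub_left,
      linearCombination_split (fun u => evo 0 v (T.tch (T.gen c₁) u))]
    rfl
  rw [s] at t₁
  rw [map_sub, derivation_linearCombination] at t₂
  convert add_mem (sub_mem t₂ t₁) t₃ using 1
  rw [map_add]
  ring

theorem Ext.variation_br (h₁ : T.Ext c₁) (h₂ : T.Ext c₂) : T.HasVar (T.br c₁ c₂).1 := by
  intro v hv
  have t₁ := h₁.variation_var h₂ hv
  have t₂ := h₂.variation_var h₁ hv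
  convert sub_mem t₁ t₂ using 1
  have e₁ : dot (zel c₂.1) (fun A => evo 0 v (T.ham c₁.1 A)) =
      T.pois (zel c₂.1) (fun A => evo 0 v (zel c₁.1 A)) := by
    simp only [ham, derivation_sig, pois]
  have e₂ : dot (zel c₁.1) (fun A => evo 0 v (T.ham c₂.1 A)) =
      - T.pois (fun A => evo 0 v (zel c₂.1 A)) (zel c₁.1) := by
    rw [← pois_skew]
    simp only [ham, derivation_sig, pois]
  rw [el_br, e₁, e₂, br, map_sub, map_sub, derivation_pois]
  simp only [map_add, map_sub]
  ring

/-- The change of the action under a bracket. -/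
theorem Ext.defect_br (h₁ : T.Ext c₁) (h₂ : T.Ext c₂) :
    T.defect (T.br c₁ c₂) - (T.var c₁ (T.defect c₂) - T.var c₂ (T.defect c₁)) ∈ T.null := by
  -- contributions of the commutators, integrated by parts
  have r : ∀ {c c' : Loc n N m × (Fin m → Loc n N m)}, T.Ext c → T.dt (T.var c c'.1) -
      T.var c (T.dt c'.1) -
      T.pois (zel c'.1) (fun A => T.dt (zel c.1 A) - T.var c (zel T.H A)) ∈ T.null := by
    intro c c' hc
    have := T.evo_sub_mem_null hc.rchar_mem c'.1
    rw [dt_var_sub]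
    convert this using 2
    rw [linearCombination_split]
    have : Finsupp.linearCombination (Loc n N m) (T.rchar c) (lamPart (el c'.1)) = 0 := by
      rw [Finsupp.linearCombination_apply]
      refine Finset.sum_eq_zero fun u _ => ?_
      cases u <;> simp [rchar]
    rw [this, add_zero]
    rfl
  have y : evo 0 (T.ychar c₁ c₂) T.H - T.pois (zel T.H)
      (fun A => T.lamAdj c₁ c₂ (.z A) - T.lamAdj c₂ c₁ (.z A)) ∈ T.null := by
    have := T.evo_sub_mem_null (h₁.ychar_mem h₂) T.H
    convert this using 2
    rw [linearCombination_split]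
    have : Finsupp.linearCombination (Loc n N m) (T.ychar c₁ c₂) (lamPart (el T.H)) = 0 := by
      rw [Finsupp.linearCombination_apply]
      refine Finset.sum_eq_zero fun u _ => ?_
      cases u with
      | z A => simp
      | lam a l =>
        rw [lamPart_lam, T.el_H_lam]
        by_cases hl : l = 0
        · subst hl; simp [ychar, tch, gen, br]
        · simp [hl]
    rw [this, add_zero, pois]
    congr 1
    funext A
    exact (ychar_z T c₁ c₂ A).symm
  convert sub_mem (sub_mem (r (c' := c₂) h₁) (r (c' := c₁) h₂)) y using 1
  have z : zel (T.br c₁ c₂).1 = fun A => (T.var c₁ (zel c₂.1 A) - T.var c₂ (zel c₁.1 A)) +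
      (T.lamAdj c₁ c₂ (.z A) - T.lamAdj c₂ c₁ (.z A)) := funext fun A => zel_br T c₁ c₂ A
  have q : ∀ a b b' : Fin N → Loc n N m, T.pois a (fun A => b A - b' A) =
      T.pois a b - T.pois a b' := by
    intro a b b'
    rw [pois_skew, pois_sub_left, pois_skew T b, pois_skew T b']; ring
  rw [defect, defect, defect, z, var_br, pois_add_left, pois_sub_left]
  simp only [br, map_sub, derivation_pois, q, pois_sub_left]
  rw [pois_skew T (fun A => T.dt (zel c₂.1 A)) (zel c₁.1),
    pois_skew T (zel T.H) fun A => T.lamAdj c₁ c₂ (.z A),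
    pois_skew T (zel T.H) fun A => T.lamAdj c₂ c₁ (.z A)]
  ring

/-- External symmetries are closed under the modified bracket. -/
theorem Ext.br (h₁ : T.Ext c₁) (h₂ : T.Ext c₂) : T.Ext (T.br c₁ c₂) where
  source _ hv α := h₁.source_br h₂ hv α
  variation := h₁.variation_br h₂
  action := by
    obtain ⟨V₁, hs₁, hV₁⟩ := h₁.action
    obtain ⟨V₂, hs₂, hV₂⟩ := h₂.action
    have e : ∑ i, tot i (T.var c₁ (V₂ i) - T.var c₂ (V₁ i)) =
        T.var c₁ (∑ i, tot i (V₂ i)) - T.var c₂ (∑ i, tot i (V₁ i)) := by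
      simp only [map_sub, map_sum, Finset.sum_sub_distrib, var, evo_tot]
    refine ⟨fun i => T.var c₁ (V₂ i) - T.var c₂ (V₁ i), fun v hv => ?_, ?_⟩
    · have key : ∀ {c : Loc n N m × (Fin m → Loc n N m)} {f : Loc n N m}, T.Ext c →
          (∀ v, T.Pres v → evo 0 v f ∈ T.null) → evo 0 v (T.var c f) ∈ T.null := by
        intro c f hc hf
        have t₁ := hc.var_mem_null (hf v hv)
        have t₂ := hf _ (hv.comm_var hc)
        rw [Pres.evo_commChar] at t₂
        simpa using sub_mem t₁ t₂
      rw [e, map_sub]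
      exact sub_mem (key h₁ hs₂) (key h₂ hs₁)
    · rw [e]
      have := add_mem (h₁.defect_br h₂)
        (sub_mem (h₁.var_mem_null hV₂) (h₂.var_mem_null hV₁))
      convert this using 1
      simp only [map_sub]
      ring

/-! ### The Jacobi identity up to proper gauge transformations -/

/-- Weakly vanishing functionals. -/
def WZero (T : LocTheory n N m ι) (g : Loc n N m) : Prop := ∃ e ∈ T.weak, g - e ∈ T.null

/-- Couples that generate proper gauge transformations. -/
structure Proper (T : LocTheory n N m ι) (c : Loc n N m × (Fin m → Loc n N m)) : Prop where
  ext : T.Ext c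
  internal : ∀ α, T.var c (T.χ α) ∈ T.bweak
  wzero : T.WZero c.1

/-- The cyclic sum of iterated modified brackets. -/
def jac (T : LocTheory n N m ι) (c₁ c₂ c₃ : Loc n N m × (Fin m → Loc n N m)) :
    Loc n N m × (Fin m → Loc n N m) :=
  T.br (T.br c₁ c₂) c₃ + T.br (T.br c₂ c₃) c₁ + T.br (T.br c₃ c₁) c₂

theorem br_br_fst (T : LocTheory n N m ι) (c₁ c₂ c₃ : Loc n N m × (Fin m → Loc n N m)) :
    (T.br (T.br c₁ c₂) c₃).1 =
      T.var c₁ (T.var c₂ c₃.1) - T.var c₂ (T.var c₁ c₃.1) -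
      T.var c₃ (T.var c₁ c₂.1) + T.var c₃ (T.var c₂ c₁.1) +
      T.pois (fun A => T.var c₃ (zel c₂.1 A)) (zel c₁.1) -
      T.pois (fun A => T.var c₃ (zel c₁.1 A)) (zel c₂.1) +
      T.pois (fun A => T.var c₁ (zel c₂.1 A)) (zel c₃.1) -
      T.pois (fun A => T.var c₂ (zel c₁.1 A)) (zel c₃.1) +
      (evo 0 (T.ychar c₁ c₂) c₃.1 - dot (zel c₃.1) fun A => T.ychar c₁ c₂ (.z A)) := by
  have z : zel (T.br c₁ c₂).1 = fun A => (T.var c₁ (zel c₂.1 A) - T.var c₂ (zel c₁.1 A)) +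
      (T.lamAdj c₁ c₂ (.z A) - T.lamAdj c₂ c₁ (.z A)) := funext fun A => zel_br T c₁ c₂ A
  have y : dot (zel c₃.1) (fun A => T.ychar c₁ c₂ (.z A)) =
      T.pois (zel c₃.1) (fun A => T.lamAdj c₁ c₂ (.z A) - T.lamAdj c₂ c₁ (.z A)) := by
    simp only [ychar_z, pois]
  rw [y, LocTheory.br]
  dsimp only
  rw [z, var_br, pois_skew T (zel c₃.1) (fun A => (T.var c₁ (zel c₂.1 A) - T.var c₂ (zel c₁.1 A)) +
      (T.lamAdj c₁ c₂ (.z A) - T.lamAdj c₂ c₁ (.z A))), pois_add_left, pois_sub_left,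
    pois_skew T (zel c₃.1) (fun A => T.lamAdj c₁ c₂ (.z A) - T.lamAdj c₂ c₁ (.z A)), LocTheory.br]
  simp only [map_sub, derivation_pois]
  rw [pois_skew T (zel c₂.1) fun A => T.var c₃ (zel c₁.1 A)]
  ring

/-- The generator of the cyclic sum of iterated brackets consists of terms that are linear in the
weakly vanishing differences between brackets and commutators. -/
theorem jac_fst (T : LocTheory n N m ι) (c₁ c₂ c₃ : Loc n N m × (Fin m → Loc n N m)) :
    (T.jac c₁ c₂ c₃).1 =
      (evo 0 (T.ychar c₁ c₂) c₃.1 - dot (zel c₃.1) fun A => T.ychar c₁ c₂ (.z A)) +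
      (evo 0 (T.ychar c₂ c₃) c₁.1 - dot (zel c₁.1) fun A => T.ychar c₂ c₃ (.z A)) +
      (evo 0 (T.ychar c₃ c₁) c₂.1 - dot (zel c₂.1) fun A => T.ychar c₃ c₁ (.z A)) := by
  rw [jac, Prod.fst_add, Prod.fst_add, br_br_fst, br_br_fst, br_br_fst]
  ring

theorem var_add (T : LocTheory n N m ι) (c c' : Loc n N m × (Fin m → Loc n N m))
    (f : Loc n N m) : T.var (c + c') f = T.var c f + T.var c' f := by
  simp only [var]
  rw [← evo_add, add_zero]
  congr 2
  funext u
  cases u with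
  | z A => simp [tch, gen, ham, sig, zel, el_add, Finset.sum_add_distrib]
  | lam a l => simp [tch, gen]

theorem var_smul (T : LocTheory n N m ι) (r : ℝ) (c : Loc n N m × (Fin m → Loc n N m))
    (f : Loc n N m) : T.var (r • c) f = r • T.var c f := by
  simp only [var]
  rw [← evo_smul, mul_zero]
  congr 2
  funext u
  cases u with
  | z A => simp [tch, gen, ham, sig, zel, el_smul, Finset.smul_sum, smul_comm r]
  | lam a l => simp [tch, gen, dt_iterate_smul]

theorem defect_add (T : LocTheory n N m ι) (c c' : Loc n N m × (Fin m → Loc n N m)) :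
    T.defect (c + c') = T.defect c + T.defect c' := by
  have : zel (c + c').1 = fun A => zel c.1 A + zel c'.1 A := by
    funext A; simp [zel, el_add]
  rw [defect, this, pois_add_left, var_add, Prod.fst_add, map_add, defect, defect]
  ring

theorem pois_smul_left (T : LocTheory n N m ι) (r : ℝ) (a b : Fin N → Loc n N m) :
    T.pois (fun A => r • a A) b = r • T.pois a b := by
  simp [pois, dot, Finset.smul_sum]

theorem defect_smul (T : LocTheory n N m ι) (r : ℝ) (c : Loc n N m × (Fin m → Loc n N m)) :
    T.defect (r • c) = r • T.defect c := by
  have : zel (r • c).1 = fun A => r • zel c.1 A := by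
    funext A; simp [zel, el_smul]
  rw [defect, this, pois_smul_left, var_smul, Prod.smul_fst, Derivation.map_smul, defect, smul_sub,
    smul_sub]

theorem Ext.add (h₁ : T.Ext c₁) (h₂ : T.Ext c₂) : T.Ext (c₁ + c₂) where
  source v hv α := by
    convert add_mem (h₁.source v hv α) (h₂.source v hv α) using 1
    simp only [var_add, map_add]; ring
  variation v hv := by
    convert add_mem (h₁.variation v hv) (h₂.variation v hv) using 1
    simp only [Prod.fst_add, el_add, map_add]; ring
  action := by
    obtain ⟨V, hs, hV⟩ := h₁.action
    obtain ⟨V', hs', hV'⟩ := h₂.action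
    refine ⟨fun i => V i + V' i, fun v hv => ?_, ?_⟩
    · simpa only [map_add, Finset.sum_add_distrib] using add_mem (hs v hv) (hs' v hv)
    · convert add_mem hV hV' using 1
      simp only [defect_add, map_add, Finset.sum_add_distrib]; ring

theorem Ext.smul (r : ℝ) (h : T.Ext c) : T.Ext (r • c) where
  source v hv α := by
    convert Submodule.smul_of_tower_mem _ r (h.source v hv α) using 1
    simp only [var_smul, Derivation.map_smul, smul_sub]
  variation v hv := by
    convert Submodule.smul_mem _ r (h.variation v hv) using 1
    simp only [Prod.smul_fst, el_smul, Derivation.map_smul, LinearMap.map_smul_of_tower, smul_sub]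
  action := by
    obtain ⟨V, hs, hV⟩ := h.action
    refine ⟨fun i => r • V i, fun v hv => ?_, ?_⟩
    · simpa only [Derivation.map_smul, ← Finset.smul_sum] using Submodule.smul_mem _ r (hs v hv)
    · convert Submodule.smul_mem _ r hV using 1
      simp only [defect_smul, Derivation.map_smul, ← Finset.smul_sum, smul_sub]

theorem Ext.zero (T : LocTheory n N m ι) : T.Ext 0 where
  source v _ α := by
    have h : ∀ f, T.var 0 f = 0 := fun f => by simpa using var_smul T 0 0 f
    simp [h]
  variation v _ := by simp
  action := by
    have h : T.defect 0 = 0 := by simpa using T.defect_smul 0 0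
    exact ⟨0, by simp, by simp [h]⟩

theorem Proper.add (h₁ : T.Proper c₁) (h₂ : T.Proper c₂) : T.Proper (c₁ + c₂) where
  ext := h₁.ext.add h₂.ext
  internal α := by rw [var_add]; exact add_mem (h₁.internal α) (h₂.internal α)
  wzero := by
    obtain ⟨e, he, h⟩ := h₁.wzero
    obtain ⟨e', he', h'⟩ := h₂.wzero
    refine ⟨e + e', add_mem he he', ?_⟩
    convert add_mem h h' using 1
    rw [Prod.fst_add]; ring

theorem Proper.smul (r : ℝ) (h : T.Proper c) : T.Proper (r • c) where
  ext := h.ext.smul r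
  internal α := by rw [var_smul]; exact Submodule.smul_of_tower_mem _ r (h.internal α)
  wzero := by
    obtain ⟨e, he, h⟩ := h.wzero
    refine ⟨r • e, Submodule.smul_of_tower_mem _ r he, ?_⟩
    convert Submodule.smul_mem _ r h using 1
    rw [Prod.smul_fst, smul_sub]

theorem Proper.zero (T : LocTheory n N m ι) : T.Proper 0 where
  ext := Ext.zero T
  internal α := by
    have h : ∀ f, T.var 0 f = 0 := fun f => by simpa using var_smul T 0 0 f
    simp [h]
  wzero := ⟨0, by simp, by simp⟩

/-- The Jacobi identity of the modified bracket holds up to proper gauge transformations. -/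
theorem Ext.jac (h₁ : T.Ext c₁) (h₂ : T.Ext c₂) (h₃ : T.Ext c₃) : T.Proper (T.jac c₁ c₂ c₃) where
  ext := (((h₁.br h₂).br h₃).add ((h₂.br h₃).br h₁)).add ((h₃.br h₁).br h₂)
  internal α := by
    have key : ∀ {c₁ c₂ c₃ : Loc n N m × (Fin m → Loc n N m)}, T.Ext c₁ → T.Ext c₂ → T.Ext c₃ →
        T.var (T.br (T.br c₁ c₂) c₃) (T.χ α) -
          (T.var c₁ (T.var c₂ (T.var c₃ (T.χ α))) - T.var c₂ (T.var c₁ (T.var c₃ (T.χ α))) -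
          T.var c₃ (T.var c₁ (T.var c₂ (T.χ α))) + T.var c₃ (T.var c₂ (T.var c₁ (T.χ α)))) ∈
            T.weak := by
      intro c₁ c₂ c₃ h₁ h₂ h₃
      have y := T.evo_char_mem_weak (h₁.ychar_mem h₂)
      have y' := T.evo_char_mem_weak ((h₁.br h₂).ychar_mem h₃) (T.χ α)
      have := add_mem (sub_mem (y (T.var c₃ (T.χ α))) (h₃.var_mem_weak (y (T.χ α)))) y'
      convert this using 1
      simp only [var_br, map_add, map_sub]
      ring
    have := add_mem (add_mem (key h₁ h₂ h₃) (key h₂ h₃ h₁)) (key h₃ h₁ h₂)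
    refine T.weak_le_bweak ?_
    convert this using 1
    simp only [LocTheory.jac, var_add]
    ring
  wzero := by
    have key : ∀ {c₁ c₂ c₃ : Loc n N m × (Fin m → Loc n N m)}, T.Ext c₁ → T.Ext c₂ →
        (evo 0 (T.ychar c₁ c₂) c₃.1 - dot (zel c₃.1) fun A => T.ychar c₁ c₂ (.z A)) ∈ T.weak := by
      intro c₁ c₂ c₃ h₁ h₂
      exact sub_mem (T.evo_char_mem_weak (h₁.ychar_mem h₂) _)
        (Submodule.sum_mem _ fun A _ => Ideal.mul_mem_left _ _ (h₁.ychar_mem h₂ _))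
    refine ⟨_, ?_, by rw [sub_self]; exact zero_mem _⟩
    rw [jac_fst]
    exact add_mem (add_mem (key h₁ h₂) (key h₂ h₃)) (key h₃ h₁)

/-! ### Proper gauge transformations form an ideal -/

/-- Proper gauge transformations preserve the internal boundary conditions at all times, so that
they may serve as variations in the conditions on external symmetries. -/
theorem Proper.pres (h : T.Proper c) : T.Pres (T.tch (T.gen c)) where
  external _ _ := h.ext.var_mem_bweak (totI_mem_constrIdeal _ _ _ _)
  internal k α := by
    have h1 : T.dt^[k] (T.var c (T.χ α)) ∈ T.bweak := by
      induction k with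
      | zero => exact h.internal α
      | succ k ih => rw [Function.iterate_succ_apply']; exact T.dt_mem_bweak ih
    have h2 := T.weak_le_bweak (h.ext.dt_iterate_var_sub_mem k (T.χ α))
    have h3 := sub_mem h1 h2
    rw [sub_sub_cancel] at h3
    exact h3

/-- The conditions on an external symmetry that refer to boundary variations, applied to the
variation of a proper gauge transformation, show that their bracket is proper. -/
theorem Ext.br_prop (hc : T.Ext c₁) (h : T.Proper c₂) : T.Proper (T.br c₁ c₂) where
  ext := hc.br h.ext
  internal α := by
    rw [var_br]
    -- the proper gauge transformation is an admissible variation for the first condition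
    have h1 := hc.source _ h.pres α
    exact add_mem h1 (T.weak_le_bweak (T.evo_char_mem_weak (hc.ychar_mem h.ext) _))
  wzero := by
    obtain ⟨e, he, hn⟩ := h.wzero
    -- the variation of `G₁` has no boundary term, so that `δ̃₂ G₁` cancels the Poisson bracket
    have h1 := hc.variation _ h.pres
    rw [linearCombination_split] at h1
    have h2 : Finsupp.linearCombination (Loc n N m) (T.tch (T.gen c₂)) (lamPart (el c₁.1)) ∈
        T.weak := by
      rw [Finsupp.linearCombination_apply]
      refine Submodule.sum_mem _ fun u _ => Ideal.mul_mem_right _ _ ?_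
      cases u with
      | z A => simp
      | lam a l => rw [lamPart_lam]; exact hc.el_lam_mem a l
    refine ⟨T.var c₁ e - Finsupp.linearCombination (Loc n N m) (T.tch (T.gen c₂))
      (lamPart (el c₁.1)), sub_mem (hc.var_mem_weak he) h2, ?_⟩
    convert sub_mem (hc.var_mem_null hn) h1 using 1
    have e1 : dot (fun A => el c₁.1 (.z A)) (fun A => T.tch (T.gen c₂) (.z A)) =
        T.pois (zel c₁.1) (zel c₂.1) := rfl
    rw [e1, LocTheory.br]
    dsimp only
    rw [pois_skew T (zel c₂.1), map_sub]
    simp only [var]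
    ring

theorem br_swap (T : LocTheory n N m ι) (c₁ c₂ : Loc n N m × (Fin m → Loc n N m)) :
    T.br c₁ c₂ = - T.br c₂ c₁ := by
  refine Prod.ext ?_ (funext fun a => ?_)
  · simp only [LocTheory.br, Prod.fst_neg]
    rw [pois_skew]; ring
  · simp [LocTheory.br]

theorem br_add_left (T : LocTheory n N m ι) (c c' d : Loc n N m × (Fin m → Loc n N m)) :
    T.br (c + c') d = T.br c d + T.br c' d := by
  have hz : zel (c + c').1 = fun A => zel c.1 A + zel c'.1 A := by
    funext A; simp [zel, el_add]
  refine Prod.ext ?_ (funext fun a => ?_)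
  · simp only [LocTheory.br, Prod.fst_add]
    rw [← Prod.fst_add, hz, pois_skew, pois_add_left, var_add, Prod.fst_add, map_add,
      pois_skew T (zel d.1), pois_skew T (zel d.1)]
    ring
  · simp only [LocTheory.br, Prod.snd_add, Pi.add_apply, var_add, map_add]
    ring

theorem br_smul_left (T : LocTheory n N m ι) (r : ℝ) (c d : Loc n N m × (Fin m → Loc n N m)) :
    T.br (r • c) d = r • T.br c d := by
  have hz : zel (r • c).1 = fun A => r • zel c.1 A := by
    funext A; simp [zel, el_smul]
  refine Prod.ext ?_ (funext fun a => ?_)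
  · simp only [LocTheory.br, Prod.smul_fst]
    rw [← Prod.smul_fst, hz, pois_skew, pois_smul_left, var_smul, Prod.smul_fst,
      Derivation.map_smul, pois_skew T (zel d.1), smul_sub, smul_sub, smul_neg]
  · simp only [LocTheory.br, Prod.smul_snd, Pi.smul_apply, var_smul, Derivation.map_smul, smul_sub]

end LocTheory

/-! ### From the given data to local functions -/

theorem eul_apply_eq_zero {θ : Form n N m} {u : Fld N m} (h : ∀ I, θ (.jet u I) = 0) :
    eul θ u = 0 :=
  Loc.ext fun p => by rw [eul_val]; simp [h]

theorem adj_eq_zero_of_dependsOn {f : Loc n N m} (hf : DependsOn f.val zCoords) (w : Loc n N m)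
    (a : Fin m) (l : ℕ) : adj f w (.lam a l) = 0 :=
  eul_apply_eq_zero fun I => by
    rw [Finsupp.smul_apply, grad_apply, pdl_eq_zero_of_dependsOn hf (by simp [zCoords]), smul_zero]

/-- The characteristic of a variation of the canonical fields alone. -/
def zchar (w : Fin N → Loc n N m) : Fld N m → Loc n N m
  | .z A => w A
  | .lam _ _ => 0

theorem evo_shift_add (w r : Fin N → Loc n N m) (f : Loc n N m) :
    evo 1 (shift fun A => w A + r A) f = evo 1 (shift w) f + evo 0 (zchar r) f := by
  rw [← evo_add, add_zero]
  congr 2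
  funext u
  cases u <;> simp [shift, zchar]

theorem evo_shift_of_dependsOn {f : Loc n N m} (hf : DependsOn f.val zCoords)
    (w : Fin N → Loc n N m) : evo 1 (shift w) f = evo 0 (zchar w) f := by
  have h0 : evo 1 (shift fun _ => (0 : Loc n N m)) f = (0 : Loc n N m) := by
    rw [evo, vf_apply, Finsupp.linearCombination_apply]
    refine Finset.sum_eq_zero fun c _ => ?_
    cases c with
    | t => rw [grad_apply, pdl_eq_zero_of_dependsOn hf (by simp [zCoords])]; exact zero_smul _ _
    | x i => simp [evoCoef]
    | jet u I =>
      cases u with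
      | z A => simp [evoCoef, shift]
      | lam a l =>
        rw [grad_apply, pdl_eq_zero_of_dependsOn hf (by simp [zCoords])]; exact zero_smul _ _
  have := evo_shift_add (fun _ => 0) w f
  simpa [h0] using this

theorem evo_zchar_add (w r : Fin N → Loc n N m) (f : Loc n N m) :
    evo 0 (zchar fun A => w A + r A) f = evo 0 (zchar w) f + evo 0 (zchar r) f := by
  rw [← evo_add, add_zero]
  congr 2
  funext u
  cases u <;> simp [zchar]

namespace GaugeData

variable {ι : Type*} {T : GaugeData n N m ι}

theorem ham_val_eq (T : GaugeData n N m ι) (g : Loc n N m) (A : Fin N) :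
    T.ham g.val A = (∑ B, T.σ A B • el g (.z B)).val := by
  simp [ham, euler_val]

namespace IsGaugeTheory

variable (hT : T.IsGaugeTheory)

/-- The constraints as local functions. -/
def locφ (a : Fin m) : Loc n N m := .mk (T.φ a) (hT.φ_local a)

/-- The density `λ^a φ_a` as a local function. -/
def locLamPhi : Loc n N m := ∑ a, crd (.jet (.lam a 0) 0) * hT.locφ a

/-- The density of the Hamiltonian as a local function. -/
def locH : Loc n N m :=
  .mk T.h hT.h_local + hT.locLamPhi + ∑ i, tot i (.mk (T.b i) (hT.b_local i))

theorem val_locLamPhi : hT.locLamPhi.val = T.lamPhi := by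
  funext p
  simp [locLamPhi, lamPhi, locφ]

theorem val_locH : hT.locH.val = T.H := by
  have := divg_val (fun i => Loc.mk (T.b i) (hT.b_local i))
  simp only [Loc.val_mk] at this
  rw [locH, H, map_add, map_add, val_locLamPhi, this]
  rfl

theorem el_locH : el hT.locH = el (.mk T.h hT.h_local) + el hT.locLamPhi := by
  have : el (∑ i, tot i (Loc.mk (T.b i) (hT.b_local i))) = 0 := by
    have : ∀ k : Fin n → Loc n N m, el (∑ i, tot i (k i)) = ∑ i, el (tot i (k i)) := fun k => by
      simp [el]
    rw [this]
    exact Finset.sum_eq_zero fun i _ => el_tot i _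
  rw [locH, el_add, el_add, this, add_zero]

theorem el_locH_lam (a : Fin m) (l : ℕ) :
    el hT.locH (.lam a l) = if l = 0 then hT.locφ a else 0 := by
  classical
  have h1 : el (.mk T.h hT.h_local) (.lam a l) = (0 : Loc n N m) := by
    have := adj_eq_zero_of_dependsOn (f := Loc.mk T.h hT.h_local) hT.h_dep 1 a l
    simpa [adj, el] using this
  have h2 : el hT.locLamPhi = ∑ b, (Finsupp.single (.lam b 0) (hT.locφ b) +
      adj (hT.locφ b) (crd (.jet (.lam b 0) 0))) := by
    have : ∀ k : Fin m → Loc n N m, el (∑ i, k i) = ∑ i, el (k i) := fun k => by simp [el]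
    rw [locLamPhi, this]
    exact Finset.sum_congr rfl fun b _ => by rw [el_mul, adj_crd]
  rw [el_locH, Finsupp.add_apply, h1, zero_add, h2, Finsupp.finsetSum_apply]
  have h3 : ∀ b, adj (hT.locφ b) (crd (.jet (.lam b 0) 0)) (.lam a l) = 0 := fun b =>
    adj_eq_zero_of_dependsOn (f := hT.locφ b) (hT.φ_dep b) _ a l
  simp only [Finsupp.add_apply, h3, add_zero, Finsupp.single_apply, Fld.lam.injEq]
  by_cases hl : l = 0
  · subst hl; simp
  · simp [hl, Ne.symm hl]

/-- A gauge theory in terms of local functions. -/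
def toLoc : LocTheory n N m ι where
  ρ := T.ρ
  σ := T.σ
  φ := hT.locφ
  H := hT.locH
  χ α := .mk (T.χ α) (hT.χ_local α)
  ρ_smooth := hT.ρ_smooth
  ρ_regular := hT.ρ_regular
  σ_skew A B := by
    have := congrFun (congrFun hT.σ_skew B) A
    simpa using this
  el_H_lam := hT.el_locH_lam
  adj_φ_lam a b l w := adj_eq_zero_of_dependsOn (f := hT.locφ a) (hT.φ_dep a) w b l
  φ_first a := by
    have zv : ∀ g : Loc n N m, (fun u => ((zchar (fun A => ∑ B, T.σ A B • el g (.z B)) u).val)) =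
        zVar (T.ham g.val) := by
      intro g; funext u
      cases u with
      | z A => exact (ham_val_eq T g A).symm
      | lam a l => exact map_zero _
    have key : ∀ g : Loc n N m, T.Weak (evol (zVar (T.ham g.val)) (T.φ a)) →
        evo 0 (zchar (fun A => ∑ B, T.σ A B • el g (.z B))) (hT.locφ a) ∈
          constrIdeal hT.locφ T.region := by
      intro g hg
      rw [← inIdeal_iff T hT.locφ (fun _ => rfl), ← evol_val, zv]
      exact hg
    have h1 := key (.mk T.h hT.h_local) (hT.h_firstClass a)
    have h2 := key hT.locLamPhi (by rw [val_locLamPhi]; exact hT.φ_firstClass a)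
    rw [evo_shift_of_dependsOn (f := hT.locφ a) (hT.φ_dep a)]
    have := add_mem h1 h2
    rw [← evo_zchar_add] at this
    have e : (fun A => ∑ B, T.σ A B • el hT.locH (.z B)) = fun A =>
        ∑ B, T.σ A B • el (.mk T.h hT.h_local) (.z B) +
          ∑ B, T.σ A B • el hT.locLamPhi (.z B) := by
      funext A
      rw [el_locH]
      simp [Finset.sum_add_distrib]
    rw [e]
    exact this

theorem ham_val (g : Loc n N m) (A : Fin N) : T.ham g.val A = (hT.toLoc.ham g A).val :=
  ham_val_eq T g A

theorem deltaT_val (f : Loc n N m) : T.deltaT f.val = (hT.toLoc.dt f).val := by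
  have : T.ham T.H = fun A => (hT.toLoc.ham hT.toLoc.H A).val := by
    funext A
    rw [← ham_val, ← val_locH hT]; rfl
  rw [deltaT, this, timeD_val]; rfl

theorem deltaT_iterate_val (k : ℕ) (f : Loc n N m) :
    T.deltaT^[k] f.val = (hT.toLoc.dt^[k] f).val := by
  induction k generalizing f with
  | zero => rfl
  | succ k ih => rw [Function.iterate_succ_apply, deltaT_val hT, ih, ← Function.iterate_succ_apply]

end IsGaugeTheory

end GaugeData

/-- The couple of functions underlying a couple of local functions. -/
def coupleVal : (Loc n N m × (Fin m → Loc n N m)) →ₗ[ℝ] Couple n N m where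
  toFun c := (c.1.val, fun a => (c.2 a).val)
  map_add' c d := by ext <;> simp
  map_smul' r c := by ext <;> simp

/-- The transformation of functions underlying a transformation of local functions. -/
def transfVal : ((Fin N → Loc n N m) × (Fin m → Loc n N m)) →ₗ[ℝ] Transf n N m where
  toFun τ := (fun A => (τ.1 A).val, fun a => (τ.2 a).val)
  map_add' c d := by ext <;> simp
  map_smul' r c := by ext <;> simp

theorem exists_coupleVal {c : Couple n N m} (h : IsLocal c.1) (h' : ∀ a, IsLocal (c.2 a)) :
    ∃ d, coupleVal d = c := ⟨(.mk c.1 h, fun a => .mk (c.2 a) (h' a)), rfl⟩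

namespace GaugeData.IsGaugeTheory

variable {ι : Type*} {T : GaugeData n N m ι} (hT : T.IsGaugeTheory)

theorem tilde_val (τ : (Fin N → Loc n N m) × (Fin m → Loc n N m)) (f : Loc n N m) :
    T.tilde (transfVal τ) f.val = (evo 0 (hT.toLoc.tch τ) f).val := by
  have : T.tchar (transfVal τ) = fun u => (hT.toLoc.tch τ u).val := by
    funext u
    cases u with
    | z A => rfl
    | lam a l => exact hT.deltaT_iterate_val l _
  rw [tilde, this, evol_val]

theorem transf_val (c : Loc n N m × (Fin m → Loc n N m)) :
    T.transf (coupleVal c) = transfVal (hT.toLoc.gen c) :=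
  Prod.ext (funext fun A => hT.ham_val c.1 A) rfl

theorem var_val (c : Loc n N m × (Fin m → Loc n N m)) (f : Loc n N m) :
    T.tilde (T.transf (coupleVal c)) f.val = (hT.toLoc.var c f).val := by
  rw [hT.transf_val, hT.tilde_val]; rfl

theorem poisson_val (f g : Loc n N m) :
    T.poisson f.val g.val = (hT.toLoc.pois (zel f) (zel g)).val := by
  simp only [poisson, euler_val, hT.ham_val, LocTheory.pois, dot, map_sum, map_mul]
  rfl

theorem bZero_iff (f : Loc n N m) : T.BZero f.val ↔ f ∈ hT.toLoc.bweak :=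
  inIdeal_iff T hT.locφ (fun _ => rfl) _ f

theorem weak_iff (f : Loc n N m) : T.Weak f.val ↔ f ∈ hT.toLoc.weak :=
  inIdeal_iff T hT.locφ (fun _ => rfl) _ f

theorem eqOnRegion_iff (f g : Loc n N m) :
    T.EqOnRegion f.val g.val ↔ f - g ∈ vanish hT.toLoc.reg :=
  forall₂_congr fun p _ => by rw [map_sub, Pi.sub_apply, sub_eq_zero]

theorem isNull_iff (f : Loc n N m) : T.IsNull f.val ↔ f ∈ hT.toLoc.null := by
  have h : ∀ k : Fin n → Loc n N m,
      (fun p => ∑ i, fderiv ℝ T.ρ (base p) (Pi.single i 1) * (k i).val p) =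
      (∑ i, hT.toLoc.conormal i * k i).val := by
    intro k; funext p
    simp [LocTheory.conormal, toLoc]
  constructor
  · rintro ⟨k, hk, h1, h2⟩
    refine ⟨fun i => .mk (k i) (hk i), ?_, ?_⟩
    · rw [← hT.eqOnRegion_iff, ← divg_val]; exact h1
    · rw [← hT.bZero_iff, ← h]; exact h2
  · rintro ⟨k, h1, h2⟩
    refine ⟨fun i => (k i).val, fun i => (k i).isLocal, ?_, ?_⟩
    · rw [divg_val, hT.eqOnRegion_iff]; exact h1
    · rw [h, hT.bZero_iff]; exact h2

theorem preservesInternal_iff (v : Fld N m → Loc n N m) :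
    T.PreservesInternal (fun u => (v u).val) ↔ hT.toLoc.Pres v := by
  have h1 : ∀ a I, (T.BZero (evol (fun u => (v u).val) (totalDI I (T.φ a))) ↔
      evo 0 v (totI I (hT.toLoc.φ a)) ∈ hT.toLoc.bweak) := fun a I => by
    rw [show T.φ a = (hT.toLoc.φ a).val from rfl, totalDI_val, evol_val, hT.bZero_iff]
  have h2 : ∀ k α, (T.BZero (evol (fun u => (v u).val) (T.deltaT^[k] (T.χ α))) ↔
      evo 0 v (hT.toLoc.dt^[k] (hT.toLoc.χ α)) ∈ hT.toLoc.bweak) := fun k α => by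
    rw [show T.χ α = (hT.toLoc.χ α).val from rfl, hT.deltaT_iterate_val, evol_val, hT.bZero_iff]
  exact ⟨fun h => ⟨fun a I => (h1 a I).1 (h.external a I), fun k α => (h2 k α).1 (h.internal k α)⟩,
    fun h => ⟨fun u => (v u).isLocal, fun a I => (h1 a I).2 (h.external a I),
      fun k α => (h2 k α).2 (h.internal k α)⟩⟩

theorem forall_preservesInternal {p : (Fld N m → JFun n N m) → Prop} :
    (∀ v, T.PreservesInternal v → p v) ↔
      ∀ v : Fld N m → Loc n N m, hT.toLoc.Pres v → p fun u => (v u).val :=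
  ⟨fun h v hv => h _ ((hT.preservesInternal_iff v).2 hv), fun h v hv =>
    h (fun u => .mk (v u) (hv.isLocal u)) ((hT.preservesInternal_iff _).1 hv)⟩

theorem finsum_euler_val (g : Loc n N m) (v : Fld N m → Loc n N m) :
    (fun p => ∑ᶠ u : Fld N m, euler u g.val p * (v u).val p) =
      (Finsupp.linearCombination (Loc n N m) v (el g)).val := by
  funext p
  rw [finsum_eq_sum_of_support_subset (s := (el g).support)]
  · simp [Finsupp.linearCombination_apply, Finsupp.sum, euler_val]
  · intro u hu
    simp only [Function.mem_support, euler_val] at hu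
    rw [Finset.mem_coe, Finsupp.mem_support_iff]
    intro h
    simp [h] at hu

theorem hasVariation_iff (g : Loc n N m) : T.HasVariation g.val ↔ hT.toLoc.HasVar g := by
  rw [HasVariation, hT.forall_preservesInternal]
  refine forall₂_congr fun v _ => ?_
  rw [finsum_euler_val, evol_val, ← map_sub, hT.isNull_iff]

theorem sourceOnly_iff (g : Loc n N m) : T.SourceOnly g.val ↔
    ∀ v, hT.toLoc.Pres v → evo 0 v g ∈ hT.toLoc.null := by
  rw [SourceOnly, hT.forall_preservesInternal]
  refine forall₂_congr fun v _ => ?_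
  rw [evol_val, hT.isNull_iff]

theorem velocity_iff (w : Fin N → Loc n N m) : T.Velocity (fun A => (w A).val) ↔
    ∀ A, hT.toLoc.BFlat (w A - hT.toLoc.ham hT.toLoc.H A) := by
  have h : ∀ A I, (T.BZero (totalDI I ((w A).val - T.ham T.H A)) ↔
      totI I (w A - hT.toLoc.ham hT.toLoc.H A) ∈ hT.toLoc.bweak) := fun A I => by
    rw [← hT.val_locH, hT.ham_val, ← map_sub, totalDI_val, hT.bZero_iff]; rfl
  exact ⟨fun hw A I => (h A I).1 (hw.2 A I),
    fun hw => ⟨fun A => (w A).isLocal, fun A I => (h A I).2 (hw A I)⟩⟩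

/-- The symplectic form inverts the Poisson matrix. -/
theorem sum_inv_sig (g w : Fin N → Loc n N m) :
    ∑ A, ∑ B, ((1 / 2 : ℝ) * T.σ⁻¹ A B) • (hT.toLoc.sig g A * w B - w A * hT.toLoc.sig g B) =
      - dot g w := by
  have hinv : T.σ⁻¹ * T.σ = 1 := Matrix.nonsing_inv_mul _ hT.σ_unit
  have hskew : ∀ A B, T.σ⁻¹ A B = - T.σ⁻¹ B A := by
    intro A B
    have : T.σ⁻¹.transpose = - T.σ⁻¹ := by
      rw [Matrix.transpose_nonsing_inv, hT.σ_skew]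
      refine Matrix.inv_eq_left_inv ?_
      rw [neg_mul_neg, hinv]
    have := congrFun (congrFun this B) A
    simpa using this
  have key : ∀ A, ∑ B, T.σ⁻¹ A B • hT.toLoc.sig g B = g A := by
    intro A
    simp only [LocTheory.sig, Finset.smul_sum, smul_smul]
    rw [Finset.sum_comm]
    simp only [← Finset.sum_smul]
    have : ∀ C, ∑ B, T.σ⁻¹ A B * T.σ B C = if A = C then 1 else 0 := fun C => by
      rw [← Matrix.mul_apply, hinv, Matrix.one_apply]
    rw [Finset.sum_eq_single A]
    · rw [show (∑ B, T.σ⁻¹ A B * hT.toLoc.σ B A) = 1 from (this A).trans (if_pos rfl), one_smul]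
    · intro C _ hC
      rw [show (∑ B, T.σ⁻¹ A B * hT.toLoc.σ B C) = 0 from (this C).trans (if_neg (Ne.symm hC)),
        zero_smul]
    · simp
  have h1 : ∑ A, ∑ B, T.σ⁻¹ A B • (w A * hT.toLoc.sig g B) = dot g w := by
    refine Finset.sum_congr rfl fun A _ => ?_
    simp only [← mul_smul_comm, ← Finset.mul_sum, key]
    exact mul_comm _ _
  have h2 : ∑ A, ∑ B, T.σ⁻¹ A B • (hT.toLoc.sig g A * w B) = - dot g w := by
    rw [← h1, Finset.sum_comm, ← Finset.sum_neg_distrib]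
    refine Finset.sum_congr rfl fun A _ => ?_
    rw [← Finset.sum_neg_distrib]
    exact Finset.sum_congr rfl fun B _ => by rw [hskew B A, neg_smul, mul_comm]
  simp only [mul_smul, smul_sub, Finset.sum_sub_distrib, ← Finset.smul_sum, h1, h2]
  rw [← smul_sub, ← neg_add', smul_neg, ← two_smul ℝ, smul_smul]
  norm_num

/-- The invariance condition on the action, which refers to an arbitrary velocity, amounts to the
one for the Hamiltonian flow: both differ by terms that are proportional to the equations of
motion, and these can be integrated by parts. -/
theorem action_sub_defect (c : Loc n N m × (Fin m → Loc n N m)) (w : Fin N → Loc n N m)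
    (hw : ∀ A, hT.toLoc.BFlat (w A - hT.toLoc.ham hT.toLoc.H A)) : ∃ f : Loc n N m,
    f.val = T.lagrangianVar (fun A => (w A).val) (T.transf (coupleVal c)) -
      timeD (fun A => (w A).val) ((fun p => ∑ A, ∑ B, (1 / 2 : ℝ) * T.σ⁻¹ A B *
        (p (.jet (.z A) 0) * T.ham (coupleVal c).1 B p)) - (coupleVal c).1) ∧
    f - hT.toLoc.defect c ∈ hT.toLoc.null := by
  set X := evo 1 (shift w)
  set Z := hT.toLoc.ham c.1
  refine ⟨∑ A, ∑ B, ((1 / 2 : ℝ) * T.σ⁻¹ A B) • (Z A * w B + crd (.jet (.z A) 0) * X (Z B)) -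
    hT.toLoc.var c hT.toLoc.H -
    X (∑ A, ∑ B, ((1 / 2 : ℝ) * T.σ⁻¹ A B) • (crd (.jet (.z A) 0) * Z B) - c.1), ?_, ?_⟩
  · have e : (fun p : Jet n N m => ∑ A, ∑ B, (1 / 2 : ℝ) * T.σ⁻¹ A B *
        (p (.jet (.z A) 0) * T.ham (coupleVal c).1 B p)) - (coupleVal c).1 =
        (∑ A, ∑ B, ((1 / 2 : ℝ) * T.σ⁻¹ A B) • (crd (.jet (.z A) 0) * Z B) - c.1).val := by
      rw [show (coupleVal c).1 = c.1.val from rfl]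
      funext p
      simp [hT.ham_val, Z]
    rw [e, timeD_val, lagrangianVar, ← hT.val_locH, hT.var_val, hT.transf_val, map_sub, map_sub]
    refine congrArg₂ _ (congrArg₂ _ ?_ rfl) rfl
    have hz : ∀ A, (transfVal (hT.toLoc.gen c)).1 A = (Z A).val := fun _ => rfl
    funext p
    simp only [map_sum, map_smul, map_add, map_mul, Finset.sum_apply, Pi.smul_apply, Pi.add_apply,
      Pi.mul_apply, hz, timeD_val, smul_eq_mul, val_crd]
    rfl
  · have hX : ∀ A, X (crd (.jet (.z A) 0)) = w A := fun A => by simp [X, shift]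
    have e1 : ∑ A, ∑ B, ((1 / 2 : ℝ) * T.σ⁻¹ A B) • (Z A * w B + crd (.jet (.z A) 0) * X (Z B)) -
        X (∑ A, ∑ B, ((1 / 2 : ℝ) * T.σ⁻¹ A B) • (crd (.jet (.z A) 0) * Z B)) =
        - dot (zel c.1) w := by
      rw [← hT.sum_inv_sig]
      simp only [map_sum, Derivation.map_smul, Derivation.leibniz, hX, smul_eq_mul,
        ← Finset.sum_sub_distrib, ← smul_sub]
      refine Finset.sum_congr rfl fun A _ => Finset.sum_congr rfl fun B _ => ?_
      congr 1
      change Z A * w B + _ - (_ + Z B * w A) = Z A * w B - w A * Z B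
      ring
    have e2 : X c.1 = hT.toLoc.dt c.1 +
        evo 0 (zchar fun A => w A - hT.toLoc.ham hT.toLoc.H A) c.1 := by
      have := evo_shift_add (hT.toLoc.ham hT.toLoc.H)
        (fun A => w A - hT.toLoc.ham hT.toLoc.H A) c.1
      simp only [add_sub_cancel] at this
      exact this
    have e3 := hT.toLoc.parts (zchar fun A => w A - hT.toLoc.ham hT.toLoc.H A) (grad c.1)
      (.inr fun u => by
        cases u with
        | z A => exact hw A
        | lam a l => intro I; simp [zchar])
    have e4 : Finsupp.linearCombination (Loc n N m)
        (zchar fun A => w A - hT.toLoc.ham hT.toLoc.H A) (el c.1) =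
        dot (zel c.1) w - hT.toLoc.pois (zel c.1) (zel hT.toLoc.H) := by
      have : Finsupp.linearCombination (Loc n N m)
          (zchar fun A => w A - hT.toLoc.ham hT.toLoc.H A) (lamPart (el c.1)) = 0 := by
        rw [Finsupp.linearCombination_apply]
        refine Finset.sum_eq_zero fun u _ => ?_
        cases u <;> simp [zchar]
      rw [linearCombination_split, this, add_zero]
      simp [dot, zchar, mul_sub, LocTheory.pois, LocTheory.ham, zel]
    change evo 0 _ c.1 - Finsupp.linearCombination (Loc n N m) _ (el c.1) ∈ _ at e3
    rw [e4] at e3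
    convert e3 using 1
    rw [map_sub, LocTheory.defect, e2]
    linear_combination e1

theorem action_iff (c : Loc n N m × (Fin m → Loc n N m)) (V : Fin n → Loc n N m) :
    (∀ w, T.Velocity w → T.IsNull (T.lagrangianVar w (T.transf (coupleVal c)) -
      timeD w ((fun p => ∑ A, ∑ B, (1 / 2 : ℝ) * T.σ⁻¹ A B *
        (p (.jet (.z A) 0) * T.ham (coupleVal c).1 B p)) - (coupleVal c).1) -
          divg fun i => (V i).val)) ↔
    hT.toLoc.defect c - ∑ i, tot i (V i) ∈ hT.toLoc.null := by
  constructor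
  · intro h
    have hw : ∀ A, hT.toLoc.BFlat (hT.toLoc.ham hT.toLoc.H A - hT.toLoc.ham hT.toLoc.H A) :=
      fun A I => by simp
    obtain ⟨f, hf, hf'⟩ := hT.action_sub_defect c _ hw
    have := h _ ((hT.velocity_iff _).2 hw)
    rw [← hf, divg_val, ← map_sub, hT.isNull_iff] at this
    convert sub_mem this hf' using 1
    ring
  · intro h w hv
    obtain ⟨w, rfl⟩ : ∃ w' : Fin N → Loc n N m, w = fun A => (w' A).val :=
      ⟨fun A => .mk (w A) (hv.1 A), rfl⟩
    obtain ⟨f, hf, hf'⟩ := hT.action_sub_defect c w ((hT.velocity_iff w).1 hv)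
    rw [← hf, divg_val, ← map_sub, hT.isNull_iff]
    convert add_mem h hf' using 1
    ring

theorem isExternal_iff (c : Loc n N m × (Fin m → Loc n N m)) :
    T.IsExternal (coupleVal c) ↔ hT.toLoc.Ext c := by
  have hs : (∀ v, T.PreservesInternal v → ∀ α,
      T.BZero (T.tilde (T.transf (coupleVal c)) (evol v (T.χ α)) -
        evol v (T.tilde (T.transf (coupleVal c)) (T.χ α)))) ↔
      ∀ v, hT.toLoc.Pres v → ∀ α, hT.toLoc.var c (evo 0 v (hT.toLoc.χ α)) -
        evo 0 v (hT.toLoc.var c (hT.toLoc.χ α)) ∈ hT.toLoc.bweak := by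
    rw [hT.forall_preservesInternal]
    refine forall₃_congr fun v _ α => ?_
    rw [show T.χ α = (hT.toLoc.χ α).val from rfl, evol_val, hT.var_val, hT.var_val, evol_val,
      ← map_sub, hT.bZero_iff]
  constructor
  · rintro ⟨-, -, h1, h2, V, hV, h3, h4⟩
    obtain ⟨V, rfl⟩ : ∃ V' : Fin n → Loc n N m, V = fun i => (V' i).val :=
      ⟨fun i => .mk (V i) (hV i), rfl⟩
    refine ⟨hs.1 h1, (hT.hasVariation_iff c.1).1 h2, V, ?_, (hT.action_iff c V).1 h4⟩
    rwa [divg_val, hT.sourceOnly_iff] at h3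
  · rintro ⟨h1, h2, V, h3, h4⟩
    refine ⟨c.1.isLocal, fun a => (c.2 a).isLocal, hs.2 h1, (hT.hasVariation_iff c.1).2 h2,
      fun i => (V i).val, fun i => (V i).isLocal, ?_, (hT.action_iff c V).2 h4⟩
    rwa [divg_val, hT.sourceOnly_iff]

theorem weaklyZero_iff (g : Loc n N m) : T.WeaklyZero g.val ↔ hT.toLoc.WZero g := by
  constructor
  · rintro ⟨e, he, h1, h2⟩
    refine ⟨.mk e he, (hT.weak_iff _).1 h1, (hT.isNull_iff _).1 ?_⟩
    rw [map_sub]; exact h2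
  · rintro ⟨e, h1, h2⟩
    refine ⟨e.val, e.isLocal, (hT.weak_iff _).2 h1, ?_⟩
    rw [← map_sub]; exact (hT.isNull_iff _).2 h2

theorem isProper_iff (c : Loc n N m × (Fin m → Loc n N m)) :
    T.IsProper (coupleVal c) ↔ hT.toLoc.Proper c := by
  have hi : ∀ α, (T.BZero (T.tilde (T.transf (coupleVal c)) (T.χ α)) ↔
      hT.toLoc.var c (hT.toLoc.χ α) ∈ hT.toLoc.bweak) := fun α => by
    rw [show T.χ α = (hT.toLoc.χ α).val from rfl, hT.var_val, hT.bZero_iff]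
  exact ⟨fun h => ⟨(hT.isExternal_iff c).1 h.external, fun α => (hi α).1 (h.internal α),
      (hT.weaklyZero_iff _).1 h.weak⟩,
    fun h => ⟨(hT.isExternal_iff c).2 h.ext, fun α => (hi α).2 (h.internal α),
      (hT.weaklyZero_iff _).2 h.wzero⟩⟩

theorem cbr_val (c₁ c₂ : Loc n N m × (Fin m → Loc n N m)) :
    T.cbr (coupleVal c₁) (coupleVal c₂) = coupleVal (hT.toLoc.br c₁ c₂) := by
  refine Prod.ext ?_ (funext fun a => ?_)
  · change T.tilde _ c₂.1.val - T.tilde _ c₁.1.val - T.poisson c₂.1.val c₁.1.val = _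
    rw [hT.var_val, hT.var_val, hT.poisson_val, ← map_sub, ← map_sub]; rfl
  · change T.tilde _ (c₂.2 a).val - T.tilde _ (c₁.2 a).val = _
    rw [hT.var_val, hT.var_val, ← map_sub]; rfl

theorem jacobiator_val (c₁ c₂ c₃ : Loc n N m × (Fin m → Loc n N m)) :
    T.jacobiator (coupleVal c₁) (coupleVal c₂) (coupleVal c₃) =
      coupleVal (hT.toLoc.jac c₁ c₂ c₃) := by
  rw [jacobiator, hT.cbr_val, hT.cbr_val, hT.cbr_val, hT.cbr_val, hT.cbr_val, hT.cbr_val,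
    ← map_add, ← map_add]; rfl

end GaugeData.IsGaugeTheory

/-! ### The bracket of transformations -/

namespace LocTheory

variable {ι : Type*} (T : LocTheory n N m ι)

/-- The transformations that vanish over the region. -/
def vanishT : Submodule ℝ ((Fin N → Loc n N m) × (Fin m → Loc n N m)) where
  carrier := {t | (∀ A, t.1 A ∈ vanish T.reg) ∧ ∀ a, t.2 a ∈ vanish T.reg}
  zero_mem' := by simp
  add_mem' h h' := ⟨fun A => add_mem (h.1 A) (h'.1 A), fun a => add_mem (h.2 a) (h'.2 a)⟩
  smul_mem' r _ h := ⟨fun A => Submodule.smul_of_tower_mem _ r (h.1 A),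
    fun a => Submodule.smul_of_tower_mem _ r (h.2 a)⟩

/-- The density `φ_a Λ^a`. -/
def phiLam (Λ : Fin m → Loc n N m) : Loc n N m := ∑ a, T.φ a * Λ a

theorem el_phiLam (Λ : Fin m → Loc n N m) (a : Fin m) (l : ℕ) :
    el (T.phiLam Λ) (.lam a l) = ∑ b, adj (Λ b) (T.φ b) (.lam a l) := by
  have : ∀ k : Fin m → Loc n N m, el (∑ i, k i) = ∑ i, el (k i) := fun k => by simp [el]
  rw [phiLam, this, Finsupp.finsetSum_apply]
  exact Finset.sum_congr rfl fun b _ => by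
    rw [el_mul, Finsupp.add_apply, T.adj_φ_lam, zero_add]

/-- The first half of the bracket of transformations, where the orders of the time derivatives of
the multipliers are bounded by `L`. -/
def halfLoc (L : ℕ) (t₁ t₂ : (Fin N → Loc n N m) × (Fin m → Loc n N m)) (A : Fin N) : Loc n N m :=
  evo 0 (T.tch t₁) (t₂.1 A) + ∑ l ∈ Finset.range L, ∑ k ∈ Finset.range l, ∑ D, ∑ a, T.σ A D •
    adj (T.dt^[k] (t₁.2 a))
      ((-1 : ℝ) ^ (l - 1 - k) • T.dt^[l - 1 - k] (el (T.phiLam t₂.2) (.lam a l))) (.z D)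

theorem dt_mem_vanish {f : Loc n N m} (hf : f ∈ vanish T.reg) : T.dt f ∈ vanish T.reg :=
  evo_mem_vanish _ _ hf

theorem dt_iterate_mem_vanish (k : ℕ) {f : Loc n N m} (hf : f ∈ vanish T.reg) :
    T.dt^[k] f ∈ vanish T.reg := by
  induction k with
  | zero => exact hf
  | succ k ih => rw [Function.iterate_succ_apply']; exact T.dt_mem_vanish ih

theorem evo_char_mem_vanish {Q : Fld N m → Loc n N m} (hQ : ∀ u, Q u ∈ vanish T.reg)
    (f : Loc n N m) : evo 0 Q f ∈ vanish T.reg := by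
  refine vf_mem fun c => Ideal.mul_mem_left _ _ ?_
  cases c with
  | t => simp [evoCoef]
  | x i => simp [evoCoef]
  | jet u I => exact T.totI_mem_vanish I (hQ u)

theorem adj_sub_mem_vanish {f f' w w' : Loc n N m} (hf : f - f' ∈ vanish T.reg)
    (hw : w - w' ∈ vanish T.reg) (u : Fld N m) : adj f w u - adj f' w' u ∈ vanish T.reg := by
  have h1 : adj (f - f') w u ∈ vanish T.reg := eul_mem T.tot_mem_vanish_reg (fun c => by
    rw [Finsupp.smul_apply, smul_eq_mul]
    exact Ideal.mul_mem_left _ _ (pdl_mem_vanish T.ρ_smooth T.ρ_regular hf c)) u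
  have h2 := adj_mem T.tot_mem_vanish_reg f' hw u
  have e : adj (f - f') w = adj f w - adj f' w := by simp [adj, smul_sub]
  rw [e, Finsupp.sub_apply] at h1
  rw [adj_sub_right, Finsupp.sub_apply] at h2
  convert add_mem h1 h2 using 1
  ring

theorem tch_sub_mem_vanish {t t' : (Fin N → Loc n N m) × (Fin m → Loc n N m)}
    (h : t - t' ∈ T.vanishT) (u : Fld N m) : T.tch t u - T.tch t' u ∈ vanish T.reg := by
  cases u with
  | z A => exact h.1 A
  | lam a l =>
    simp only [tch]
    rw [← dt_iterate_sub]
    exact T.dt_iterate_mem_vanish l (h.2 a)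

theorem evo_tch_sub_mem_vanish {t t' : (Fin N → Loc n N m) × (Fin m → Loc n N m)}
    (h : t - t' ∈ T.vanishT) {f f' : Loc n N m} (hf : f - f' ∈ vanish T.reg) :
    evo 0 (T.tch t) f - evo 0 (T.tch t') f' ∈ vanish T.reg := by
  have h1 := evo_mem_vanish 0 (T.tch t) hf
  have h2 := T.evo_char_mem_vanish (T.tch_sub_mem_vanish h) f'
  have h3 := evo_add 0 0 (fun u => T.tch t u - T.tch t' u) (T.tch t') f'
  simp only [sub_add_cancel, add_zero] at h3
  rw [map_sub] at h1
  convert add_mem h1 h2 using 1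
  linear_combination h3

/-- The bracket of transformations over the region depends on the transformations over the region
only. -/
theorem halfLoc_sub_mem_vanish (L : ℕ) {t₁ t₁' t₂ t₂' : (Fin N → Loc n N m) × (Fin m → Loc n N m)}
    (h₁ : t₁ - t₁' ∈ T.vanishT) (h₂ : t₂ - t₂' ∈ T.vanishT) (A : Fin N) :
    T.halfLoc L t₁ t₂ A - T.halfLoc L t₁' t₂' A ∈ vanish T.reg := by
  rw [halfLoc, halfLoc, add_sub_add_comm]
  refine add_mem (T.evo_tch_sub_mem_vanish h₁ (h₂.1 A)) ?_
  simp only [← Finset.sum_sub_distrib, ← smul_sub]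
  refine Submodule.sum_mem _ fun l _ => Submodule.sum_mem _ fun k _ =>
    Submodule.sum_mem _ fun D _ => Submodule.sum_mem _ fun a _ => Submodule.smul_of_tower_mem _ (T.σ A D)
      (T.adj_sub_mem_vanish (T.tch_sub_mem_vanish h₁ (.lam a k)) ?_ _)
  rw [← smul_sub, ← dt_iterate_sub]
  refine Submodule.smul_of_tower_mem _ _ (T.dt_iterate_mem_vanish _ ?_)
  have e : el (T.phiLam t₂.2) (.lam a l) - el (T.phiLam t₂'.2) (.lam a l) =
      el (T.phiLam (t₂ - t₂').2) (.lam a l) := by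
    rw [← Finsupp.sub_apply, ← el_sub]
    simp [phiLam, mul_sub]
  rw [e]
  exact T.el_mem_vanish_of_mem_vanish
    (Submodule.sum_mem _ fun b _ => Ideal.mul_mem_left _ _ (h₂.2 b)) _

theorem exists_order_bound (e : Fld N m →₀ Loc n N m) :
    ∃ L, ∀ L', L ≤ L' → ∀ a l, L' ≤ l → e (.lam a l) = 0 := by
  classical
  refine ⟨e.support.sup (fun u => match u with
    | .z _ => 0
    | .lam _ l => l + 1), fun L' hL a l hl => ?_⟩
  by_contra h
  have := Finset.le_sup (f := fun u : Fld N m => match u with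
    | .z _ => 0
    | .lam _ l => l + 1) (Finsupp.mem_support_iff.2 h)
  simp only at this
  omega

variable {T} {c₁ c₂ : Loc n N m × (Fin m → Loc n N m)}

/-- Over the region, the derivatives of the generator with respect to the multipliers are
determined by the transformation of the multipliers, by downward recursion in the order. -/
theorem Ext.el_lam_sub_sum_mem (h : T.Ext c₂) (L : ℕ) (hL : ∀ a l, L ≤ l → el c₂.1 (.lam a l) = 0)
    (hL' : ∀ a l, L ≤ l → el (T.phiLam c₂.2) (.lam a l) = 0) (a : Fin m) (k : ℕ) :
    el c₂.1 (.lam a k) - ∑ l ∈ Finset.range L, (if k < l then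
      (-1 : ℝ) ^ (l - 1 - k) • T.dt^[l - 1 - k] (el (T.phiLam c₂.2) (.lam a l)) else 0) ∈
        vanish T.reg := by
  have key : ∀ j k, L ≤ k + j → el c₂.1 (.lam a k) - ∑ l ∈ Finset.range L, (if k < l then
      (-1 : ℝ) ^ (l - 1 - k) • T.dt^[l - 1 - k] (el (T.phiLam c₂.2) (.lam a l)) else 0) ∈
        vanish T.reg := by
    intro j
    induction j with
    | zero =>
      intro k hk
      rw [hL a k hk, Finset.sum_eq_zero fun l hl => if_neg (by
        have := Finset.mem_range.1 hl; omega), sub_zero]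
      exact zero_mem _
    | succ j ih =>
      intro k hk
      have h1 := h.el_lam_succ a k
      have h2 := T.dt_mem_vanish (ih (k + 1) (by omega))
      rw [← el_phiLam] at h1
      have e : ∑ l ∈ Finset.range L, (if k < l then
          (-1 : ℝ) ^ (l - 1 - k) • T.dt^[l - 1 - k] (el (T.phiLam c₂.2) (.lam a l)) else 0) =
          el (T.phiLam c₂.2) (.lam a (k + 1)) - T.dt (∑ l ∈ Finset.range L, (if k + 1 < l then
            (-1 : ℝ) ^ (l - 1 - (k + 1)) • T.dt^[l - 1 - (k + 1)]
              (el (T.phiLam c₂.2) (.lam a l)) else 0)) := by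
        have e1 : el (T.phiLam c₂.2) (.lam a (k + 1)) = ∑ l ∈ Finset.range L,
            if l = k + 1 then el (T.phiLam c₂.2) (.lam a l) else 0 := by
          rw [Finset.sum_ite_eq']
          split_ifs with hk
          · rfl
          · exact hL' a _ (by simpa using hk)
        rw [e1, map_sum, ← Finset.sum_sub_distrib]
        refine Finset.sum_congr rfl fun l _ => ?_
        rcases lt_trichotomy l (k + 1) with hl | rfl | hl
        · rw [if_neg (by omega), if_neg (by omega), if_neg (by omega)]; simp
        · simp
        · obtain ⟨i, rfl⟩ : ∃ i, l = k + 1 + 1 + i := ⟨l - (k + 1 + 1), by omega⟩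
          rw [if_pos (by omega), if_neg (by omega), if_pos (by omega),
            show k + 1 + 1 + i - 1 - k = i + 1 by omega,
            show k + 1 + 1 + i - 1 - (k + 1) = i by omega, Function.iterate_succ_apply',
            Derivation.map_smul, pow_succ]
          simp
      rw [e]
      rw [map_sub] at h2
      convert sub_mem h1 h2 using 1
      ring
  exact key L k (by omega)

theorem lamAdj_eq_sum (T : LocTheory n N m ι) (c₁ c₂ : Loc n N m × (Fin m → Loc n N m)) (L : ℕ)
    (hL : ∀ a l, L ≤ l → el c₂.1 (.lam a l) = 0) (u : Fld N m) :
    T.lamAdj c₁ c₂ u = ∑ k ∈ Finset.range L,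
      ∑ a, adj (T.dt^[k] (c₁.2 a)) (el c₂.1 (.lam a k)) u := by
  classical
  have hinj : Function.Injective fun s : ℕ × Fin m => (Fld.lam s.2 s.1 : Fld N m) := by
    rintro ⟨k, a⟩ ⟨k', a'⟩ h
    cases h; rfl
  rw [lamAdj, Finsupp.sum_of_support_subset _
    (s := (Finset.range L ×ˢ Finset.univ).image fun s : ℕ × Fin m => (Fld.lam s.2 s.1 : Fld N m))
    _ _ (by simp), Finset.sum_image fun a _ b _ h => hinj h, Finset.sum_product,
    Finsupp.finsetSum_apply]
  · refine Finset.sum_congr rfl fun k _ => ?_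
    rw [Finsupp.finsetSum_apply]
    refine Finset.sum_congr rfl fun a _ => ?_
    rw [lamPart_lam]; rfl
  · intro u hu
    rw [Finsupp.mem_support_iff] at hu
    cases u with
    | z A => simp at hu
    | lam a l =>
      rw [lamPart_lam] at hu
      refine Finset.mem_image_of_mem (fun s : ℕ × Fin m => (Fld.lam s.2 s.1 : Fld N m))
        (a := (l, a)) ?_
      simp only [Finset.mem_product, Finset.mem_range, Finset.mem_univ, and_true]
      by_contra h
      exact hu (hL a l (by omega))

/-- Over the region, the explicit correction in the bracket of transformations is the one that
comes from the Euler-Lagrange derivatives of the bracket of generators. -/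
theorem Ext.halfLoc_sub_mem (h : T.Ext c₂) (L : ℕ) (hL : ∀ a l, L ≤ l → el c₂.1 (.lam a l) = 0)
    (hL' : ∀ a l, L ≤ l → el (T.phiLam c₂.2) (.lam a l) = 0)
    (c₁ : Loc n N m × (Fin m → Loc n N m)) (A : Fin N) :
    T.halfLoc L (T.gen c₁) (T.gen c₂) A -
      (T.var c₁ (T.ham c₂.1 A) + T.sig (fun D => T.lamAdj c₁ c₂ (.z D)) A) ∈ vanish T.reg := by
  have e : ∑ l ∈ Finset.range L, ∑ k ∈ Finset.range l, ∑ D, ∑ a, T.σ A D •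
      adj (T.dt^[k] (c₁.2 a))
        ((-1 : ℝ) ^ (l - 1 - k) • T.dt^[l - 1 - k] (el (T.phiLam c₂.2) (.lam a l))) (.z D) =
      ∑ D, T.σ A D • ∑ k ∈ Finset.range L, ∑ a, adj (T.dt^[k] (c₁.2 a))
        (∑ l ∈ Finset.range L, (if k < l then
      (-1 : ℝ) ^ (l - 1 - k) • T.dt^[l - 1 - k] (el (T.phiLam c₂.2) (.lam a l)) else 0))
        (.z D) := by
    have e1 : ∀ l ∈ Finset.range L, ∀ F : ℕ → Loc n N m, ∑ k ∈ Finset.range l, F k =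
        ∑ k ∈ Finset.range L, if k < l then F k else 0 := by
      intro l hl F
      rw [← Finset.sum_filter]
      refine Finset.sum_congr ?_ fun _ _ => rfl
      ext k
      have := Finset.mem_range.1 hl
      simp only [Finset.mem_range, Finset.mem_filter]
      omega
    rw [Finset.sum_congr rfl fun l hl => e1 l hl _, Finset.sum_comm]
    simp only [Finset.smul_sum, adj_sum_right, Finsupp.finsetSum_apply]
    rw [Finset.sum_comm (s := Finset.univ)]
    refine Finset.sum_congr rfl fun k _ => ?_
    have e2 : ∀ l, (if k < l then ∑ D, ∑ a, T.σ A D • adj (T.dt^[k] (c₁.2 a))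
        ((-1 : ℝ) ^ (l - 1 - k) • T.dt^[l - 1 - k] (el (T.phiLam c₂.2) (.lam a l))) (.z D) else 0) =
        ∑ D, ∑ a, T.σ A D • adj (T.dt^[k] (c₁.2 a)) (if k < l then
        (-1 : ℝ) ^ (l - 1 - k) • T.dt^[l - 1 - k] (el (T.phiLam c₂.2) (.lam a l)) else 0)
          (.z D) := by
      intro l
      split_ifs <;> simp
    simp only [e2]
    rw [Finset.sum_comm]
    exact Finset.sum_congr rfl fun D _ => Finset.sum_comm
  have e3 : T.halfLoc L (T.gen c₁) (T.gen c₂) A = T.var c₁ (T.ham c₂.1 A) + _ :=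
    congrArg₂ (· + ·) rfl e
  rw [e3, add_sub_add_left_eq_sub, sig, ← Finset.sum_sub_distrib]
  refine Submodule.sum_mem _ fun D _ => ?_
  rw [← smul_sub, lamAdj_eq_sum T c₁ c₂ L hL, ← Finset.sum_sub_distrib]
  refine Submodule.smul_of_tower_mem _ (T.σ A D) (Submodule.sum_mem _ fun k _ => ?_)
  rw [← Finset.sum_sub_distrib]
  refine Submodule.sum_mem _ fun a _ => T.adj_sub_mem_vanish (by simp) ?_ _
  rw [← neg_sub]
  exact neg_mem (h.el_lam_sub_sum_mem L hL hL' a k)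

end LocTheory

theorem localTransf_iff (τ : Transf n N m) : GaugeData.LocalTransf τ ↔ ∃ t, transfVal t = τ :=
  ⟨fun h => ⟨(fun A => .mk (τ.1 A) (h.1 A), fun a => .mk (τ.2 a) (h.2 a)), rfl⟩, by
    rintro ⟨t, rfl⟩; exact ⟨fun A => (t.1 A).isLocal, fun a => (t.2 a).isLocal⟩⟩

namespace GaugeData.IsGaugeTheory

variable {ι : Type*} {T : GaugeData n N m ι} (hT : T.IsGaugeTheory)

theorem generates_iff (c : Loc n N m × (Fin m → Loc n N m))
    (t : (Fin N → Loc n N m) × (Fin m → Loc n N m)) :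
    T.Generates (coupleVal c) (transfVal t) ↔ t - hT.toLoc.gen c ∈ hT.toLoc.vanishT := by
  rw [Generates, hT.transf_val]
  exact and_congr (forall_congr' fun A => hT.eqOnRegion_iff _ _)
    (forall_congr' fun a => hT.eqOnRegion_iff _ _)

theorem halfBr_val (t₁ t₂ : (Fin N → Loc n N m) × (Fin m → Loc n N m)) (L : ℕ)
    (hL : ∀ a l, L ≤ l → el (hT.toLoc.phiLam t₂.2) (.lam a l) = 0) (A : Fin N) :
    T.halfBr (transfVal t₁) (transfVal t₂) A = (hT.toLoc.halfLoc L t₁ t₂ A).val := by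
  have e0 : T.phiLam (transfVal t₂).2 = (hT.toLoc.phiLam t₂.2).val := by
    funext p
    simp [GaugeData.phiLam, LocTheory.phiLam, transfVal, toLoc, locφ]
  have e1 : ∀ (a : Fin m) (k l : ℕ) (D : Fin N) (p : Jet n N m),
      adjLin (.z D) (T.deltaT^[k] ((transfVal t₁).2 a)) ((-1 : ℝ) ^ (l - 1 - k) •
        T.deltaT^[l - 1 - k] (euler (.lam a l) (T.phiLam (transfVal t₂).2))) p =
      (adj (hT.toLoc.dt^[k] (t₁.2 a)) ((-1 : ℝ) ^ (l - 1 - k) •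
        hT.toLoc.dt^[l - 1 - k] (el (hT.toLoc.phiLam t₂.2) (.lam a l))) (.z D)).val p := by
    intro a k l D p
    rw [e0, euler_val, hT.deltaT_iterate_val, ← map_smul, ← adjLin_val, ← hT.deltaT_iterate_val]
    rfl
  funext p
  rw [halfBr, LocTheory.halfLoc, map_add, Pi.add_apply, Pi.add_apply]
  refine congrArg₂ _ (congrFun (hT.tilde_val t₁ (t₂.1 A)) p) ?_
  rw [finsum_eq_sum_of_support_subset (s := Finset.range L)]
  · simp only [e1, map_sum, Finset.sum_apply, map_smul, Pi.smul_apply, smul_eq_mul]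
    rfl
  · intro l hl
    rw [Finset.coe_range, Set.mem_Iio]
    by_contra h
    refine hl (Finset.sum_eq_zero fun k _ => Finset.sum_eq_zero fun D _ =>
      Finset.sum_eq_zero fun a _ => ?_)
    have z : ∀ k, hT.toLoc.dt^[k] 0 = 0 := fun k => by
      simp
    rw [e1, hL a l (by omega), z, smul_zero, adj_zero_right]
    simp

/-- The bracket of transformations is, over the region, generated by the modified bracket of the
couples. -/
theorem tbr_val {c₁ c₂ : Loc n N m × (Fin m → Loc n N m)} (h₁ : hT.toLoc.Ext c₁)
    (h₂ : hT.toLoc.Ext c₂) {t₁ t₂ : (Fin N → Loc n N m) × (Fin m → Loc n N m)}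
    (e₁ : t₁ - hT.toLoc.gen c₁ ∈ hT.toLoc.vanishT) (e₂ : t₂ - hT.toLoc.gen c₂ ∈ hT.toLoc.vanishT) :
    ∃ t, transfVal t = T.tbr (transfVal t₁) (transfVal t₂) ∧
      t - hT.toLoc.gen (hT.toLoc.br c₁ c₂) ∈ hT.toLoc.vanishT := by
  obtain ⟨L₁, b₁⟩ := LocTheory.exists_order_bound (el c₁.1)
  obtain ⟨L₂, b₂⟩ := LocTheory.exists_order_bound (el c₂.1)
  obtain ⟨L₃, b₃⟩ := LocTheory.exists_order_bound (el (hT.toLoc.phiLam c₁.2))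
  obtain ⟨L₄, b₄⟩ := LocTheory.exists_order_bound (el (hT.toLoc.phiLam c₂.2))
  obtain ⟨L₅, b₅⟩ := LocTheory.exists_order_bound (el (hT.toLoc.phiLam t₁.2))
  obtain ⟨L₆, b₆⟩ := LocTheory.exists_order_bound (el (hT.toLoc.phiLam t₂.2))
  set L := L₁ + L₂ + L₃ + L₄ + L₅ + L₆ with hL
  refine ⟨(fun A => hT.toLoc.halfLoc L t₁ t₂ A - hT.toLoc.halfLoc L t₂ t₁ A,
    fun a => evo 0 (hT.toLoc.tch t₁) (t₂.2 a) - evo 0 (hT.toLoc.tch t₂) (t₁.2 a)), ?_, ?_, ?_⟩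
  · refine Prod.ext (funext fun A => ?_) (funext fun a => ?_)
    · change (_ - _ : Loc n N m).val = T.halfBr _ _ A - T.halfBr _ _ A
      rw [hT.halfBr_val t₁ t₂ L (b₆ L (by omega)), hT.halfBr_val t₂ t₁ L (b₅ L (by omega)), map_sub]
    · change (_ - _ : Loc n N m).val = T.tilde _ (t₂.2 a).val - T.tilde _ (t₁.2 a).val
      rw [hT.tilde_val, hT.tilde_val, map_sub]
  · intro A
    have s₁ := add_mem (hT.toLoc.halfLoc_sub_mem_vanish L e₁ e₂ A)
      (h₂.halfLoc_sub_mem L (b₂ L (by omega)) (b₄ L (by omega)) c₁ A)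
    have s₂ := add_mem (hT.toLoc.halfLoc_sub_mem_vanish L e₂ e₁ A)
      (h₁.halfLoc_sub_mem L (b₁ L (by omega)) (b₃ L (by omega)) c₂ A)
    have y := LocTheory.ychar_z hT.toLoc c₁ c₂ A
    have y' :
        hT.toLoc.sig (fun B => hT.toLoc.lamAdj c₁ c₂ (.z B) - hT.toLoc.lamAdj c₂ c₁ (.z B)) A =
        hT.toLoc.sig (fun B => hT.toLoc.lamAdj c₁ c₂ (.z B)) A -
          hT.toLoc.sig (fun B => hT.toLoc.lamAdj c₂ c₁ (.z B)) A := by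
      simp [LocTheory.sig, smul_sub]
    rw [y'] at y
    convert sub_mem s₁ s₂ using 1
    change _ - hT.toLoc.ham (hT.toLoc.br c₁ c₂).1 A = _
    change hT.toLoc.ham (hT.toLoc.br c₁ c₂).1 A - (hT.toLoc.var c₁ (hT.toLoc.ham c₂.1 A) -
      hT.toLoc.var c₂ (hT.toLoc.ham c₁.1 A)) = _ at y
    linear_combination -y
  · intro a
    have s₁ := hT.toLoc.evo_tch_sub_mem_vanish e₁ (e₂.2 a)
    have s₂ := hT.toLoc.evo_tch_sub_mem_vanish e₂ (e₁.2 a)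
    convert sub_mem s₁ s₂ using 1
    change _ - (hT.toLoc.var c₁ (c₂.2 a) - hT.toLoc.var c₂ (c₁.2 a)) = _
    simp only [LocTheory.var, LocTheory.gen]
    ring

end GaugeData.IsGaugeTheory

/-! ### Lie algebras of classes -/

/-- A skew bilinear map on `C` that satisfies the Jacobi identity modulo an ideal `P`, together with
a linear map to `M'` that determines a bracket on its image up to elements of `K`, induces Lie
brackets on the quotients and a surjective homomorphism between them. -/
theorem exists_lieBrackets {M M' : Type*} [AddCommGroup M] [Module ℝ M] [AddCommGroup M']
    [Module ℝ M'] {C P : Submodule ℝ M} {S Q K : Submodule ℝ M'} (hPC : P ≤ C) {br : M → M → M}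
    {br' : M' → M' → M'} {r : M → M'} (hC : ∀ c₁ c₂ : C, br c₁ c₂ ∈ C)
    (br_add : ∀ c ∈ C, ∀ c' ∈ C, ∀ d ∈ C, br (c + c') d = br c d + br c' d)
    (br_smul : ∀ s : ℝ, ∀ c ∈ C, ∀ d ∈ C, br (s • c) d = s • br c d)
    (br_swap : ∀ c ∈ C, ∀ d ∈ C, br c d = - br d c)
    (br_mem : ∀ c ∈ C, ∀ γ ∈ P, br c γ ∈ P)
    (jacobi : ∀ c₁ ∈ C, ∀ c₂ ∈ C, ∀ c₃ ∈ C,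
      br (br c₁ c₂) c₃ + br (br c₂ c₃) c₁ + br (br c₃ c₁) c₂ ∈ P)
    (r_add : ∀ c ∈ C, ∀ c' ∈ C, r (c + c') = r c + r c')
    (r_smul : ∀ s : ℝ, ∀ c ∈ C, r (s • c) = s • r c)
    (hS : ∀ τ, τ ∈ S ↔ ∃ c ∈ C, τ - r c ∈ K) (hQ : ∀ τ, τ ∈ Q ↔ ∃ c ∈ P, τ - r c ∈ K)
    (r_br : ∀ c₁ ∈ C, ∀ c₂ ∈ C, ∀ τ₁ τ₂, τ₁ - r c₁ ∈ K → τ₂ - r c₂ ∈ K →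
      br' τ₁ τ₂ - r (br c₁ c₂) ∈ K) :
    ∃ (hS' : ∀ τ₁ τ₂ : S, br' τ₁ τ₂ ∈ S) (hCS : ∀ c : C, r c ∈ S)
      (B : (C ⧸ P.submoduleOf C) →ₗ[ℝ] (C ⧸ P.submoduleOf C) →ₗ[ℝ] (C ⧸ P.submoduleOf C))
      (B' : (S ⧸ Q.submoduleOf S) →ₗ[ℝ] (S ⧸ Q.submoduleOf S) →ₗ[ℝ] (S ⧸ Q.submoduleOf S))
      (R : (C ⧸ P.submoduleOf C) →ₗ[ℝ] (S ⧸ Q.submoduleOf S)),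
      (∀ c ∈ C, ∀ γ ∈ P, br c γ ∈ P ∧ br γ c ∈ P) ∧
      (∀ τ ∈ S, ∀ γ ∈ Q, br' τ γ ∈ Q ∧ br' γ τ ∈ Q) ∧
      (∀ c₁ c₂ : C, B (Submodule.Quotient.mk c₁) (Submodule.Quotient.mk c₂) =
        Submodule.Quotient.mk ⟨br c₁ c₂, hC c₁ c₂⟩) ∧
      (∀ τ₁ τ₂ : S, B' (Submodule.Quotient.mk τ₁) (Submodule.Quotient.mk τ₂) =
        Submodule.Quotient.mk ⟨br' τ₁ τ₂, hS' τ₁ τ₂⟩) ∧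
      (∀ c : C, R (Submodule.Quotient.mk c) = Submodule.Quotient.mk ⟨r c, hCS c⟩) ∧
      IsLieBracket B ∧ IsLieBracket B' ∧
      (∀ x y, R (B x y) = B' (R x) (R y)) ∧ Function.Surjective R ∧
      (∀ x, R x = 0 ↔ ∃ c : C, x = Submodule.Quotient.mk c ∧ r c ∈ K) := by
  have br_mem' : ∀ c ∈ C, ∀ γ ∈ P, br γ c ∈ P := fun c hc γ hγ => by
    rw [br_swap γ (hPC hγ) c hc]; exact neg_mem (br_mem c hc γ hγ)
  have r_neg : ∀ c ∈ C, r (-c) = - r c := fun c hc => by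
    simpa using r_smul (-1) c hc
  have hS' : ∀ τ₁ τ₂ : S, br' τ₁ τ₂ ∈ S := fun τ₁ τ₂ => by
    obtain ⟨c₁, h₁, e₁⟩ := (hS _).1 τ₁.2
    obtain ⟨c₂, h₂, e₂⟩ := (hS _).1 τ₂.2
    exact (hS _).2 ⟨_, hC ⟨c₁, h₁⟩ ⟨c₂, h₂⟩, r_br _ h₁ _ h₂ _ _ e₁ e₂⟩
  have hCS : ∀ c : C, r c ∈ S := fun c => (hS _).2 ⟨c, c.2, by simp⟩
  have hKQ : K ≤ Q := fun τ hτ => (hQ τ).2 ⟨0, zero_mem _, by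
    have : r 0 = 0 := by simpa using r_smul 0 0 (zero_mem _)
    simpa [this] using hτ⟩
  have hPQ : ∀ γ ∈ P, r γ ∈ Q := fun γ hγ => (hQ _).2 ⟨γ, hγ, by simp⟩
  -- the bracket of couples on the quotient
  let b : C →ₗ[ℝ] C →ₗ[ℝ] (C ⧸ P.submoduleOf C) := LinearMap.mk₂ ℝ
    (fun c d => Submodule.Quotient.mk ⟨br c d, hC c d⟩)
    (fun c c' d => congrArg Submodule.Quotient.mk (Subtype.ext (br_add c c.2 c' c'.2 d d.2)))
    (fun s c d => congrArg Submodule.Quotient.mk (Subtype.ext (br_smul s c c.2 d d.2)))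
    (fun c d d' => congrArg Submodule.Quotient.mk (Subtype.ext (by
      change br (c : M) ((d : M) + d') = br c d + br c d'
      rw [br_swap c c.2 _ (add_mem d.2 d'.2), br_add d d.2 d' d'.2 c c.2, br_swap d d.2 c c.2,
        br_swap d' d'.2 c c.2]
      abel)))
    (fun s c d => congrArg Submodule.Quotient.mk (Subtype.ext (by
      change br (c : M) (s • (d : M)) = s • br c d
      rw [br_swap c c.2 _ (Submodule.smul_mem _ s d.2), br_smul s d d.2 c c.2,
        br_swap d d.2 c c.2, smul_neg, neg_neg])))
  let B₁ : (C ⧸ P.submoduleOf C) →ₗ[ℝ] C →ₗ[ℝ] (C ⧸ P.submoduleOf C) :=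
    (P.submoduleOf C).liftQ b fun γ hγ => LinearMap.ext fun d =>
      (Submodule.Quotient.mk_eq_zero _).2 (br_mem' d d.2 γ hγ)
  let B : (C ⧸ P.submoduleOf C) →ₗ[ℝ] (C ⧸ P.submoduleOf C) →ₗ[ℝ] (C ⧸ P.submoduleOf C) :=
    ((P.submoduleOf C).liftQ B₁.flip fun γ hγ => LinearMap.ext fun x => by
      obtain ⟨c, rfl⟩ := Submodule.Quotient.mk_surjective _ x
      exact (Submodule.Quotient.mk_eq_zero _).2 (br_mem c c.2 γ hγ)).flip
  have hB : ∀ c₁ c₂ : C, B (Submodule.Quotient.mk c₁) (Submodule.Quotient.mk c₂) =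
      Submodule.Quotient.mk ⟨br c₁ c₂, hC c₁ c₂⟩ := fun _ _ => rfl
  let ρ : C →ₗ[ℝ] S :=
    { toFun := fun c => ⟨r c, hCS c⟩
      map_add' := fun c c' => Subtype.ext (r_add c c.2 c' c'.2)
      map_smul' := fun s c => Subtype.ext (r_smul s c c.2) }
  let R : (C ⧸ P.submoduleOf C) →ₗ[ℝ] (S ⧸ Q.submoduleOf S) :=
    (P.submoduleOf C).mapQ (Q.submoduleOf S) ρ fun γ hγ => hPQ γ hγ
  have hR : ∀ c : C, R (Submodule.Quotient.mk c) = Submodule.Quotient.mk ⟨r c, hCS c⟩ :=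
    fun _ => rfl
  have mk_eq : ∀ (τ : S) (c : C), (τ : M') - r c ∈ Q →
      (Submodule.Quotient.mk τ : S ⧸ Q.submoduleOf S) = R (Submodule.Quotient.mk c) :=
    fun τ c h => (Submodule.Quotient.eq _).2 h
  have hRs : Function.Surjective R := fun x => by
    obtain ⟨τ, rfl⟩ := Submodule.Quotient.mk_surjective _ x
    obtain ⟨c, hc, e⟩ := (hS _).1 τ.2
    exact ⟨Submodule.Quotient.mk ⟨c, hc⟩, (mk_eq τ ⟨c, hc⟩ (hKQ e)).symm⟩
  have hR0 : ∀ x, R x = 0 ↔ ∃ c : C, x = Submodule.Quotient.mk c ∧ r c ∈ K := by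
    intro x
    constructor
    · intro hx
      obtain ⟨c, rfl⟩ := Submodule.Quotient.mk_surjective _ x
      have hx' : ρ c ∈ Q.submoduleOf S := (Submodule.Quotient.mk_eq_zero _).1 hx
      obtain ⟨γ, hγ, e⟩ := (hQ (r c)).1 hx'
      refine ⟨c - ⟨γ, hPC hγ⟩, (Submodule.Quotient.eq _).2 ?_, ?_⟩
      · rw [sub_sub_cancel]; exact hγ
      · change r ((c : M) - γ) ∈ K
        rw [sub_eq_add_neg, r_add c c.2 (-γ) (neg_mem (hPC hγ)), r_neg γ (hPC hγ),
          ← sub_eq_add_neg]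
        exact e
    · rintro ⟨c, rfl, h⟩
      exact (Submodule.Quotient.mk_eq_zero _).2 (hKQ h)
  -- the bracket of transformations is transported along a linear section
  obtain ⟨σ, hσ⟩ := R.exists_rightInverse_of_surjective (LinearMap.range_eq_top.2 hRs)
  have hσ : ∀ y, R (σ y) = y := fun y => congrArg (fun L => L y) hσ
  -- independence of the section: classes that generate the zero transformation form an ideal
  have hker : ∀ x x' y y', R x = R x' → R y = R y' → R (B x y) = R (B x' y') := by
    have h0 : ∀ x y, R x = 0 → R (B x y) = 0 ∧ R (B y x) = 0 := by
      intro x y hx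
      obtain ⟨c, rfl, hc⟩ := (hR0 x).1 hx
      obtain ⟨d, rfl⟩ := Submodule.Quotient.mk_surjective _ y
      have z : (0 : M') - r (0 : M) ∈ K := by
        have : r 0 = 0 := by simpa using r_smul 0 0 (zero_mem _)
        simp [this]
      have e1 := r_br c c.2 d d.2 0 (r d) (by simpa using hc) (by simp)
      have e2 := r_br 0 (zero_mem _) d d.2 0 (r d) z (by simp)
      have b0 : br 0 (d : M) = 0 := by simpa using br_smul 0 0 (zero_mem _) d d.2
      have r0 : r 0 = 0 := by simpa using r_smul 0 0 (zero_mem _)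
      rw [b0, r0, sub_zero] at e2
      have e3 : r (br c d) ∈ Q := hKQ (by simpa using sub_mem e2 e1)
      refine ⟨(Submodule.Quotient.mk_eq_zero _).2 e3, (Submodule.Quotient.mk_eq_zero _).2 ?_⟩
      change r (br (d : M) c) ∈ Q
      rw [br_swap d d.2 c c.2, r_neg _ (hC c d)]
      exact neg_mem e3
    intro x x' y y' hx hy
    have h1 := (h0 (x - x') y (by rw [map_sub, hx, sub_self])).1
    have h2 := (h0 (y - y') x' (by rw [map_sub, hy, sub_self])).2
    rw [map_sub, LinearMap.sub_apply, map_sub, sub_eq_zero] at h1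
    rw [map_sub, map_sub, sub_eq_zero] at h2
    rw [h1, h2]
  let B' : (S ⧸ Q.submoduleOf S) →ₗ[ℝ] (S ⧸ Q.submoduleOf S) →ₗ[ℝ] (S ⧸ Q.submoduleOf S) :=
    (B.compl₁₂ σ σ).compr₂ R
  have hB'R : ∀ x y, R (B x y) = B' (R x) (R y) := fun x y =>
    hker _ _ _ _ (hσ _).symm (hσ _).symm
  have hB' : ∀ τ₁ τ₂ : S, B' (Submodule.Quotient.mk τ₁) (Submodule.Quotient.mk τ₂) =
      Submodule.Quotient.mk ⟨br' τ₁ τ₂, hS' τ₁ τ₂⟩ := by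
    intro τ₁ τ₂
    obtain ⟨c₁, h₁, e₁⟩ := (hS _).1 τ₁.2
    obtain ⟨c₂, h₂, e₂⟩ := (hS _).1 τ₂.2
    rw [mk_eq τ₁ ⟨c₁, h₁⟩ (hKQ e₁), mk_eq τ₂ ⟨c₂, h₂⟩ (hKQ e₂), ← hB'R, hB]
    exact (mk_eq ⟨br' τ₁ τ₂, hS' τ₁ τ₂⟩ ⟨br c₁ c₂, hC ⟨c₁, h₁⟩ ⟨c₂, h₂⟩⟩
      (hKQ (r_br _ h₁ _ h₂ _ _ e₁ e₂))).symm
  have hlie : IsLieBracket B := by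
    refine ⟨fun x => ?_, fun x y w => ?_⟩
    · obtain ⟨c, rfl⟩ := Submodule.Quotient.mk_surjective _ x
      rw [hB]
      have h2 : (2 : ℝ) • br (c : M) c = 0 := by
        rw [two_smul]
        nth_rewrite 1 [br_swap c c.2 c c.2]
        exact neg_add_cancel _
      have : br (c : M) c = 0 := (smul_eq_zero.1 h2).resolve_left two_ne_zero
      refine (Submodule.Quotient.mk_eq_zero _).2 ?_
      change br (c : M) c ∈ P
      rw [this]
      exact zero_mem _
    · obtain ⟨c₁, rfl⟩ := Submodule.Quotient.mk_surjective _ x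
      obtain ⟨c₂, rfl⟩ := Submodule.Quotient.mk_surjective _ y
      obtain ⟨c₃, rfl⟩ := Submodule.Quotient.mk_surjective _ w
      simp only [hB]
      exact (Submodule.Quotient.mk_eq_zero _).2 (jacobi _ c₁.2 _ c₂.2 _ c₃.2)
  have hlie' : IsLieBracket B' := by
    refine ⟨fun x => ?_, fun x y w => ?_⟩
    · obtain ⟨x, rfl⟩ := hRs x
      rw [← hB'R, hlie.1, map_zero]
    · obtain ⟨x, rfl⟩ := hRs x
      obtain ⟨y, rfl⟩ := hRs y
      obtain ⟨w, rfl⟩ := hRs w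
      simp only [← hB'R]
      rw [← map_add, ← map_add, hlie.2, map_zero]
  refine ⟨hS', hCS, B, B', R, fun c hc γ hγ => ⟨br_mem c hc γ hγ, br_mem' c hc γ hγ⟩,
    fun τ hτ γ hγ => ?_, hB, hB', hR, hlie, hlie', hB'R, hRs, hR0⟩
  obtain ⟨c, hc, e⟩ := (hS _).1 hτ
  obtain ⟨d, hd, e'⟩ := (hQ _).1 hγ
  exact ⟨(hQ _).2 ⟨_, br_mem c hc d hd, r_br _ hc _ (hPC hd) _ _ e e'⟩,
    (hQ _).2 ⟨_, br_mem' c hc d hd, r_br _ (hPC hd) _ hc _ _ e' e⟩⟩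

namespace LocTheory

variable {ι : Type*} (T : LocTheory n N m ι)

/-- The space of couples that generate external symmetries. -/
def extSub : Submodule ℝ (Loc n N m × (Fin m → Loc n N m)) where
  carrier := {c | T.Ext c}
  zero_mem' := Ext.zero T
  add_mem' h h' := h.add h'
  smul_mem' r _ h := h.smul r

/-- The space of couples that generate proper gauge transformations. -/
def propSub : Submodule ℝ (Loc n N m × (Fin m → Loc n N m)) where
  carrier := {c | T.Proper c}
  zero_mem' := Proper.zero T
  add_mem' h h' := h.add h'
  smul_mem' r _ h := h.smul r

/-- The transformation generated by a couple, as a linear map. -/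
def genLin : (Loc n N m × (Fin m → Loc n N m)) →ₗ[ℝ]
    (Fin N → Loc n N m) × (Fin m → Loc n N m) where
  toFun := T.gen
  map_add' c c' := by
    refine Prod.ext (funext fun A => ?_) rfl
    simp [gen, ham, sig, zel, el_add, Finset.sum_add_distrib]
  map_smul' r c := by
    refine Prod.ext (funext fun A => ?_) rfl
    simp [gen, ham, sig, zel, el_smul, Finset.smul_sum, smul_comm r]

end LocTheory

namespace GaugeData.IsGaugeTheory

variable {ι : Type*} {T : GaugeData n N m ι} (hT : T.IsGaugeTheory)

/-- The transformations that are generated, over the region, by the couples of a subspace. -/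
def generated (E : Submodule ℝ (Loc n N m × (Fin m → Loc n N m))) : Submodule ℝ (Transf n N m) :=
  E.map (transfVal ∘ₗ hT.toLoc.genLin) ⊔ hT.toLoc.vanishT.map transfVal

theorem mem_generated {E : Submodule ℝ (Loc n N m × (Fin m → Loc n N m))} {τ : Transf n N m} :
    τ ∈ hT.generated E ↔
      ∃ c ∈ E.map coupleVal, τ - T.transf c ∈ hT.toLoc.vanishT.map transfVal := by
  constructor
  · intro h
    obtain ⟨_, ⟨d, hd, rfl⟩, k, hk, rfl⟩ := Submodule.mem_sup.1 h
    refine ⟨_, ⟨d, hd, rfl⟩, ?_⟩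
    rw [hT.transf_val]
    simpa [LocTheory.genLin] using hk
  · rintro ⟨_, ⟨d, hd, rfl⟩, h⟩
    rw [hT.transf_val] at h
    exact Submodule.mem_sup.2 ⟨_, ⟨d, hd, rfl⟩, _, h, add_sub_cancel _ _⟩

theorem mem_generated_iff_localTransf {E : Submodule ℝ (Loc n N m × (Fin m → Loc n N m))}
    {τ : Transf n N m} : τ ∈ hT.generated E ↔
      LocalTransf τ ∧ ∃ c ∈ E.map coupleVal, T.Generates c τ := by
  rw [mem_generated]
  constructor
  · rintro ⟨_, ⟨d, hd, rfl⟩, k, hk, e⟩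
    have e' : τ = transfVal (hT.toLoc.gen d + k) := by
      rw [map_add, e, ← hT.transf_val]; abel
    rw [e']
    exact ⟨(localTransf_iff _).2 ⟨_, rfl⟩, _, ⟨d, hd, rfl⟩,
      (hT.generates_iff _ _).2 (by simpa using hk)⟩
  · rintro ⟨h, _, ⟨d, hd, rfl⟩, hg⟩
    obtain ⟨t, rfl⟩ := (localTransf_iff τ).1 h
    refine ⟨_, ⟨d, hd, rfl⟩, _, (hT.generates_iff d t).1 hg, ?_⟩
    rw [hT.transf_val, map_sub]

theorem generates_zero_iff (c : Loc n N m × (Fin m → Loc n N m)) :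
    T.Generates (coupleVal c) 0 ↔
      T.transf (coupleVal c) ∈ hT.toLoc.vanishT.map transfVal := by
  rw [← map_zero (transfVal (n := n) (N := N) (m := m)), hT.generates_iff, hT.transf_val, zero_sub,
    Submodule.neg_mem_iff]
  refine ⟨fun h => ⟨_, h, rfl⟩, ?_⟩
  rintro ⟨k, hk, e⟩
  have : k = hT.toLoc.gen c := Prod.ext
    (funext fun A => Loc.val_injective (congrFun (congrArg Prod.fst e) A))
    (funext fun a => Loc.val_injective (congrFun (congrArg Prod.snd e) a))
  rwa [← this]

theorem isExternal_iff_exists (c : Couple n N m) :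
    T.IsExternal c ↔ ∃ d, hT.toLoc.Ext d ∧ coupleVal d = c := by
  constructor
  · intro h
    obtain ⟨d, rfl⟩ := exists_coupleVal h.local_gen h.local_lam
    exact ⟨d, (hT.isExternal_iff d).1 h, rfl⟩
  · rintro ⟨d, h, rfl⟩; exact (hT.isExternal_iff d).2 h

theorem isProper_iff_exists (c : Couple n N m) :
    T.IsProper c ↔ ∃ d, hT.toLoc.Proper d ∧ coupleVal d = c := by
  constructor
  · intro h
    obtain ⟨d, rfl⟩ := exists_coupleVal h.external.local_gen h.external.local_lam
    exact ⟨d, (hT.isProper_iff d).1 h, rfl⟩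
  · rintro ⟨d, h, rfl⟩; exact (hT.isProper_iff d).2 h

/-- The modified bracket and the bracket of transformations induce Lie algebras of classes. -/
theorem exists_classes {T : GaugeData n N m ι} (hT : T.IsGaugeTheory) :
    ∃ (C P : Submodule ℝ (Couple n N m)) (S Q : Submodule ℝ (Transf n N m))
    (hC : ∀ c₁ c₂ : C, T.cbr c₁ c₂ ∈ C) (hS : ∀ τ₁ τ₂ : S, T.tbr τ₁ τ₂ ∈ S)
    (hCS : ∀ c : C, T.transf c ∈ S)
    (B : (C ⧸ P.submoduleOf C) →ₗ[ℝ] (C ⧸ P.submoduleOf C) →ₗ[ℝ] (C ⧸ P.submoduleOf C))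
    (B' : (S ⧸ Q.submoduleOf S) →ₗ[ℝ] (S ⧸ Q.submoduleOf S) →ₗ[ℝ] (S ⧸ Q.submoduleOf S))
    (R : (C ⧸ P.submoduleOf C) →ₗ[ℝ] (S ⧸ Q.submoduleOf S)),
    (∀ c, c ∈ C ↔ T.IsExternal c) ∧ (∀ c, c ∈ P ↔ T.IsProper c) ∧
    (∀ τ, τ ∈ S ↔ T.IsExternalSymmetry τ) ∧ (∀ τ, τ ∈ Q ↔ T.IsProperGauge τ) ∧
    (∀ c ∈ C, ∀ γ ∈ P, T.cbr c γ ∈ P ∧ T.cbr γ c ∈ P) ∧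
    (∀ τ ∈ S, ∀ γ ∈ Q, T.tbr τ γ ∈ Q ∧ T.tbr γ τ ∈ Q) ∧
    (∀ c₁ c₂ : C, B (Submodule.Quotient.mk c₁) (Submodule.Quotient.mk c₂) =
      Submodule.Quotient.mk ⟨T.cbr c₁ c₂, hC c₁ c₂⟩) ∧
    (∀ τ₁ τ₂ : S, B' (Submodule.Quotient.mk τ₁) (Submodule.Quotient.mk τ₂) =
      Submodule.Quotient.mk ⟨T.tbr τ₁ τ₂, hS τ₁ τ₂⟩) ∧
    (∀ c : C, R (Submodule.Quotient.mk c) = Submodule.Quotient.mk ⟨T.transf c, hCS c⟩) ∧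
    IsLieBracket B ∧ IsLieBracket B' ∧
    (∀ x y, R (B x y) = B' (R x) (R y)) ∧ Function.Surjective R ∧
    (∀ x, R x = 0 ↔ ∃ c : C, x = Submodule.Quotient.mk c ∧ T.Generates c 0) := by
  have mC : ∀ c, c ∈ hT.toLoc.extSub.map coupleVal ↔ T.IsExternal c := fun c =>
    (hT.isExternal_iff_exists c).symm
  have mP : ∀ c, c ∈ hT.toLoc.propSub.map coupleVal ↔ T.IsProper c := fun c =>
    (hT.isProper_iff_exists c).symm
  have hC : ∀ c₁ c₂ : hT.toLoc.extSub.map coupleVal,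
      T.cbr c₁ c₂ ∈ hT.toLoc.extSub.map coupleVal := by
    rintro ⟨_, c₁, h₁, rfl⟩ ⟨_, c₂, h₂, rfl⟩
    exact ⟨_, LocTheory.Ext.br h₁ h₂, (hT.cbr_val c₁ c₂).symm⟩
  obtain ⟨hS, hCS, B, B', R, h1, h2, h3, h4, h5, h6, h7, h8, h9, h10⟩ :=
    exists_lieBrackets (C := hT.toLoc.extSub.map coupleVal) (P := hT.toLoc.propSub.map coupleVal)
      (S := hT.generated hT.toLoc.extSub) (Q := hT.generated hT.toLoc.propSub)
      (K := hT.toLoc.vanishT.map transfVal) (br := T.cbr) (br' := T.tbr) (r := T.transf)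
      (Submodule.map_mono fun c hc => LocTheory.Proper.ext hc) hC
      (by
        rintro _ ⟨c, -, rfl⟩ _ ⟨c', -, rfl⟩ _ ⟨d, -, rfl⟩
        rw [← map_add, hT.cbr_val, hT.cbr_val, hT.cbr_val, LocTheory.br_add_left, map_add])
      (by
        rintro s _ ⟨c, -, rfl⟩ _ ⟨d, -, rfl⟩
        rw [← map_smul, hT.cbr_val, hT.cbr_val, LocTheory.br_smul_left, map_smul])
      (by
        rintro _ ⟨c, -, rfl⟩ _ ⟨d, -, rfl⟩
        rw [hT.cbr_val, hT.cbr_val, LocTheory.br_swap, map_neg])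
      (by
        rintro _ ⟨c, hc, rfl⟩ _ ⟨d, hd, rfl⟩
        exact ⟨_, LocTheory.Ext.br_prop hc hd, (hT.cbr_val c d).symm⟩)
      (by
        rintro _ ⟨c₁, h₁, rfl⟩ _ ⟨c₂, h₂, rfl⟩ _ ⟨c₃, h₃, rfl⟩
        exact ⟨_, LocTheory.Ext.jac h₁ h₂ h₃, (hT.jacobiator_val c₁ c₂ c₃).symm⟩)
      (by
        rintro _ ⟨c, -, rfl⟩ _ ⟨c', -, rfl⟩
        rw [← map_add, hT.transf_val, hT.transf_val, hT.transf_val, ← map_add]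
        exact congrArg _ (hT.toLoc.genLin.map_add c c'))
      (by
        rintro s _ ⟨c, -, rfl⟩
        rw [← map_smul, hT.transf_val, hT.transf_val, ← map_smul]
        exact congrArg _ (hT.toLoc.genLin.map_smul s c))
      (fun τ => hT.mem_generated) (fun τ => hT.mem_generated)
      (by
        rintro _ ⟨c₁, h₁, rfl⟩ _ ⟨c₂, h₂, rfl⟩ τ₁ τ₂ ⟨k₁, hk₁, e₁⟩ ⟨k₂, hk₂, e₂⟩
        obtain rfl : τ₁ = transfVal (hT.toLoc.gen c₁ + k₁) := by
          rw [map_add, e₁, ← hT.transf_val]; abel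
        obtain rfl : τ₂ = transfVal (hT.toLoc.gen c₂ + k₂) := by
          rw [map_add, e₂, ← hT.transf_val]; abel
        obtain ⟨t, ht, hk⟩ := hT.tbr_val h₁ h₂ (t₁ := hT.toLoc.gen c₁ + k₁)
          (t₂ := hT.toLoc.gen c₂ + k₂) (by simpa using hk₁) (by simpa using hk₂)
        refine ⟨_, hk, ?_⟩
        rw [map_sub, ht, hT.cbr_val, hT.transf_val])
  refine ⟨_, _, _, _, hC, hS, hCS, B, B', R, mC, mP, fun τ => ?_, fun τ => ?_, h1, h2, h3, h4, h5,
    h6, h7, h8, h9, fun x => ?_⟩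
  · rw [hT.mem_generated_iff_localTransf]
    exact and_congr_right fun _ => exists_congr fun c => and_congr_left fun _ => mC c
  · rw [hT.mem_generated_iff_localTransf]
    exact and_congr_right fun _ => exists_congr fun c => and_congr_left fun _ => mP c
  · rw [h10]
    refine exists_congr fun c => and_congr_right fun _ => ?_
    obtain ⟨_, d, hd, rfl⟩ := c
    exact (hT.generates_zero_iff d).symm

end GaugeData.IsGaugeTheory

/-! ### Functions of the undifferentiated fields -/

theorem adj_mul_left (f g w : Loc n N m) : adj (f * g) w = adj f (g * w) + adj g (f * w) := by
  simp only [adj, Derivation.leibniz, smul_add, smul_smul, map_add]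
  rw [add_comm, mul_comm w g, mul_comm w f]

theorem el_crd (u : Fld N m) : el (crd (.jet u 0) : Loc n N m) = Finsupp.single u 1 := by
  rw [← adj_crd, adj, el, one_smul]

/-- The polynomials in the fields without spatial derivatives. -/
def undiff (n N m : ℕ) : Subalgebra ℝ (Loc n N m) :=
  Algebra.adjoin ℝ (Set.range fun u => crd (.jet u 0))

theorem crd_mem_undiff (u : Fld N m) : crd (.jet u 0) ∈ undiff n N m :=
  Algebra.subset_adjoin ⟨u, rfl⟩

/-- Variations of functions of the undifferentiated fields need no integration by parts. -/
theorem evo_eq_of_mem_undiff {g : Loc n N m} (hg : g ∈ undiff n N m) (v : Fld N m → Loc n N m) :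
    evo 0 v g = Finsupp.linearCombination (Loc n N m) v (el g) := by
  suffices h : (∀ w, adj g w = w • el g) ∧
      evo 0 v g = Finsupp.linearCombination (Loc n N m) v (el g) from h.2
  induction hg using Algebra.adjoin_induction with
  | mem x hx =>
    obtain ⟨u, rfl⟩ := hx
    simp [adj_crd, el_crd]
  | algebraMap r =>
    have h0 : grad (algebraMap ℝ (Loc n N m) r) = 0 := Derivation.map_algebraMap _ r
    simp [adj, el, h0]
  | add f g _ _ hf hg =>
    refine ⟨fun w => ?_, by rw [map_add, hf.2, hg.2, el_add, map_add]⟩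
    rw [el_add, smul_add, ← hf.1, ← hg.1]
    simp [adj]
  | mul f g _ _ hf hg =>
    have e : el (f * g) = g • el f + f • el g := by rw [el_mul, hf.1, hg.1]
    refine ⟨fun w => ?_, ?_⟩
    · rw [adj_mul_left, hf.1, hg.1, e, smul_add, smul_smul, smul_smul, mul_comm g, mul_comm f]
    · rw [Derivation.leibniz, hf.2, hg.2, e, map_add, map_smul, map_smul, add_comm]

/-! ### A theory in which the modified bracket violates the Jacobi identity -/

/-- The theory on the half line with one canonical pair `(q, p)`, the constraint `p`, and neither a
Hamiltonian besides the constraint part nor boundary conditions. -/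
def halfLine (ι : Type*) : GaugeData 1 2 1 ι where
  ρ x := x 0
  σ := !![0, 1; -1, 0]
  φ _ p := p (.jet (.z 1) 0)
  h := 0
  b := 0
  χ := 0

/-- The field `q`. -/
def posn : Loc 1 2 1 := crd (.jet (.z 0) 0)

/-- The momentum `p` conjugate to `q`. -/
def mom : Loc 1 2 1 := crd (.jet (.z 1) 0)

/-- The `l`-th time derivative of the multiplier. -/
def mult (l : ℕ) : Loc 1 2 1 := crd (.jet (.lam 0 l) 0)

theorem posn_mem_undiff : posn ∈ undiff 1 2 1 := crd_mem_undiff _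

theorem mom_mem_undiff : mom ∈ undiff 1 2 1 := crd_mem_undiff _

theorem mult_mem_undiff (l : ℕ) : mult l ∈ undiff 1 2 1 := crd_mem_undiff _

theorem evo_posn (s : ℝ) (Q : Fld 2 1 → Loc 1 2 1) : evo s Q posn = Q (.z 0) := by simp [posn]

theorem evo_mom (s : ℝ) (Q : Fld 2 1 → Loc 1 2 1) : evo s Q mom = Q (.z 1) := by simp [mom]

theorem evo_mult (s : ℝ) (Q : Fld 2 1 → Loc 1 2 1) (l : ℕ) : evo s Q (mult l) = Q (.lam 0 l) := by
  simp [mult]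

namespace halfLine

variable (ι : Type*)

theorem lamPhi_eq : (halfLine ι).lamPhi = (mult 0 * mom).val := by
  funext p
  simp [GaugeData.lamPhi, halfLine, mult, mom]

theorem H_eq : (halfLine ι).H = (mult 0 * mom).val := by
  have h : divg (0 : Fin 1 → JFun 1 2 1) = 0 := by
    refine (divg_val fun _ : Fin 1 => (0 : Loc 1 2 1)).trans ?_
    simp
  rw [GaugeData.H, lamPhi_eq]
  change (0 : JFun 1 2 1) + _ + divg 0 = _
  rw [h, zero_add, add_zero]

theorem isNull_zero : (halfLine ι).IsNull 0 := by
  refine ⟨fun _ => (0 : Loc 1 2 1).val, fun _ => (0 : Loc 1 2 1).isLocal, fun p _ => ?_,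
    ∅, 0, by simp, by simp⟩
  rw [divg_val]
  simp

/-- A Hamiltonian variation changes the constraint `p` only through the derivative of its generator
with respect to `q`. -/
theorem weak_of_el_eq_zero (a : Fin 1) {g : Loc 1 2 1} (hg : el g (.z 0) = 0) :
    (halfLine ι).Weak (evol (GaugeData.zVar ((halfLine ι).ham g.val)) ((halfLine ι).φ a)) := by
  have hz : GaugeData.zVar ((halfLine ι).ham g.val) =
      fun u => (zchar (fun A => ∑ B, (halfLine ι).σ A B • el g (.z B)) u).val := by
    funext u
    cases u with
    | z A => exact GaugeData.ham_val_eq _ g A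
    | lam a l => exact (map_zero _).symm
  have h0 : evo 0 (zchar (fun A => ∑ B, (halfLine ι).σ A B • el g (.z B))) mom = 0 := by
    simp [mom, zchar, halfLine, hg]
  refine ⟨∅, 0, by simp, fun p _ => ?_⟩
  rw [hz, show (halfLine ι).φ a = mom.val from rfl, evol_val, h0]
  simp

theorem isGaugeTheory : (halfLine ι).IsGaugeTheory where
  ρ_smooth := contDiff_apply ℝ ℝ 0
  ρ_regular x _ h := by
    have : HasFDerivAt (halfLine ι).ρ
        (ContinuousLinearMap.proj (R := ℝ) (φ := fun _ : Fin 1 => ℝ) 0) x :=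
      (ContinuousLinearMap.proj (R := ℝ) (φ := fun _ : Fin 1 => ℝ) 0).hasFDerivAt
    rw [this.fderiv] at h
    simpa using congrArg (fun f => f (fun _ => (1 : ℝ))) h
  σ_skew := by
    ext i j
    fin_cases i <;> fin_cases j <;> simp [halfLine]
  σ_unit := by simp [halfLine, Matrix.det_fin_two]
  φ_local _ := mom.isLocal
  φ_dep _ _ _ h := h _ (.inr ⟨1, 0, rfl⟩)
  h_local := (0 : Loc 1 2 1).isLocal
  h_dep _ _ _ := rfl
  b_local _ := (0 : Loc 1 2 1).isLocal
  b_dep _ _ _ _ := rfl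
  χ_local _ := (0 : Loc 1 2 1).isLocal
  χ_dep _ _ _ _ := rfl
  φ_firstClass a := by
    rw [lamPhi_eq]
    exact weak_of_el_eq_zero ι a (by simp [mult, mom, el_mul, adj_crd])
  h_firstClass a := weak_of_el_eq_zero ι a (g := 0) (by rw [el_zero]; rfl)
  H_variation v hv := by
    choose! v' hv' using fun u => (⟨.mk (v u) (hv.isLocal u), rfl⟩ : ∃ f : Loc 1 2 1, f.val = v u)
    obtain rfl : (fun u => (v' u).val) = v := funext hv'
    rw [H_eq, evol_val, GaugeData.IsGaugeTheory.finsum_euler_val, ← map_sub, evo_eq_of_mem_undiff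
      (mul_mem (mult_mem_undiff 0) mom_mem_undiff), sub_self]
    exact isNull_zero ι

/-- The theory in terms of local functions. -/
abbrev loc : LocTheory 1 2 1 ι := (isGaugeTheory ι).toLoc

theorem loc_H : (loc ι).H = mult 0 * mom :=
  Loc.val_injective ((isGaugeTheory ι).val_locH.trans (H_eq ι))

theorem sig_zero (b : Fin 2 → Loc 1 2 1) : (loc ι).sig b 0 = b 1 := by
  change ∑ B, (!![0, 1; -1, 0] : Matrix (Fin 2) (Fin 2) ℝ) 0 B • b B = b 1
  simp

theorem sig_one (b : Fin 2 → Loc 1 2 1) : (loc ι).sig b 1 = - b 0 := by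
  change ∑ B, (!![0, 1; -1, 0] : Matrix (Fin 2) (Fin 2) ℝ) 1 B • b B = - b 0
  simp

theorem zel_H : zel (loc ι).H = ![0, mult 0] := by
  funext A
  rw [loc_H]
  fin_cases A <;> simp [zel, mult, mom, el_mul, adj_crd]

theorem dt_posn : (loc ι).dt posn = mult 0 := by
  rw [LocTheory.dt, evo_posn]
  simp [shift, LocTheory.ham, sig_zero, zel_H]

theorem dt_mom : (loc ι).dt mom = 0 := by
  rw [LocTheory.dt, evo_mom]
  simp [shift, LocTheory.ham, sig_one, zel_H]

/-- The couple with generator `∫ g p` and `δλ = δ_t g`. -/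
def smear (g : Loc 1 2 1) : Loc 1 2 1 × (Fin 1 → Loc 1 2 1) := (g * mom, fun _ => (loc ι).dt g)

theorem var_mult_zero (g : Loc 1 2 1) : (loc ι).var (smear ι g) (mult 0) = (loc ι).dt g := by
  rw [LocTheory.var, evo_mult]
  rfl

/-- The variation of `λ` compensates the change of the constraint part of the Hamiltonian, so that
the action is invariant without boundary terms. -/
theorem ext_smear {g : Loc 1 2 1} (hg : g ∈ undiff 1 2 1) : (loc ι).Ext (smear ι g) where
  source v _ α := by
    have : (loc ι).χ α = 0 := rfl
    simp [this]
  variation v _ := by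
    rw [smear, evo_eq_of_mem_undiff (mul_mem hg mom_mem_undiff), sub_self]
    exact zero_mem _
  action := by
    refine ⟨0, fun v _ => by simp, ?_⟩
    have h1 : (loc ι).var (smear ι g) mom = - zel (g * mom) 0 := by
      rw [LocTheory.var, evo_mom]
      exact sig_one ι _
    have : (loc ι).defect (smear ι g) = 0 := by
      rw [LocTheory.defect, zel_H, loc_H, Derivation.leibniz, var_mult_zero, h1]
      simp only [smear, Derivation.leibniz, dt_mom, LocTheory.pois, dot, Fin.sum_univ_two, sig_zero,
        sig_one, smul_eq_mul]
      simp
      ring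
    simp [this]

/-- The commutator of `δ_t` with the variation generated by `∫ q² p`, on the change of `λ` that
belongs to `∫ q p²`. -/
theorem evo_rchar_posn_sq :
    evo 0 ((loc ι).rchar (smear ι (posn * posn))) ((loc ι).dt (posn * mom)) =
      -(2 * (mult 0 * mult 0 * mom)) := by
  have h0 : (loc ι).rchar (smear ι (posn * posn)) (.z 1) = -(2 * (mom * mult 0)) := by
    have : zel (posn * posn * mom) 0 = 2 * (posn * mom) := by
      simp [posn, mom, zel, el_mul, adj_mul_left, adj_crd]
      ring
    rw [LocTheory.rchar, sig_one, zel_H, smear, this]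
    simp only [two_mul, map_add, Derivation.leibniz, dt_mom, dt_posn]
    simp
  have h1 : (loc ι).rchar (smear ι (posn * posn)) (.lam 0 0) = 0 := rfl
  rw [Derivation.leibniz, dt_mom, dt_posn, smul_zero, zero_add, smul_eq_mul, Derivation.leibniz,
    evo_mom, evo_mult, h0, h1]
  simp only [smul_eq_mul]
  ring

/-- The commutator of `δ_t` with the variation generated by `∫ q p²`, on the change of `λ` that
belongs to `∫ q² p`. -/
theorem evo_rchar_posn_mom :
    evo 0 ((loc ι).rchar (smear ι (posn * mom))) ((loc ι).dt (posn * posn)) =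
      2 * (mult 0 * mult 0 * mom) := by
  have h0 : (loc ι).rchar (smear ι (posn * mom)) (.z 0) = mult 0 * mom := by
    have h : zel (posn * mom * mom) 1 = 2 * (posn * mom) := by
      simp [posn, mom, zel, el_mul, adj_mul_left, adj_crd]
      ring
    have h' : (loc ι).var (smear ι (posn * mom)) (mult 0) = mult 0 * mom := by
      rw [var_mult_zero, Derivation.leibniz, dt_mom, dt_posn]
      simp [mul_comm]
    rw [LocTheory.rchar, sig_zero, zel_H]
    change (loc ι).dt (zel (posn * mom * mom) 1) - (loc ι).var _ (mult 0) = _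
    rw [h, h']
    simp only [two_mul, map_add, Derivation.leibniz, dt_mom, dt_posn, smul_eq_mul]
    ring
  have h1 : (loc ι).rchar (smear ι (posn * mom)) (.lam 0 0) = 0 := rfl
  rw [Derivation.leibniz, dt_posn, smul_eq_mul, map_add, Derivation.leibniz,
    evo_posn, evo_mult, h0, h1]
  simp only [smul_eq_mul]
  ring

/-- Of the three generators only the third depends on a multiplier, `∂_t λ`. So the cyclic sum is
`p` times the value on `∂_t λ` of the difference between bracket and commutator of the first two
variations, which is made of commutators with `δ_t`. -/
theorem jac_fst :
    ((loc ι).jac (smear ι (posn * posn)) (smear ι (posn * mom)) (smear ι (mult 1))).1 =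
      (-4 : ℝ) • (mult 0 * mult 0 * mom * mom) := by
  have hY : (loc ι).ychar (smear ι (posn * posn)) (smear ι (posn * mom)) (.lam 0 1) =
      -(4 * (mult 0 * mult 0 * mom)) := by
    have h1 := (loc ι).dt_var_sub (smear ι (posn * posn)) ((loc ι).dt (posn * mom))
    have h2 := (loc ι).dt_var_sub (smear ι (posn * mom)) ((loc ι).dt (posn * posn))
    rw [evo_rchar_posn_sq] at h1
    rw [evo_rchar_posn_mom] at h2
    change (loc ι).dt ((loc ι).var _ ((loc ι).dt _) - (loc ι).var _ ((loc ι).dt _)) -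
      ((loc ι).var _ ((loc ι).dt ((loc ι).dt _)) - (loc ι).var _ ((loc ι).dt ((loc ι).dt _))) = _
    rw [map_sub]
    linear_combination h1 - h2
  have e1 : ∀ v : Fld 2 1 → Loc 1 2 1, evo 0 v (posn * posn * mom) -
      dot (zel (posn * posn * mom)) (fun A => v (.z A)) = 0 := fun v => by
    simp [posn, mom, dot, zel, el_mul, adj_mul_left, adj_crd]
    ring
  have e2 : ∀ v : Fld 2 1 → Loc 1 2 1, evo 0 v (posn * mom * mom) -
      dot (zel (posn * mom * mom)) (fun A => v (.z A)) = 0 := fun v => by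
    simp [posn, mom, dot, zel, el_mul, adj_mul_left, adj_crd]
    ring
  have e3 : ∀ v : Fld 2 1 → Loc 1 2 1, evo 0 v (mult 1 * mom) -
      dot (zel (mult 1 * mom)) (fun A => v (.z A)) = mom * v (.lam 0 1) := fun v => by
    simp [mult, mom, dot, zel, el_mul, adj_crd]
  rw [LocTheory.jac_fst]
  simp only [smear] at hY ⊢
  rw [e1, e2, e3, hY, neg_smul, ofNat_smul_eq_nsmul ℝ 4, nsmul_eq_mul]
  push_cast
  ring

theorem not_isNull : ¬ (halfLine ι).IsNull ((halfLine ι).jacobiator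
    (coupleVal (smear ι (posn * posn))) (coupleVal (smear ι (posn * mom)))
    (coupleVal (smear ι (mult 1)))).1 := by
  rw [(isGaugeTheory ι).jacobiator_val]
  change ¬ (halfLine ι).IsNull (Loc.val _)
  rw [(isGaugeTheory ι).isNull_iff, jac_fst]
  intro h
  -- the Euler-Lagrange derivative with respect to the multiplier, where all coordinates are one
  have h1 := (loc ι).el_mem_vanish h (.lam 0 0) (fun _ => 1) (by
    change (0 : ℝ) ≤ 1
    exact zero_le_one)
  have h2 : el (mult 0 * mult 0 * mom * mom) (.lam 0 0) =
      mult 0 * mom * mom + mult 0 * mom * mom := by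
    simp [mult, mom, el_mul, adj_mul_left, adj_crd]
    ring
  rw [el_smul, Finsupp.smul_apply, h2] at h1
  simp [mult, mom] at h1

end halfLine

end GaugeBracket

end

open GaugeBracket in
theorem mainTheorem10 {ι : Type*} :
    (∀ (n N m : ℕ) (T : GaugeData n N m ι), T.IsGaugeTheory →
      (∀ c₁ c₂ c₃, T.IsExternal c₁ → T.IsExternal c₂ → T.IsExternal c₃ →
        T.WeaklyZero (T.jacobiator c₁ c₂ c₃).1 ∧ T.IsProper (T.jacobiator c₁ c₂ c₃)) ∧
      ∃ (C P : Submodule ℝ (Couple n N m)) (S Q : Submodule ℝ (Transf n N m))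
        (hC : ∀ c₁ c₂ : C, T.cbr c₁ c₂ ∈ C) (hS : ∀ τ₁ τ₂ : S, T.tbr τ₁ τ₂ ∈ S)
        (hCS : ∀ c : C, T.transf c ∈ S)
        (B : (C ⧸ P.submoduleOf C) →ₗ[ℝ] (C ⧸ P.submoduleOf C) →ₗ[ℝ] (C ⧸ P.submoduleOf C))
        (B' : (S ⧸ Q.submoduleOf S) →ₗ[ℝ] (S ⧸ Q.submoduleOf S) →ₗ[ℝ] (S ⧸ Q.submoduleOf S))
        (R : (C ⧸ P.submoduleOf C) →ₗ[ℝ] (S ⧸ Q.submoduleOf S)),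
        (∀ c, c ∈ C ↔ T.IsExternal c) ∧ (∀ c, c ∈ P ↔ T.IsProper c) ∧
        (∀ τ, τ ∈ S ↔ T.IsExternalSymmetry τ) ∧ (∀ τ, τ ∈ Q ↔ T.IsProperGauge τ) ∧
        (∀ c ∈ C, ∀ γ ∈ P, T.cbr c γ ∈ P ∧ T.cbr γ c ∈ P) ∧
        (∀ τ ∈ S, ∀ γ ∈ Q, T.tbr τ γ ∈ Q ∧ T.tbr γ τ ∈ Q) ∧
        (∀ c₁ c₂ : C, B (Submodule.Quotient.mk c₁) (Submodule.Quotient.mk c₂) =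
          Submodule.Quotient.mk ⟨T.cbr c₁ c₂, hC c₁ c₂⟩) ∧
        (∀ τ₁ τ₂ : S, B' (Submodule.Quotient.mk τ₁) (Submodule.Quotient.mk τ₂) =
          Submodule.Quotient.mk ⟨T.tbr τ₁ τ₂, hS τ₁ τ₂⟩) ∧
        (∀ c : C, R (Submodule.Quotient.mk c) = Submodule.Quotient.mk ⟨T.transf c, hCS c⟩) ∧
        IsLieBracket B ∧ IsLieBracket B' ∧
        (∀ x y, R (B x y) = B' (R x) (R y)) ∧ Function.Surjective R ∧
        (∀ x, R x = 0 ↔ ∃ c : C, x = Submodule.Quotient.mk c ∧ T.Generates c 0)) ∧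
    (∃ (n N m : ℕ) (T : GaugeData n N m ι) (c₁ c₂ c₃ : Couple n N m),
      T.IsGaugeTheory ∧ T.bdry.Nonempty ∧
      T.IsExternal c₁ ∧ T.IsExternal c₂ ∧ T.IsExternal c₃ ∧
      ¬ T.IsNull (T.jacobiator c₁ c₂ c₃).1) := by
  refine ⟨fun n N m T hT => ⟨fun c₁ c₂ c₃ h₁ h₂ h₃ => ?_, hT.exists_classes⟩, ?_⟩
  · obtain ⟨c₁, e₁, rfl⟩ := (hT.isExternal_iff_exists _).1 h₁
    obtain ⟨c₂, e₂, rfl⟩ := (hT.isExternal_iff_exists _).1 h₂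
    obtain ⟨c₃, e₃, rfl⟩ := (hT.isExternal_iff_exists _).1 h₃
    have h : T.IsProper (T.jacobiator (coupleVal c₁) (coupleVal c₂) (coupleVal c₃)) := by
      rw [hT.jacobiator_val, hT.isProper_iff]
      exact e₁.jac e₂ e₃
    exact ⟨h.weak, h⟩
  · have hT := halfLine.isGaugeTheory ι
    exact ⟨1, 2, 1, halfLine ι, _, _, _, hT, ⟨0, rfl⟩,
      (hT.isExternal_iff _).2 (halfLine.ext_smear ι (mul_mem posn_mem_undiff posn_mem_undiff)),
      (hT.isExternal_iff _).2 (halfLine.ext_smear ι (mul_mem posn_mem_undiff mom_mem_undiff)),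
      (hT.isExternal_iff _).2 (halfLine.ext_smear ι (mult_mem_undiff 1)), halfLine.not_isNull ι⟩
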